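/- Let $k,m\in\mathbb N=\{1,2,\dots\}$, $T>0$ and $\mathbb F\in\{\mathbb R,\mathbb C\}$. Let $\alpha_1,\dots,\alpha_k\in C(\mathbb R,\mathbb F^{m\times m})$ be $T$-periodic with $\alpha_k(x)$ invertible for every $x\in\mathbb R$, and let $\mathcal N\in C(\mathbb F^m\times\mathbb R,\mathbb F^m)$ be $T$-periodic in its second argument and twice continuously differentiable (over $\mathbb F$) in its first argument, with $\partial_u\mathcal N$ continuous on $\mathbb F^m\times\mathbb R$. Put $Au=\sum_{j=1}^k\alpha_j\partial_x^j u$ and consider the stationary equation $$Au+\mathcal N(u,\cdot)=0. \tag{1}$$ For $\underline u\in L^\infty(\mathbb R)$ with values in $\mathbb F^m$, let $\mathcal L(\underline u)u=Au+\partial_u\mathcal N(\underline u,\cdot)u$ be the operator on $L^2(\mathbb R,\mathbb C^m)$ with domain $H^k(\mathbb R,\mathbb C^m)$; if $\underline u$ is continuous and $nT$-periodic, let $\mathcal L_{\rm per}(\underline u)$ be the operator given by the same expression on $L^2_{\rm per}((0,nT),\mathbb C^m)$ with domain $H^k_{\rm per}((0,nT),\mathbb C^m)$. The spectrum $\sigma$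 of such an operator $L$ is the set of $\lambda\in\mathbb C$ for which $L-\lambda$ is not a bijection from the domain onto the space with bounded inverse. Assume: * (H4) $v\in H^k_{\rm per}((0,T),\mathbb F^m)$ and $z\in H^k(\mathbb R,\mathbb F^m)$ are such that $v$ and $z+v$ solve (1); * (H5) $z+v$ is nondegenerate, i.e. $\mathcal L(z+v)$ is invertible (with bounded inverse); * $z+v$ is strongly spectrally stable, i.e. there is $\varrho>0$ with $\sigma(\mathcal L(z+v))\subset\{\lambda\in\mathbb C:\operatorname{Re}\lambda\le-\varrho\}$. Let $C\geq0$ and $N_0\in\mathbb N$, and for every $n\ge N_0$ let $u_n\in H^k_{\rm per}((0,nT),\mathbb F^m)$ be an $nT$-periodic solution of (1) of the form $$u_n(x)=\chi_n(x)z(x)+v(x)+a_n(x),\qquad x\in[-\tfrac n2T,\tfrac n2T),$$ where $a_n\in H^k_{\rm per}((0,nT),\mathbb F^m)$ satisfies $\|a_n\|_{H^k_{\rm per}(0,nT)}\le C\,\|z\|_{H^k(\mathbb R\setminus(-\frac n6T,\frac n6T))}$, and $\chi_n:\mathbb R\to[0,1]$ is smooth and $nT$-periodic with $|\chi_n^{(j)}|\le1$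 for $0\le j\le k$, $\chi_n=1$ on $[-\frac n6T,\frac n6T]$ and $\chi_n=0$ on $[-\frac n2T,-\frac n3T]\cup[\frac n3T,\frac n2T]$. Then the following holds for $\mathcal L_n=\mathcal L(u_n)$, and likewise for $\mathcal L_n=\mathcal L_{\rm per}(u_n)$ (on $L^2_{\rm per}(0,nT)$). If there are a compact set $\mathcal K\subset\mathbb C$ and an integer $N\ge N_0$ with $$\sigma(\mathcal L_n)\cap\{\lambda\in\mathbb C:\operatorname{Re}\lambda\ge0\}\subset\mathcal K\qquad\text{for all } n\ge N,$$ then there exists an integer $N_1\ge N$ such that $\sigma(\mathcal L_n)\subset\{\lambda\in\mathbb C:\operatorname{Re}\lambda<0\}$ for all $n\ge N_1$. -/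

import Mathlib

open MeasureTheory Set Filter
open scoped ENNReal NNReal ContDiff

noncomputable section

namespace PeriodicPulse

section WeakDerivatives

variable {E : Type*} [NormedAddCommGroup E] [NormedSpace ℝ E]

/-- `g` is a weak derivative of `f` on the real line: both are locally integrable and
`∫ φ' f = - ∫ φ g` for all test functions `φ ∈ C_c^∞(ℝ)`. -/
structure IsWeakDeriv (f g : ℝ → E) : Prop where
  left : LocallyIntegrable f volume
  right : LocallyIntegrable g volume
  integral_eq : ∀ φ : ℝ → ℝ, ContDiff ℝ ∞ φ → HasCompactSupport φ →
    ∫ x, deriv φ x • f x = - ∫ x, φ x • g x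

open Classical in
/-- A representative of the weak derivative of `f` (and `0` if there is none). -/
def weakDeriv (f : ℝ → E) : ℝ → E :=
  if h : ∃ g, IsWeakDeriv f g then h.choose else 0

/-- `f` is locally integrable, and its weak derivatives of order `1, …, k` exist. -/
def HasWeakDerivs (k : ℕ) (f : ℝ → E) : Prop :=
  LocallyIntegrable f volume ∧ ∀ j < k, ∃ g, IsWeakDeriv (weakDeriv^[j] f) g

/-- All weak derivatives of `f` on `ℝ` of order at most `k` exist and are square-integrable
with respect to `μ`. For `μ = volume` this is the Sobolev space `H^k(ℝ)`. -/
def MemHk (k : ℕ) (μ : Measure ℝ) (f : ℝ → E) : Prop :=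
  HasWeakDerivs k f ∧ ∀ j ≤ k, MemLp (weakDeriv^[j] f) 2 μ

/-- The Sobolev space `H^k_per(0, L)` of `L`-periodic functions on the real line. -/
def MemHkPer (k : ℕ) (L : ℝ) (f : ℝ → E) : Prop :=
  Function.Periodic f L ∧ MemHk k (volume.restrict (Ico 0 L)) f

/-- The Sobolev norm `(∑_{j ≤ k} ∫_S |f^{(j)}|²)^{1/2}` over the set `S`. -/
def hkNorm (k : ℕ) (S : Set ℝ) (f : ℝ → E) : ℝ≥0∞ :=
  (∑ j ∈ Finset.range (k + 1), eLpNorm (weakDeriv^[j] f) 2 (volume.restrict S) ^ 2) ^ (1 / 2 : ℝ)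

theorem IsWeakDeriv.unique [CompleteSpace E] {f f' g g' : ℝ → E} (h : IsWeakDeriv f g)
    (h' : IsWeakDeriv f' g') (hf : f =ᵐ[volume] f') : g =ᵐ[volume] g' := by
  refine ae_eq_of_integral_contDiff_smul_eq h.right h'.right fun φ hφ hc => ?_
  have h1 : ∫ x, deriv φ x • f x = ∫ x, deriv φ x • f' x := by
    refine integral_congr_ae ?_
    filter_upwards [hf] with x hx
    rw [hx]
  rw [h.integral_eq φ hφ hc, h'.integral_eq φ hφ hc] at h1
  exact neg_injective h1

theorem IsWeakDeriv.congr {f f' g : ℝ → E} (h : IsWeakDeriv f g)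
    (hf : f =ᵐ[volume] f') : IsWeakDeriv f' g where
  left := h.left.congr hf
  right := h.right
  integral_eq φ hφ hc := by
    rw [← h.integral_eq φ hφ hc]
    refine integral_congr_ae ?_
    filter_upwards [hf] with x hx
    rw [hx]

theorem IsWeakDeriv.add {f f' g g' : ℝ → E} (h : IsWeakDeriv f g)
    (h' : IsWeakDeriv f' g') : IsWeakDeriv (f + f') (g + g') where
  left := h.left.add h'.left
  right := h.right.add h'.right
  integral_eq φ hφ hc := by
    have hd : Continuous (deriv φ) := hφ.continuous_deriv (by simp)
    have i1 := h.left.integrable_smul_left_of_hasCompactSupport hd hc.deriv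
    have i2 := h'.left.integrable_smul_left_of_hasCompactSupport hd hc.deriv
    have i3 := h.right.integrable_smul_left_of_hasCompactSupport hφ.continuous hc
    have i4 := h'.right.integrable_smul_left_of_hasCompactSupport hφ.continuous hc
    simp only [Pi.add_apply, smul_add]
    rw [integral_add i1 i2, integral_add i3 i4, h.integral_eq φ hφ hc, h'.integral_eq φ hφ hc]
    abel

theorem IsWeakDeriv.const_smul [NormedSpace ℂ E] {f g : ℝ → E} (c : ℂ)
    (h : IsWeakDeriv f g) : IsWeakDeriv (c • f) (c • g) where
  left := h.left.smul c
  right := h.right.smul c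
  integral_eq φ hφ hc := by
    simp only [Pi.smul_apply]
    simp_rw [smul_comm _ c]
    rw [integral_smul, integral_smul, h.integral_eq φ hφ hc, smul_neg]

theorem isWeakDeriv_weakDeriv {f : ℝ → E} (h : ∃ g, IsWeakDeriv f g) :
    IsWeakDeriv f (weakDeriv f) := by
  unfold weakDeriv
  rw [dif_pos h]
  exact h.choose_spec

theorem HasWeakDerivs.isWeakDeriv {k : ℕ} {f : ℝ → E} (h : HasWeakDerivs k f) {j : ℕ}
    (hj : j < k) : IsWeakDeriv (weakDeriv^[j] f) (weakDeriv^[j + 1] f) := by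
  rw [Function.iterate_succ_apply']
  exact isWeakDeriv_weakDeriv (h.2 j hj)

/-- Weak derivatives are unique up to null sets. -/
theorem hasWeakDerivs_of_tower [CompleteSpace E] {k : ℕ} {f : ℝ → E} {g : ℕ → ℝ → E}
    (hf : LocallyIntegrable f volume) (h0 : f =ᵐ[volume] g 0)
    (hg : ∀ j < k, IsWeakDeriv (g j) (g (j + 1))) :
    HasWeakDerivs k f ∧ ∀ j ≤ k, weakDeriv^[j] f =ᵐ[volume] g j := by
  have key : ∀ j ≤ k, weakDeriv^[j] f =ᵐ[volume] g j := by
    intro j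
    induction j with
    | zero => intro _; exact h0
    | succ j ih =>
      intro hj
      have h1 := (hg j (by omega)).congr (ih (by omega)).symm
      rw [Function.iterate_succ_apply']
      exact (isWeakDeriv_weakDeriv ⟨_, h1⟩).unique h1 (ae_eq_refl _)
  exact ⟨⟨hf, fun j hj => ⟨_, (hg j hj).congr (key j hj.le).symm⟩⟩, key⟩

theorem HasWeakDerivs.add [CompleteSpace E] {k : ℕ} {f f' h : ℝ → E} (hf : HasWeakDerivs k f)
    (hf' : HasWeakDerivs k f') (hh : h =ᵐ[volume] f + f') :
    HasWeakDerivs k h ∧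
      ∀ j ≤ k, weakDeriv^[j] h =ᵐ[volume] weakDeriv^[j] f + weakDeriv^[j] f' :=
  hasWeakDerivs_of_tower (g := fun j => weakDeriv^[j] f + weakDeriv^[j] f')
    ((hf.1.add hf'.1).congr hh.symm) hh
    fun _ hj => (hf.isWeakDeriv hj).add (hf'.isWeakDeriv hj)

theorem HasWeakDerivs.const_smul [NormedSpace ℂ E] [CompleteSpace E] {k : ℕ} {f h : ℝ → E}
    (c : ℂ) (hf : HasWeakDerivs k f) (hh : h =ᵐ[volume] c • f) :
    HasWeakDerivs k h ∧ ∀ j ≤ k, weakDeriv^[j] h =ᵐ[volume] c • weakDeriv^[j] f :=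
  hasWeakDerivs_of_tower (g := fun j => c • weakDeriv^[j] f)
    ((hf.1.smul c).congr hh.symm) hh fun _ hj => (hf.isWeakDeriv hj).const_smul c

end WeakDerivatives

section Operators

/-- The resolvent set of an unbounded operator `A` on `X`: all `lam` such that
`A - lam : D(A) → X` is bijective with bounded inverse `R`. -/
def resolventSet {X : Type*} [NormedAddCommGroup X] [NormedSpace ℂ X] (A : X →ₗ.[ℂ] X) : Set ℂ :=
  {lam | ∃ R : X →L[ℂ] X,
    (∀ f : X, ∃ h : R f ∈ A.domain, A ⟨R f, h⟩ - lam • R f = f) ∧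
    ∀ u : A.domain, R (A u - lam • (u : X)) = u}

/-- The spectrum of an unbounded operator. -/
def spec {X : Type*} [NormedAddCommGroup X] [NormedSpace ℂ X] (A : X →ₗ.[ℂ] X) : Set ℂ :=
  (resolventSet A)ᶜ

variable {m : ℕ}

/-- The differential expression `∑_{j ≤ k} B_j(x) f^{(j)}(x)`. -/
def diffExpr (k : ℕ) (B : ℕ → ℝ → Matrix (Fin m) (Fin m) ℂ)
    (f : ℝ → EuclideanSpace ℂ (Fin m)) (x : ℝ) : EuclideanSpace ℂ (Fin m) :=
  ∑ j ∈ Finset.range (k + 1), Matrix.toEuclideanLin (B j x) (weakDeriv^[j] f x)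

theorem diffExpr_add {k : ℕ} (B : ℕ → ℝ → Matrix (Fin m) (Fin m) ℂ)
    {f f' h : ℝ → EuclideanSpace ℂ (Fin m)} (hf : HasWeakDerivs k f)
    (hf' : HasWeakDerivs k f') (hh : h =ᵐ[volume] f + f') :
    diffExpr k B h =ᵐ[volume] diffExpr k B f + diffExpr k B f' := by
  have h1 : ∀ᵐ x, ∀ j ∈ Finset.range (k + 1),
      weakDeriv^[j] h x = weakDeriv^[j] f x + weakDeriv^[j] f' x := by
    rw [Finset.eventually_all]
    intro j hj
    exact (hf.add hf' hh).2 j (by simpa [Nat.lt_succ_iff] using hj)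
  filter_upwards [h1] with x hx
  simp only [diffExpr, Pi.add_apply, ← Finset.sum_add_distrib]
  exact Finset.sum_congr rfl fun j hj => by rw [hx j hj, map_add]

theorem diffExpr_smul {k : ℕ} (B : ℕ → ℝ → Matrix (Fin m) (Fin m) ℂ) (c : ℂ)
    {f h : ℝ → EuclideanSpace ℂ (Fin m)} (hf : HasWeakDerivs k f) (hh : h =ᵐ[volume] c • f) :
    diffExpr k B h =ᵐ[volume] c • diffExpr k B f := by
  have h1 : ∀ᵐ x, ∀ j ∈ Finset.range (k + 1), weakDeriv^[j] h x = c • weakDeriv^[j] f x := by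
    rw [Finset.eventually_all]
    intro j hj
    exact (hf.const_smul c hh).2 j (by simpa [Nat.lt_succ_iff] using hj)
  filter_upwards [h1] with x hx
  simp only [diffExpr, Pi.smul_apply, Finset.smul_sum]
  exact Finset.sum_congr rfl fun j hj => by rw [hx j hj, map_smul]

/-- The domain of `f ↦ ∑_{j ≤ k} B_j f^{(j)}` on `L²(μ)`, where `e f` is the function on the real
line that is represented by `f ∈ L²(μ)`. It consists of all `f` with `H^k` regularity whose image
lies in `L²(μ)`; the latter condition is automatic if the coefficients are bounded. -/
def diffDomain (μ : Measure ℝ) (hμ : μ ≪ volume)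
    (e : Lp (EuclideanSpace ℂ (Fin m)) 2 μ → ℝ → EuclideanSpace ℂ (Fin m))
    (e_add : ∀ f g, e (f + g) =ᵐ[volume] e f + e g)
    (e_smul : ∀ (c : ℂ) f, e (c • f) =ᵐ[volume] c • e f)
    (k : ℕ) (B : ℕ → ℝ → Matrix (Fin m) (Fin m) ℂ) :
    Submodule ℂ (Lp (EuclideanSpace ℂ (Fin m)) 2 μ) where
  carrier := {f | MemHk k μ (e f) ∧ MemLp (diffExpr k B (e f)) 2 μ}
  add_mem' := by
    rintro f g ⟨⟨hf, hf2⟩, hf3⟩ ⟨⟨hg, hg2⟩, hg3⟩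
    refine ⟨⟨(hf.add hg (e_add f g)).1, fun j hj => ?_⟩, ?_⟩
    · exact ((hf2 j hj).add (hg2 j hj)).ae_eq
        (hμ.ae_le ((hf.add hg (e_add f g)).2 j hj).symm)
    · exact (hf3.add hg3).ae_eq (hμ.ae_le (diffExpr_add B hf hg (e_add f g)).symm)
  zero_mem' := by
    have h0 : e 0 =ᵐ[volume] 0 := by simpa using e_smul 0 0
    have hL : LocallyIntegrable (0 : ℝ → EuclideanSpace ℂ (Fin m)) volume :=
      locallyIntegrable_zero
    have ht := hasWeakDerivs_of_tower (k := k) (f := e 0)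
      (g := fun _ => (0 : ℝ → EuclideanSpace ℂ (Fin m)))
      (hL.congr h0.symm) h0 (fun _ _ => ⟨hL, hL, fun _ _ _ => by simp⟩)
    refine ⟨⟨ht.1, fun j hj => ?_⟩, ?_⟩
    · exact MemLp.zero.ae_eq (hμ.ae_le (ht.2 j hj).symm)
    · have h1 := diffExpr_smul B 0 ht.1 (h := e 0) (by simpa using h0)
      rw [zero_smul] at h1
      exact MemLp.zero.ae_eq (hμ.ae_le h1.symm)
  smul_mem' := by
    rintro c f ⟨⟨hf, hf2⟩, hf3⟩
    refine ⟨⟨(hf.const_smul c (e_smul c f)).1, fun j hj => ?_⟩, ?_⟩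
    · exact ((hf2 j hj).const_smul c).ae_eq
        (hμ.ae_le ((hf.const_smul c (e_smul c f)).2 j hj).symm)
    · exact (hf3.const_smul c).ae_eq (hμ.ae_le (diffExpr_smul B c hf (e_smul c f)).symm)

/-- The operator `f ↦ ∑_{j ≤ k} B_j f^{(j)}` on `L²(μ)`. -/
def diffOp (μ : Measure ℝ) (hμ : μ ≪ volume)
    (e : Lp (EuclideanSpace ℂ (Fin m)) 2 μ → ℝ → EuclideanSpace ℂ (Fin m))
    (e_add : ∀ f g, e (f + g) =ᵐ[volume] e f + e g)
    (e_smul : ∀ (c : ℂ) f, e (c • f) =ᵐ[volume] c • e f)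
    (k : ℕ) (B : ℕ → ℝ → Matrix (Fin m) (Fin m) ℂ) :
    Lp (EuclideanSpace ℂ (Fin m)) 2 μ →ₗ.[ℂ] Lp (EuclideanSpace ℂ (Fin m)) 2 μ where
  domain := diffDomain μ hμ e e_add e_smul k B
  toFun :=
    { toFun := fun f => MemLp.toLp (diffExpr k B (e f.1)) f.2.2
      map_add' := fun f g =>
        (MemLp.toLp_congr (f + g).2.2 (f.2.2.add g.2.2)
          (hμ.ae_le (diffExpr_add B f.2.1.1 g.2.1.1 (e_add f.1 g.1)))).trans
          (MemLp.toLp_add f.2.2 g.2.2)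
      map_smul' := fun c f =>
        (MemLp.toLp_congr (c • f).2.2 (f.2.2.const_smul c)
          (hμ.ae_le (diffExpr_smul B c f.2.1.1 (e_smul c f.1)))).trans
          (MemLp.toLp_const_smul c f.2.2) }

/-- The operator `f ↦ ∑_{j ≤ k} B_j f^{(j)}` on `L²(ℝ)` with domain `H^k(ℝ)`. -/
def lineOp (k : ℕ) (B : ℕ → ℝ → Matrix (Fin m) (Fin m) ℂ) :
    Lp (EuclideanSpace ℂ (Fin m)) 2 (volume : Measure ℝ) →ₗ.[ℂ]
      Lp (EuclideanSpace ℂ (Fin m)) 2 (volume : Measure ℝ) :=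
  diffOp volume Measure.AbsolutelyContinuous.rfl (fun f => f)
    Lp.coeFn_add Lp.coeFn_smul k B

/-- The `L`-periodic extension of the restriction of `f` to `[0, L)`. -/
def perExt (L : ℝ) (f : ℝ → EuclideanSpace ℂ (Fin m)) (x : ℝ) : EuclideanSpace ℂ (Fin m) :=
  (Ico 0 L).indicator f (L * Int.fract (x / L))

theorem perExt_congr {L : ℝ} {f g : ℝ → EuclideanSpace ℂ (Fin m)}
    (h : f =ᵐ[volume.restrict (Ico 0 L)] g) : perExt L f =ᵐ[volume] perExt L g := by
  rcases le_or_gt L 0 with hL | hL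
  · have : perExt L f = perExt L g := by
      funext x
      simp [perExt, Ico_eq_empty (not_lt.mpr hL)]
    rw [this]
  · have h1 : ∀ᵐ x, (Ico 0 L).indicator f x = (Ico 0 L).indicator g x :=
      (ae_eq_restrict_iff_indicator_ae_eq measurableSet_Ico).1 h
    have h2 : ∀ᵐ x, ∀ j : ℤ, (Ico 0 L).indicator f (x - L * j) =
        (Ico 0 L).indicator g (x - L * j) := by
      rw [ae_all_iff]
      intro j
      exact (measurePreserving_sub_right volume (L * j)).quasiMeasurePreserving.ae h1
    filter_upwards [h2] with x hx
    have h3 : L * Int.fract (x / L) = x - L * ⌊x / L⌋ := by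
      unfold Int.fract
      field_simp
    simp only [perExt, h3]
    exact hx _

/-- The operator `f ↦ ∑_{j ≤ k} B_j f^{(j)}` on `L²_per(0, L)` with domain `H^k_per(0, L)`, where
`L²_per(0, L)` is realized as `L²` of the interval `[0, L)`. -/
def perOp (L : ℝ) (k : ℕ) (B : ℕ → ℝ → Matrix (Fin m) (Fin m) ℂ) :
    Lp (EuclideanSpace ℂ (Fin m)) 2 ((volume : Measure ℝ).restrict (Ico 0 L)) →ₗ.[ℂ]
      Lp (EuclideanSpace ℂ (Fin m)) 2 ((volume : Measure ℝ).restrict (Ico 0 L)) :=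
  diffOp (volume.restrict (Ico 0 L)) Measure.restrict_le_self.absolutelyContinuous
    (fun f => perExt L f)
    (fun f g => (perExt_congr (Lp.coeFn_add f g)).trans (ae_of_all _ fun x => by
      exact congrFun (indicator_add (Ico 0 L) (f : ℝ → EuclideanSpace ℂ (Fin m)) g) _))
    (fun c f => (perExt_congr (Lp.coeFn_smul c f)).trans (ae_of_all _ fun x => by
      simp only [perExt, Pi.smul_apply, ← indicator_const_smul_apply]
      rfl)) k B

end Operators

/-- The data of the system `∂_t u = α_k ∂_x^k u + … + α_1 ∂_x u + 𝒩(u, x)` of `m` components with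
`T`-periodic coefficients `α_1, …, α_k` (the values `α j` for other `j` play no role). -/
structure PeriodicSystem (𝔽 : Type*) [RCLike 𝔽] (k m : ℕ) (T : ℝ) where
  α : ℕ → ℝ → Matrix (Fin m) (Fin m) 𝔽
  nonlin : EuclideanSpace 𝔽 (Fin m) → ℝ → EuclideanSpace 𝔽 (Fin m)
  α_continuous : ∀ j ∈ Finset.Icc 1 k, Continuous (α j)
  α_periodic : ∀ j ∈ Finset.Icc 1 k, Function.Periodic (α j) T
  α_invertible : ∀ x, IsUnit (α k x)
  nonlin_continuous : Continuous fun p : EuclideanSpace 𝔽 (Fin m) × ℝ => nonlin p.1 p.2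
  nonlin_contDiff : ∀ x, ContDiff 𝔽 2 fun w => nonlin w x
  nonlin_fderiv_continuous : Continuous fun p : EuclideanSpace 𝔽 (Fin m) × ℝ =>
    fderiv 𝔽 (fun w => nonlin w p.2) p.1
  nonlin_periodic : ∀ w, Function.Periodic (nonlin w) T

namespace PeriodicSystem

variable {𝔽 : Type*} [RCLike 𝔽] {k m : ℕ} {T : ℝ} (S : PeriodicSystem 𝔽 k m T)

/-- `u` solves the stationary equation `α_k ∂_x^k u + … + α_1 ∂_x u + 𝒩(u, ·) = 0`. -/
def IsSolution (u : ℝ → EuclideanSpace 𝔽 (Fin m)) : Prop :=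
  HasWeakDerivs k u ∧
    ∀ᵐ x, (∑ j ∈ Finset.Icc 1 k, Matrix.toEuclideanLin (S.α j x) (weakDeriv^[j] u x)) +
      S.nonlin (u x) x = 0

/-- The Jacobian matrix of `w ↦ 𝒩(w, x)` at `w`. -/
def jacobian (w : EuclideanSpace 𝔽 (Fin m)) (x : ℝ) : Matrix (Fin m) (Fin m) 𝔽 :=
  Matrix.of fun i j =>
    fderiv 𝔽 (fun y => S.nonlin y x) w (EuclideanSpace.single j (1 : 𝔽)) i

/-- The coefficients of the linearization about `u`: `∂_u 𝒩(u(x), x)` for `j = 0` and `α_j(x)` for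
`j ≥ 1`, regarded as complex matrices. -/
def linCoeff (u : ℝ → EuclideanSpace 𝔽 (Fin m)) : ℕ → ℝ → Matrix (Fin m) (Fin m) ℂ
  | 0, x => (S.jacobian (u x) x).map (RCLike.map 𝔽 ℂ)
  | j + 1, x => (S.α (j + 1) x).map (RCLike.map 𝔽 ℂ)

/-- The linearization `ℒ(u)` on `L²(ℝ)` with domain `H^k(ℝ)`. -/
def linOp (u : ℝ → EuclideanSpace 𝔽 (Fin m)) :
    Lp (EuclideanSpace ℂ (Fin m)) 2 (volume : Measure ℝ) →ₗ.[ℂ]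
      Lp (EuclideanSpace ℂ (Fin m)) 2 (volume : Measure ℝ) :=
  lineOp k (S.linCoeff u)

/-- The linearization `ℒ_per(u)` on `L²_per(0, L)` with domain `H^k_per(0, L)`. -/
def linOpPer (L : ℝ) (u : ℝ → EuclideanSpace 𝔽 (Fin m)) :
    Lp (EuclideanSpace ℂ (Fin m)) 2 ((volume : Measure ℝ).restrict (Ico 0 L)) →ₗ.[ℂ]
      Lp (EuclideanSpace ℂ (Fin m)) 2 ((volume : Measure ℝ).restrict (Ico 0 L)) :=
  perOp L k (S.linCoeff u)

/-- `u` is nondegenerate: `ℒ(u)` is invertible. -/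
def Nondegenerate (u : ℝ → EuclideanSpace 𝔽 (Fin m)) : Prop :=
  0 ∈ resolventSet (S.linOp u)

def StronglySpectrallyStable (u : ℝ → EuclideanSpace 𝔽 (Fin m)) : Prop :=
  ∃ ϱ : ℝ, 0 < ϱ ∧ spec (S.linOp u) ⊆ {lam : ℂ | lam.re ≤ -ϱ}

/-- A smooth `nT`-periodic cut-off function with values in `[0, 1]`, derivatives of order at most
`k` bounded by `1`, equal to `1` on `[-nT/6, nT/6]` and to `0` on
`[-nT/2, -nT/3] ∪ [nT/3, nT/2]`. -/
structure IsCutoff (k : ℕ) (T : ℝ) (n : ℕ) (χ : ℝ → ℝ) : Prop where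
  smooth : ContDiff ℝ ∞ χ
  periodic : Function.Periodic χ (n * T)
  mem_Icc : ∀ x, χ x ∈ Icc (0 : ℝ) 1
  norm_le : ∀ j ≤ k, ∀ x, |iteratedDeriv j χ x| ≤ 1
  eq_one : ∀ x ∈ Icc (-(n * T / 6)) (n * T / 6), χ x = 1
  eq_zero : ∀ x ∈ Icc (-(n * T / 2)) (-(n * T / 3)) ∪ Icc (n * T / 3) (n * T / 2), χ x = 0

/-- `u` is an `nT`-periodic pulse solution `u = χ z + v + a` on `[-nT/2, nT/2)` with cut-off
function `χ` and an error `a` with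
`‖a‖_{H^k_per(0, nT)} ≤ C ‖z‖_{H^k(ℝ \ (-nT/6, nT/6))}`. -/
structure IsPeriodicPulse (v z : ℝ → EuclideanSpace 𝔽 (Fin m)) (C : ℝ≥0) (n : ℕ)
    (χ : ℝ → ℝ) (a u : ℝ → EuclideanSpace 𝔽 (Fin m)) : Prop where
  cutoff : IsCutoff k T n χ
  a_mem : MemHkPer k (n * T) a
  a_le : hkNorm k (Ico 0 (n * T)) a ≤ C * hkNorm k (Ioo (-(n * T / 6)) (n * T / 6))ᶜ z
  u_mem : MemHkPer k (n * T) u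
  u_solution : S.IsSolution u
  u_eq : ∀ᵐ x, x ∈ Ico (-(n * T / 2)) (n * T / 2) → u x = χ x • z x + v x + a x

end PeriodicSystem

end PeriodicPulse

end

/-! Strong stability puts the closed right half-plane into the resolvent set of the linearization
about `z + v`. The heart of the matter is that every resolvent point `lam` of that operator has a
neighbourhood contained in the resolvent sets of both `ℒ(u_n)` and `ℒ_per(u_n)` for all large `n`
(`exists_forall_mem_resolventSet_of_approx`, `eventually_mem_resolventSet`). Finitely many such
neighbourhoods cover `K ∩ {Re ≥ 0}`, so for large `n` this set carries no spectrum, and by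
assumption there is no unstable spectrum outside it.

For the perturbation argument put `L = nT`. The linearizations about `u_n` and `z + v` differ only
in the coefficient of order zero, and this difference is uniformly small for `|x| ≤ 3L/4`, because
`z` and the error are small where the two functions fail to agree
(`IsPeriodicPulse.ae_norm_sub_le`). Let `η` be a slowly varying cut-off that is `1` on `[-L/2, L/2]`
and vanishes beyond `3L/4`. Multiplication by `η` changes the equation by terms of relative size `δ`
in the `H^k` energy: the commutator, the coefficient difference and `lam - lam'`. Transferring the
bounded inverse of the reference operator in this way gives an a priori estimate on `[-L/2, L/2]`
with a small remainder on `[-L, L]` (`exists_local_apriori`), and approximate solvability for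
right-hand sides supported in `[-L/2, L/2]` (`exists_local_solution`).

The coefficients of `ℒ(u_n)` are `L`-periodic, so both facts hold on every translate of the window
by a multiple of `L`. The translates cover the line twice; summing and absorbing the remainder gives
a global `H^k` bound, hence injectivity and closed range. Approximate solvability shows that a
function orthogonal to the range is small on each window relative to the doubled window, and
absorption forces it to vanish; no adjoint operator is needed. On the period cell a single window
suffices, and test functions are periodized. The `H^k` bounds for the reference resolvent come from
the closed graph theorem (`exists_bound_of_mem_resolventSet_lineOp`). -/

open scoped Topology

namespace PeriodicPulse

/-! ### Calculus of weak derivatives: product rule, limits, primitives, a local Sobolev inequality.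
-/

section WeakDerivativeCalculus

variable {E : Type*} [NormedAddCommGroup E] [NormedSpace ℝ E]

theorem IsWeakDeriv.congr_right {f g g' : ℝ → E} (h : IsWeakDeriv f g)
    (hg : g =ᵐ[volume] g') : IsWeakDeriv f g' where
  left := h.left
  right := h.right.congr hg
  integral_eq φ hφ hc := by
    rw [h.integral_eq φ hφ hc]
    congr 1
    refine integral_congr_ae ?_
    filter_upwards [hg] with x hx
    rw [hx]

theorem IsWeakDeriv.zero : IsWeakDeriv (0 : ℝ → E) 0 where
  left := locallyIntegrable_zero
  right := locallyIntegrable_zero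
  integral_eq φ _ _ := by simp

theorem IsWeakDeriv.sum {ι : Type*} (s : Finset ι) {f g : ι → ℝ → E}
    (h : ∀ i ∈ s, IsWeakDeriv (f i) (g i)) : IsWeakDeriv (∑ i ∈ s, f i) (∑ i ∈ s, g i) := by
  classical
  induction s using Finset.induction_on with
  | empty => simpa using IsWeakDeriv.zero
  | insert i s hi ih =>
    rw [Finset.sum_insert hi, Finset.sum_insert hi]
    exact (h i (by simp)).add (ih fun j hj => h j (by simp [hj]))

theorem IsWeakDeriv.neg {f g : ℝ → E} (h : IsWeakDeriv f g) : IsWeakDeriv (-f) (-g) where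
  left := h.left.neg
  right := h.right.neg
  integral_eq φ hφ hc := by
    simp only [Pi.neg_apply, smul_neg, integral_neg, h.integral_eq φ hφ hc]

theorem IsWeakDeriv.sub {f f' g g' : ℝ → E} (h : IsWeakDeriv f g)
    (h' : IsWeakDeriv f' g') : IsWeakDeriv (f - f') (g - g') := by
  simpa [sub_eq_add_neg] using h.add h'.neg

theorem locallyIntegrable_continuous_smul {f : ℝ → E} (hf : LocallyIntegrable f volume)
    {η : ℝ → ℝ} (hη : Continuous η) : LocallyIntegrable (fun x => η x • f x) volume := by
  rw [locallyIntegrable_iff]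
  intro K hK
  exact (hf.integrableOn_isCompact hK).continuousOn_smul hη.continuousOn hK

/-- The product rule for a smooth factor. -/
theorem IsWeakDeriv.smooth_smul {f g : ℝ → E} (h : IsWeakDeriv f g) {η : ℝ → ℝ}
    (hη : ContDiff ℝ ∞ η) :
    IsWeakDeriv (fun x => η x • f x) (fun x => deriv η x • f x + η x • g x) where
  left := locallyIntegrable_continuous_smul h.left hη.continuous
  right := (locallyIntegrable_continuous_smul h.left (hη.continuous_deriv (by simp))).add
    (locallyIntegrable_continuous_smul h.right hη.continuous)
  integral_eq φ hφ hc := by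
    have hd : ∀ x, deriv (fun y => φ y * η y) x = deriv φ x * η x + φ x * deriv η x :=
      fun x => deriv_fun_mul (hφ.differentiable (by simp) x) (hη.differentiable (by simp) x)
    -- The product `φ * η` is again a test function; the part of its derivative containing `deriv η`
    -- supplies the extra term of the product rule.
    have h1 := h.integral_eq _ (hφ.mul hη) hc.mul_right
    have cη : Continuous (deriv η) := hη.continuous_deriv (by simp)
    have cφ : Continuous (deriv φ) := hφ.continuous_deriv (by simp)
    have i1 := (locallyIntegrable_continuous_smul h.left hη.continuous).integrable_smul_left_of_hasCompactSupport
      cφ hc.deriv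
    have i2 := (locallyIntegrable_continuous_smul h.left cη).integrable_smul_left_of_hasCompactSupport
      hφ.continuous hc
    have i3 := (locallyIntegrable_continuous_smul h.right hη.continuous).integrable_smul_left_of_hasCompactSupport
      hφ.continuous hc
    simp only [hd, add_smul, mul_smul] at h1
    rw [integral_add i1 i2] at h1
    simp only [smul_add]
    rw [integral_add i2 i3, eq_sub_of_add_eq h1]
    abel

omit [NormedSpace ℝ E] in
theorem locallyIntegrable_comp_add_right {f : ℝ → E} (hf : LocallyIntegrable f volume) (c : ℝ) :
    LocallyIntegrable (fun x => f (x + c)) volume := by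
  have := (locallyIntegrable_map_homeomorph (Homeomorph.addRight c) (f := f)
    (μ := (volume : Measure ℝ))).1
  simp only [Homeomorph.coe_addRight, map_add_right_eq_self] at this
  exact this hf

theorem IsWeakDeriv.comp_add_right {f g : ℝ → E} (h : IsWeakDeriv f g) (c : ℝ) :
    IsWeakDeriv (fun x => f (x + c)) (fun x => g (x + c)) where
  left := locallyIntegrable_comp_add_right h.left c
  right := locallyIntegrable_comp_add_right h.right c
  integral_eq φ hφ hc := by
    have h1 := h.integral_eq (fun x => φ (x - c)) (hφ.comp (contDiff_id.sub contDiff_const))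
      (hc.comp_homeomorph (Homeomorph.subRight c))
    simp only [deriv_comp_sub_const] at h1
    rw [← integral_add_right_eq_self _ c, ← integral_add_right_eq_self (fun x => φ (x - c) • g x) c]
      at h1
    simpa using h1

theorem exists_Icc_of_hasCompactSupport {φ : ℝ → ℝ} (hc : HasCompactSupport φ) :
    ∃ R > 0, ∀ x, x ∉ Icc (-R) R → φ x = 0 ∧ deriv φ x = 0 := by
  obtain ⟨R, hR⟩ := hc.isCompact.isBounded.subset_closedBall 0
  refine ⟨max R 1, by positivity, fun x hx => ?_⟩
  have h1 : x ∉ tsupport φ := fun h => hx (by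
    have := hR h
    rw [Real.closedBall_eq_Icc] at this
    simp only [zero_sub, zero_add, mem_Icc] at this
    have := le_max_left R 1
    constructor <;> linarith)
  exact ⟨image_eq_zero_of_notMem_tsupport h1,
    image_eq_zero_of_notMem_tsupport fun h => h1 (tsupport_deriv_subset h)⟩

omit [NormedSpace ℝ E] in
theorem locallyIntegrable_of_forall_Icc {f : ℝ → E}
    (h : ∀ R > 0, IntegrableOn f (Icc (-R) R)) : LocallyIntegrable f volume := by
  rw [locallyIntegrable_iff]
  intro K hK
  obtain ⟨R, hR⟩ := hK.isBounded.subset_closedBall 0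
  refine (h (max R 1) (by positivity)).mono_set fun x hx => ?_
  have := hR hx
  rw [Real.closedBall_eq_Icc] at this
  simp only [zero_sub, zero_add, mem_Icc] at this
  have := le_max_left R 1
  constructor <;> linarith

/-- Being a weak derivative is a local property. -/
theorem isWeakDeriv_of_local {f g : ℝ → E}
    (h : ∀ R > 0, ∃ f' g', IsWeakDeriv f' g' ∧ ∀ x ∈ Icc (-R) R, f x = f' x ∧ g x = g' x) :
    IsWeakDeriv f g where
  left := locallyIntegrable_of_forall_Icc fun R hR => by
    obtain ⟨f', g', h1, h2⟩ := h R hR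
    exact (h1.left.integrableOn_isCompact isCompact_Icc).congr_fun (fun x hx => (h2 x hx).1.symm)
      measurableSet_Icc
  right := locallyIntegrable_of_forall_Icc fun R hR => by
    obtain ⟨f', g', h1, h2⟩ := h R hR
    exact (h1.right.integrableOn_isCompact isCompact_Icc).congr_fun (fun x hx => (h2 x hx).2.symm)
      measurableSet_Icc
  integral_eq φ hφ hc := by
    obtain ⟨R, hR, hφR⟩ := exists_Icc_of_hasCompactSupport hc
    obtain ⟨f', g', h1, h2⟩ := h R hR
    have e1 : ∀ x, deriv φ x • f x = deriv φ x • f' x := fun x => by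
      by_cases hx : x ∈ Icc (-R) R
      · rw [(h2 x hx).1]
      · simp [hφR x hx]
    have e2 : ∀ x, φ x • g x = φ x • g' x := fun x => by
      by_cases hx : x ∈ Icc (-R) R
      · rw [(h2 x hx).2]
      · simp [hφR x hx]
    simp only [e1, e2]
    exact h1.integral_eq φ hφ hc

theorem tendsto_integral_smul_of_locally {φ : ℝ → ℝ} (hφ : Continuous φ) {R : ℝ}
    (hR : ∀ x, x ∉ Icc (-R) R → φ x = 0) {f : ℕ → ℝ → E} {F : ℝ → E}
    (hf : ∀ n, LocallyIntegrable (f n) volume) (hF : LocallyIntegrable F volume)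
    (hfF : Tendsto (fun n => eLpNorm (f n - F) 1 (volume.restrict (Icc (-R) R))) atTop (𝓝 0)) :
    Tendsto (fun n => ∫ x, φ x • f n x) atTop (𝓝 (∫ x, φ x • F x)) := by
  have hK : ∀ G : ℝ → E, ∫ x, φ x • G x = ∫ x in Icc (-R) R, φ x • G x := fun G => by
    rw [setIntegral_eq_integral_of_forall_compl_eq_zero]
    intro x hx
    simp [hR x hx]
  simp only [hK]
  have iG : ∀ G : ℝ → E, LocallyIntegrable G volume →
      Integrable (fun x => φ x • G x) (volume.restrict (Icc (-R) R)) := fun G hG =>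
    (hG.integrableOn_isCompact isCompact_Icc).continuousOn_smul hφ.continuousOn isCompact_Icc
  obtain ⟨C, hC⟩ := isCompact_Icc.exists_bound_of_continuousOn (s := Icc (-R) R) hφ.continuousOn
  refine tendsto_integral_of_L1' _ (iG F hF).aestronglyMeasurable (Eventually.of_forall fun n => iG _ (hf n)) ?_
  have h0 : Tendsto (fun n => ENNReal.ofReal C *
      eLpNorm (f n - F) 1 (volume.restrict (Icc (-R) R))) atTop (𝓝 0) := by
    simpa using ENNReal.Tendsto.const_mul hfF (Or.inr ENNReal.ofReal_ne_top)
  refine tendsto_of_tendsto_of_tendsto_of_le_of_le tendsto_const_nhds h0 (fun _ => zero_le)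
    fun n => ?_
  refine eLpNorm_le_mul_eLpNorm_of_ae_le_mul ?_ 1
  filter_upwards [ae_restrict_mem measurableSet_Icc] with x hx
  simp only [Pi.sub_apply, ← smul_sub, norm_smul]
  exact mul_le_mul_of_nonneg_right (hC x hx) (norm_nonneg _)

/-- A test function sees only a compact window, so local `L¹` convergence is enough to pass to the
limit on both sides of the defining identity. -/
theorem isWeakDeriv_of_tendsto {f g : ℕ → ℝ → E} {F G : ℝ → E}
    (h : ∀ n, IsWeakDeriv (f n) (g n)) (hF : LocallyIntegrable F volume)
    (hG : LocallyIntegrable G volume)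
    (hfF : ∀ R > 0, Tendsto (fun n => eLpNorm (f n - F) 1 (volume.restrict (Icc (-R) R)))
      atTop (𝓝 0))
    (hgG : ∀ R > 0, Tendsto (fun n => eLpNorm (g n - G) 1 (volume.restrict (Icc (-R) R)))
      atTop (𝓝 0)) : IsWeakDeriv F G where
  left := hF
  right := hG
  integral_eq φ hφ hc := by
    obtain ⟨R, hR, hφR⟩ := exists_Icc_of_hasCompactSupport hc
    have t1 := tendsto_integral_smul_of_locally (hφ.continuous_deriv (by simp))
      (fun x hx => (hφR x hx).2) (fun n => (h n).left) hF (hfF R hR)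
    have t2 := tendsto_integral_smul_of_locally hφ.continuous
      (fun x hx => (hφR x hx).1) (fun n => (h n).right) hG (hgG R hR)
    refine tendsto_nhds_unique t1 ?_
    simp only [(h _).integral_eq φ hφ hc]
    exact t2.neg

omit [NormedSpace ℝ E] in
theorem intervalIntegrable_of_locallyIntegrable {g : ℝ → E} (hg : LocallyIntegrable g volume)
    {a b : ℝ} : IntervalIntegrable g volume a b :=
  (hg.integrableOn_isCompact isCompact_uIcc).intervalIntegrable

/-- The primitive of a locally integrable function has that function as weak derivative. -/
theorem isWeakDeriv_primitive [CompleteSpace E] {g : ℝ → E} (hg : LocallyIntegrable g volume)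
    (a : ℝ) : IsWeakDeriv (fun x => ∫ t in a..x, g t) g where
  left := (intervalIntegral.continuous_primitive
    (fun _ _ => intervalIntegrable_of_locallyIntegrable hg) a).locallyIntegrable
  right := hg
  integral_eq φ hφ hc := by
    obtain ⟨R, hR, hφR⟩ := exists_Icc_of_hasCompactSupport hc
    have cφ : Continuous (deriv φ) := hφ.continuous_deriv (by simp)
    have hii : ∀ a b, IntervalIntegrable g volume a b := fun _ _ => intervalIntegrable_of_locallyIntegrable hg
    have hφ' : ∫ x, deriv φ x = 0 := by
      have := integral_of_hasDerivAt_of_tendsto (f := φ) (f' := deriv φ) (m := 0) (n := 0)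
        (fun x => (hφ.differentiable (by simp) x).hasDerivAt)
        (cφ.integrable_of_hasCompactSupport hc.deriv) 
        (tendsto_nhds_of_eventually_eq (by
          filter_upwards [Iio_mem_atBot (-R)] with x hx
          exact (hφR x (fun h => not_lt.2 h.1 hx)).1))
        (tendsto_nhds_of_eventually_eq (by
          filter_upwards [Ioi_mem_atTop R] with x hx
          exact (hφR x (fun h => not_lt.2 h.2 hx)).1))
      simpa using this
    -- Moving the base point to `-R` adds a constant, which `∫ deriv φ = 0` removes.
    have hsplit : ∀ x, deriv φ x • ∫ t in a..x, g t =
        deriv φ x • (∫ t in a..(-R), g t) + deriv φ x • ∫ t in (-R)..x, g t := fun x => by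
      rw [← smul_add, intervalIntegral.integral_add_adjacent_intervals (hii _ _) (hii _ _)]
    simp only [hsplit]
    have cP : Continuous fun x => ∫ t in (-R)..x, g t :=
      intervalIntegral.continuous_primitive hii _
    rw [integral_add ((cφ.integrable_of_hasCompactSupport hc.deriv).smul_const _)
      (cP.locallyIntegrable.integrable_smul_left_of_hasCompactSupport cφ hc.deriv),
      integral_smul_const, hφ', zero_smul, zero_add]
    set μ : Measure ℝ := volume.restrict (Ioc (-R) R) with hμ
    -- Continuity gives vanishing at the left endpoint as well, so the half-open interval used by
    -- interval integrals can replace the closed one.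
    have hoc : ∀ x, x ∉ Ioc (-R) R → φ x = 0 := fun x hx => by
      rcases eq_or_ne x (-R) with rfl | h
      · have : Tendsto φ (𝓝[<] (-R)) (𝓝 (φ (-R))) := hφ.continuous.continuousWithinAt
        refine tendsto_nhds_unique this (tendsto_nhds_of_eventually_eq ?_)
        filter_upwards [self_mem_nhdsWithin] with y hy
        exact (hφR y (fun h => not_lt.2 h.1 hy)).1
      · exact (hφR x fun h' => hx ⟨lt_of_le_of_ne h'.1 h.symm, h'.2⟩).1
    have hoc' : ∀ x, x ∉ Ioc (-R) R → deriv φ x = 0 := fun x hx => by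
      rcases eq_or_ne x (-R) with rfl | h
      · have : Tendsto (deriv φ) (𝓝[<] (-R)) (𝓝 (deriv φ (-R))) := cφ.continuousWithinAt
        refine tendsto_nhds_unique this (tendsto_nhds_of_eventually_eq ?_)
        filter_upwards [self_mem_nhdsWithin] with y hy
        exact (hφR y (fun h => not_lt.2 h.1 hy)).2
      · exact (hφR x fun h' => hx ⟨lt_of_le_of_ne h'.1 h.symm, h'.2⟩).2
    rw [← setIntegral_eq_integral_of_forall_compl_eq_zero (s := Ioc (-R) R)
        (f := fun x => φ x • g x) (fun x hx => by simp [hoc x hx]),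
      ← setIntegral_eq_integral_of_forall_compl_eq_zero (s := Ioc (-R) R)
        (f := fun x => deriv φ x • ∫ t in (-R)..x, g t) (fun x hx => by simp [hoc' x hx])]
    -- Fubini on the triangle `t ≤ x` inside the square `(-R, R]²`: integrating in `t` produces the
    -- primitive, integrating in `x` produces `φ R - φ t = -φ t`.
    set h : ℝ × ℝ → E := {p : ℝ × ℝ | p.2 ≤ p.1}.indicator fun p => deriv φ p.1 • g p.2 with hh
    have hint : Integrable h (μ.prod μ) := by
      refine Integrable.indicator ?_ (measurableSet_le measurable_snd measurable_fst)
      exact Integrable.smul_prod (cφ.integrable_of_hasCompactSupport hc.deriv).restrict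
        ((hg.integrableOn_isCompact isCompact_Icc).mono_set Ioc_subset_Icc_self)
    have hsw := integral_integral_swap (f := fun x t => h (x, t)) hint
    have e1 : ∀ x ∈ Ioc (-R) R, ∫ t, h (x, t) ∂μ = deriv φ x • ∫ t in (-R)..x, g t := by
      intro x hx
      rw [intervalIntegral.integral_of_le hx.1.le, ← integral_smul]
      have : (fun t => h (x, t)) = (Iic x).indicator fun t => deriv φ x • g t := by
        funext t
        simp [hh, indicator]
      rw [this, integral_indicator measurableSet_Iic, hμ, Measure.restrict_restrict measurableSet_Iic]
      congr 2
      ext t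
      simp only [mem_inter_iff, mem_Iic, mem_Ioc]
      constructor
      · rintro ⟨a, b, c⟩; exact ⟨b, a⟩
      · rintro ⟨a, b⟩; exact ⟨b, a, b.trans hx.2⟩
    have e2 : ∀ t ∈ Ioc (-R) R, ∫ x, h (x, t) ∂μ = -(φ t • g t) := by
      intro t ht
      have : (fun x => h (x, t)) = (Ici t).indicator fun x => deriv φ x • g t := by
        funext x
        simp [hh, indicator]
      rw [this, integral_indicator measurableSet_Ici, hμ,
        Measure.restrict_restrict measurableSet_Ici, integral_smul_const, ← neg_smul]
      congr 1
      have hs : Ici t ∩ Ioc (-R) R = Icc t R := by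
        ext x
        simp only [mem_inter_iff, mem_Ici, mem_Ioc, mem_Icc]
        constructor
        · rintro ⟨a, b, c⟩; exact ⟨a, c⟩
        · rintro ⟨a, b⟩; exact ⟨a, ht.1.trans_le a, b⟩
      rw [hs, integral_Icc_eq_integral_Ioc, ← intervalIntegral.integral_of_le ht.2,
        intervalIntegral.integral_deriv_eq_sub (fun x _ => hφ.differentiable (by simp) x)
          (cφ.intervalIntegrable _ _)]
      have : φ R = 0 := by
        have : Tendsto φ (𝓝[>] R) (𝓝 (φ R)) := hφ.continuous.continuousWithinAt
        refine tendsto_nhds_unique this (tendsto_nhds_of_eventually_eq ?_)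
        filter_upwards [self_mem_nhdsWithin] with y hy
        exact (hφR y (fun h => not_lt.2 h.2 hy)).1
      rw [this, zero_sub]
    rw [← integral_neg, ← setIntegral_congr_fun measurableSet_Ioc e1,
      ← setIntegral_congr_fun measurableSet_Ioc e2]
    exact hsw

/-- A function with vanishing weak derivative is constant. -/
theorem IsWeakDeriv.ae_eq_const [CompleteSpace E] {f : ℝ → E} (h : IsWeakDeriv f 0) :
    ∃ c, f =ᵐ[volume] fun _ => c := by
  let b : ContDiffBump (0 : ℝ) := default
  set ρ : ℝ → ℝ := b.normed volume with hρ
  have ρs : ContDiff ℝ ∞ ρ := b.contDiff_normed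
  have ρc : HasCompactSupport ρ := b.hasCompactSupport_normed
  have ρi : ∫ x, ρ x = 1 := b.integral_normed
  have cρ := ρs.continuous
  refine ⟨∫ x, ρ x • f x, ae_eq_of_integral_contDiff_smul_eq h.left (locallyIntegrable_const _)
    fun ψ hψ hc => ?_⟩
  have iρ : Integrable ρ := cρ.integrable_of_hasCompactSupport ρc
  have iψ : Integrable ψ := hψ.continuous.integrable_of_hasCompactSupport hc
  -- The du Bois-Reymond argument: subtracting `(∫ ψ) ρ` makes the mean zero, which is exactly what
  -- makes the primitive `Θ` compactly supported and hence a test function.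
  set θ : ℝ → ℝ := fun x => ψ x - (∫ y, ψ y) * ρ x with hθ
  have θs : ContDiff ℝ ∞ θ := hψ.sub (contDiff_const.mul ρs)
  have θc : HasCompactSupport θ := hc.sub (ρc.mul_left)
  have cθ := θs.continuous
  have iθ : ∫ x, θ x = 0 := by
    rw [integral_sub iψ (iρ.const_mul _), integral_const_mul, ρi, mul_one, sub_self]
  obtain ⟨R, hR, hθR⟩ := exists_Icc_of_hasCompactSupport θc
  set Θ : ℝ → ℝ := fun x => ∫ t in (-R)..x, θ t with hΘ
  have dΘ : ∀ x, HasDerivAt Θ (θ x) x := fun x =>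
    intervalIntegral.integral_hasDerivAt_right (cθ.intervalIntegrable _ _)
      (cθ.stronglyMeasurableAtFilter _ _) cθ.continuousAt
  have dΘ' : deriv Θ = θ := funext fun x => (dΘ x).deriv
  have Θs : ContDiff ℝ ∞ Θ := by
    rw [contDiff_infty_iff_deriv]
    exact ⟨fun x => (dΘ x).differentiableAt, by rw [dΘ']; exact θs⟩
  have Θc : HasCompactSupport Θ := by
    refine HasCompactSupport.intro (isCompact_Icc (a := -R) (b := R)) fun x hx => ?_
    by_cases h1 : x < -R
    · simp only [hΘ]
      rw [intervalIntegral.integral_symm, intervalIntegral.integral_of_le h1.le,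
        integral_Ioc_eq_integral_Ioo, setIntegral_eq_zero_of_forall_eq_zero, neg_zero]
      intro y hy
      exact (hθR y fun h => not_lt.2 h.1 hy.2).1
    · have h2 : R < x := by
        by_contra h2
        exact hx ⟨not_lt.1 h1, not_lt.1 h2⟩
      simp only [hΘ]
      rw [intervalIntegral.integral_of_le (not_lt.1 h1), ← integral_Icc_eq_integral_Ioc,
        setIntegral_eq_integral_of_forall_compl_eq_zero, iθ]
      intro y hy
      exact (hθR y fun h => hy ⟨h.1, h.2.trans h2.le⟩).1
  have h1 := h.integral_eq Θ Θs Θc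
  rw [dΘ'] at h1
  simp only [Pi.zero_apply, smul_zero, integral_zero, neg_zero, hθ, sub_smul, mul_smul] at h1
  have i2 : Integrable fun x => (∫ y, ψ y) • ρ x • f x :=
    (h.left.integrable_smul_left_of_hasCompactSupport cρ ρc).smul _
  rw [integral_sub (h.left.integrable_smul_left_of_hasCompactSupport hψ.continuous hc) i2,
    integral_smul, sub_eq_zero] at h1
  rw [h1, integral_smul_const]

theorem IsWeakDeriv.exists_primitive [CompleteSpace E] {f g : ℝ → E} (h : IsWeakDeriv f g) :
    ∃ c, f =ᵐ[volume] fun x => c + ∫ t in (0 : ℝ)..x, g t := by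
  have h1 := h.sub (isWeakDeriv_primitive h.right 0)
  rw [sub_self] at h1
  obtain ⟨c, hc⟩ := h1.ae_eq_const
  refine ⟨c, ?_⟩
  filter_upwards [hc] with x hx
  rw [← hx]
  simp

omit [NormedSpace ℝ E] in
theorem lintegral_enorm_Ioc_le {f : ℝ → E} (hf : AEStronglyMeasurable f volume) (a ℓ : ℝ) :
    ∫⁻ x in Ioc a (a + ℓ), ‖f x‖ₑ ≤
      ENNReal.ofReal ℓ ^ (1 / 2 : ℝ) * eLpNorm f 2 (volume.restrict (Ioc a (a + ℓ))) := by
  rw [← eLpNorm_one_eq_lintegral_enorm]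
  refine (eLpNorm_le_eLpNorm_mul_rpow_measure_univ (p := 1) (q := 2) (by norm_num)
    hf.restrict).trans ?_
  rw [mul_comm]
  gcongr
  simp
  norm_num

/-- A local Sobolev inequality. -/
theorem exists_enorm_le_of_isWeakDeriv (E : Type*) [NormedAddCommGroup E] [NormedSpace ℝ E]
    [CompleteSpace E] {ℓ : ℝ} (hℓ : 0 < ℓ) : ∃ C : ℝ≥0, ∀ f g : ℝ → E, IsWeakDeriv f g →
      ∀ (a : ℝ), ∀ᵐ x, x ∈ Ioc a (a + ℓ) → ‖f x‖ₑ ≤ C * (eLpNorm f 2 (volume.restrict (Ioc a (a + ℓ))) +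
        eLpNorm g 2 (volume.restrict (Ioc a (a + ℓ)))) := by
  set l := ENNReal.ofReal ℓ with hl
  have l0 : l ≠ 0 := by simpa [hl] using hℓ
  have lt : l ≠ ⊤ := ENNReal.ofReal_ne_top
  set r := l ^ (1 / 2 : ℝ) with hr
  have rt : r ≠ ⊤ := ENNReal.rpow_ne_top_of_nonneg (by norm_num) lt
  refine ⟨(l⁻¹ * r + r).toNNReal, fun f g h a => ?_⟩
  obtain ⟨c, hc⟩ := h.exists_primitive
  rw [ENNReal.coe_toNNReal
    (ENNReal.add_ne_top.2 ⟨ENNReal.mul_ne_top (ENNReal.inv_ne_top.2 l0) rt, rt⟩)]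
  set J := Ioc a (a + ℓ) with hJ
  have hmf : AEStronglyMeasurable f volume := h.left.aestronglyMeasurable
  have hmg : AEStronglyMeasurable g volume := h.right.aestronglyMeasurable
  filter_upwards [hc] with x hx hxJ
  -- Every `y` in the interval is compared with `x` through the primitive; averaging over `y`
  -- afterwards leaves only `L¹` norms, which Cauchy–Schwarz turns into `L²` norms.
  have key : ∀ᵐ y ∂(volume.restrict J), ‖f x‖ₑ ≤ ‖f y‖ₑ + ∫⁻ t in J, ‖g t‖ₑ := by
    filter_upwards [ae_restrict_of_ae hc, ae_restrict_mem measurableSet_Ioc] with y hy hyJ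
    have e : f x = f y + ∫ t in y..x, g t := by
      rw [hx, hy, add_assoc, intervalIntegral.integral_add_adjacent_intervals] <;>
      exact intervalIntegrable_of_locallyIntegrable h.right
    rw [e]
    refine (enorm_add_le _ _).trans (add_le_add le_rfl ?_)
    rw [← enorm_norm, intervalIntegral.norm_intervalIntegral_eq, enorm_norm]
    refine (enorm_integral_le_lintegral_enorm _).trans (lintegral_mono_set ?_)
    intro t ht
    rw [mem_uIoc] at ht
    rcases ht with ht | ht
    · exact ⟨hyJ.1.trans ht.1, ht.2.trans hxJ.2⟩
    · exact ⟨hxJ.1.trans ht.1, ht.2.trans hyJ.2⟩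
  have h1 := lintegral_mono_ae key
  rw [lintegral_add_right _ measurable_const, lintegral_const, lintegral_const,
    Measure.restrict_apply_univ, hJ, Real.volume_Ioc, add_sub_cancel_left, ← hl, ← hJ] at h1
  have h2 := lintegral_enorm_Ioc_le hmf a ℓ
  have h3 := lintegral_enorm_Ioc_le hmg a ℓ
  rw [← hJ, ← hl, ← hr] at h2 h3
  calc ‖f x‖ₑ = l⁻¹ * (‖f x‖ₑ * l) := by
        rw [mul_comm, mul_assoc, ENNReal.mul_inv_cancel l0 lt, mul_one]
    _ ≤ l⁻¹ * ((∫⁻ t in J, ‖f t‖ₑ) + (∫⁻ t in J, ‖g t‖ₑ) * l) := by gcongr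
    _ = l⁻¹ * (∫⁻ t in J, ‖f t‖ₑ) + ∫⁻ t in J, ‖g t‖ₑ := by
        rw [mul_add, mul_comm _ l, ← mul_assoc l⁻¹ l, ENNReal.inv_mul_cancel l0 lt, one_mul]
    _ ≤ l⁻¹ * (r * eLpNorm f 2 (volume.restrict J)) + r * eLpNorm g 2 (volume.restrict J) := by
        gcongr
    _ ≤ _ := by
        rw [← mul_assoc, mul_add]
        gcongr
        · exact le_self_add
        · exact le_add_self

end WeakDerivativeCalculus

/-! ### Towers of weak derivatives, the Leibniz rule, slow cut-offs. -/

section Towers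

variable {E : Type*} [NormedAddCommGroup E] [NormedSpace ℝ E]

/-- `g 0, …, g k` are locally integrable and each is the weak derivative of its predecessor. -/
structure IsTower (k : ℕ) (g : ℕ → ℝ → E) : Prop where
  locallyIntegrable : LocallyIntegrable (g 0) volume
  isWeakDeriv : ∀ j < k, IsWeakDeriv (g j) (g (j + 1))

theorem HasWeakDerivs.isTower {k : ℕ} {f : ℝ → E} (h : HasWeakDerivs k f) :
    IsTower k fun j => weakDeriv^[j] f :=
  ⟨h.1, fun _ hj => h.isWeakDeriv hj⟩

theorem IsTower.hasWeakDerivs [CompleteSpace E] {k : ℕ} {g : ℕ → ℝ → E} (h : IsTower k g)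
    {f : ℝ → E} (hf : f =ᵐ[volume] g 0) :
    HasWeakDerivs k f ∧ ∀ j ≤ k, weakDeriv^[j] f =ᵐ[volume] g j :=
  hasWeakDerivs_of_tower (h.locallyIntegrable.congr hf.symm) hf h.isWeakDeriv

theorem IsTower.aestronglyMeasurable {k : ℕ} {g : ℕ → ℝ → E} (h : IsTower k g) {j : ℕ}
    (hj : j ≤ k) : AEStronglyMeasurable (g j) volume := by
  rcases j with _ | j
  · exact h.locallyIntegrable.aestronglyMeasurable
  · exact (h.isWeakDeriv j hj).right.aestronglyMeasurable

theorem IsTower.ae_eq [CompleteSpace E] {k : ℕ} {g g' : ℕ → ℝ → E} (h : IsTower k g)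
    (h' : IsTower k g') (h0 : g 0 =ᵐ[volume] g' 0) {j : ℕ} (hj : j ≤ k) :
    g j =ᵐ[volume] g' j :=
  ((h.hasWeakDerivs (ae_eq_refl _)).2 j hj).symm.trans ((h'.hasWeakDerivs h0).2 j hj)

theorem IsTower.comp_add_right {k : ℕ} {g : ℕ → ℝ → E} (h : IsTower k g) (c : ℝ) :
    IsTower k fun j x => g j (x + c) :=
  ⟨locallyIntegrable_comp_add_right h.locallyIntegrable c,
    fun j hj => (h.isWeakDeriv j hj).comp_add_right c⟩

/-- The derivatives of the product `η • g 0`, by the Leibniz rule. -/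
noncomputable def leibniz : ℕ → (ℝ → ℝ) → (ℕ → ℝ → E) → ℝ → E
  | 0, η, g => fun x => η x • g 0 x
  | i + 1, η, g => leibniz i (deriv η) g + leibniz i η fun l => g (l + 1)

theorem isWeakDeriv_leibniz {k : ℕ} {g : ℕ → ℝ → E} (hg : IsTower k g) {i : ℕ} (hi : i < k)
    {η : ℝ → ℝ} (hη : ContDiff ℝ ∞ η) :
    IsWeakDeriv (leibniz i η g) (leibniz (i + 1) η g) := by
  induction i generalizing η g k with
  | zero => exact (hg.isWeakDeriv 0 hi).smooth_smul hη
  | succ i ih =>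
    obtain ⟨k, rfl⟩ : ∃ k', k = k' + 1 := ⟨k - 1, by omega⟩
    have hg' : IsTower k fun l => g (l + 1) :=
      ⟨(hg.isWeakDeriv 0 (by omega)).right, fun j hj => hg.isWeakDeriv (j + 1) (by omega)⟩
    have hη' : ContDiff ℝ ∞ (deriv η) := (contDiff_infty_iff_deriv.1 hη).2
    exact (ih hg (by omega) hη').add (ih hg' (by omega) hη)

theorem isTower_leibniz {k : ℕ} {g : ℕ → ℝ → E} (hg : IsTower k g)
    {η : ℝ → ℝ} (hη : ContDiff ℝ ∞ η) : IsTower k fun i => leibniz i η g :=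
  ⟨locallyIntegrable_continuous_smul hg.locallyIntegrable hη.continuous,
    fun _ hj => isWeakDeriv_leibniz hg hj hη⟩

theorem leibniz_eq_zero {η : ℝ → ℝ} {x : ℝ} (h : η =ᶠ[𝓝 x] 0) (i : ℕ) (g : ℕ → ℝ → E) :
    leibniz i η g x = 0 := by
  induction i generalizing η g with
  | zero => simp [leibniz, h.eq_of_nhds]
  | succ i ih =>
    have : deriv η =ᶠ[𝓝 x] 0 := by simpa using h.deriv
    simp [leibniz, ih h, ih this]

theorem leibniz_eq_self {η : ℝ → ℝ} {x : ℝ} (h : η =ᶠ[𝓝 x] 1) (i : ℕ) (g : ℕ → ℝ → E) :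
    leibniz i η g x = g i x := by
  induction i generalizing g with
  | zero => simp [leibniz, h.eq_of_nhds]
  | succ i ih =>
    have : deriv η =ᶠ[𝓝 x] 0 := by
      refine h.deriv.trans (Eventually.of_forall fun y => ?_)
      exact deriv_const y (1 : ℝ)
    simp [leibniz, ih, leibniz_eq_zero this]

/-- Each step of the recursion doubles the number of terms, whence the factor `2 ^ i`; no binomial
coefficients are needed. -/
theorem norm_leibniz_le {δ : ℝ} {x : ℝ} {η : ℝ → ℝ} (i : ℕ)
    (hη : ∀ l ≤ i, |iteratedDeriv l η x| ≤ δ) (g : ℕ → ℝ → E) :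
    ‖leibniz i η g x‖ ≤ 2 ^ i * δ * ∑ l ∈ Finset.range (i + 1), ‖g l x‖ := by
  have hδ : 0 ≤ δ := (abs_nonneg _).trans (hη 0 (by omega))
  induction i generalizing η g with
  | zero =>
    have := hη 0 le_rfl
    simp only [iteratedDeriv_zero] at this
    simp only [leibniz, norm_smul, Real.norm_eq_abs]
    simpa using mul_le_mul_of_nonneg_right this (norm_nonneg _)
  | succ i ih =>
    have h1 := ih (η := deriv η) (fun l hl => by
      rw [← iteratedDeriv_succ']; exact hη (l + 1) (by omega)) g
    have h2 := ih (fun l hl => hη l (by omega)) (fun l => g (l + 1))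
    have h3 : ∑ l ∈ Finset.range (i + 1), ‖g l x‖ ≤ ∑ l ∈ Finset.range (i + 1 + 1), ‖g l x‖ := by
      rw [Finset.sum_range_succ _ (i + 1)]
      simp
    have h4 : ∑ l ∈ Finset.range (i + 1), ‖g (l + 1) x‖ ≤
        ∑ l ∈ Finset.range (i + 1 + 1), ‖g l x‖ := by
      rw [Finset.sum_range_succ' _ (i + 1)]
      simp
    have hc : 0 ≤ 2 ^ i * δ := by positivity
    calc ‖leibniz (i + 1) η g x‖ ≤ _ := norm_add_le _ _
      _ ≤ _ := add_le_add (h1.trans (mul_le_mul_of_nonneg_left h3 hc))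
          (h2.trans (mul_le_mul_of_nonneg_left h4 hc))
      _ = _ := by ring

/-- After subtracting `η • g i`, every remaining term carries at least one derivative of `η`. Hence
only orders `l ≥ 1` have to be small, which is what a slow cut-off provides. -/
theorem norm_leibniz_sub_le {δ : ℝ} (hδ : 0 ≤ δ) {x : ℝ} {η : ℝ → ℝ} (i : ℕ)
    (hη : ∀ l, 1 ≤ l → l ≤ i → |iteratedDeriv l η x| ≤ δ) (g : ℕ → ℝ → E) :
    ‖leibniz i η g x - η x • g i x‖ ≤ 2 ^ i * δ * ∑ l ∈ Finset.range (i + 1), ‖g l x‖ := by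
  induction i generalizing g with
  | zero =>
    simp only [leibniz, sub_self, norm_zero]
    positivity
  | succ i ih =>
    have h1 := norm_leibniz_le (δ := δ) (x := x) (η := deriv η) i (fun l hl => by
      rw [← iteratedDeriv_succ']; exact hη (l + 1) (by omega) (by omega)) g
    have h2 := ih (fun l h hl => hη l h (by omega)) (fun l => g (l + 1))
    have h3 : ∑ l ∈ Finset.range (i + 1), ‖g l x‖ ≤ ∑ l ∈ Finset.range (i + 1 + 1), ‖g l x‖ := by
      rw [Finset.sum_range_succ _ (i + 1)]
      simp
    have h4 : ∑ l ∈ Finset.range (i + 1), ‖g (l + 1) x‖ ≤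
        ∑ l ∈ Finset.range (i + 1 + 1), ‖g l x‖ := by
      rw [Finset.sum_range_succ' _ (i + 1)]
      simp
    have hc : 0 ≤ 2 ^ i * δ := by positivity
    calc ‖leibniz (i + 1) η g x - η x • g (i + 1) x‖ ≤ _ := by
          simp only [leibniz, Pi.add_apply, add_sub_assoc]
          exact norm_add_le _ _
      _ ≤ _ := add_le_add (h1.trans (mul_le_mul_of_nonneg_left h3 hc))
          (h2.trans (mul_le_mul_of_nonneg_left h4 hc))
      _ = _ := by ring

/-- Cut-off functions with small derivatives on long intervals. -/
theorem exists_cutoff (k : ℕ) {δ : ℝ} (hδ : 0 < δ) : ∃ Λ > 0, ∀ L ≥ Λ, ∃ η : ℝ → ℝ,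
    ContDiff ℝ ∞ η ∧ (∀ x, |η x| ≤ 1) ∧ (∀ x, |x| ≤ L / 2 → η =ᶠ[𝓝 x] 1) ∧
    (∀ x, 3 * L / 4 < |x| → η =ᶠ[𝓝 x] 0) ∧
    ∀ l, 1 ≤ l → l ≤ k → ∀ x, |iteratedDeriv l η x| ≤ δ := by
  -- The inner radius `5/8` exceeds `1/2`, so after rescaling the function is `1` on a neighbourhood
  -- of each point of the closed interval `[-L/2, L/2]`.
  let b : ContDiffBump (0 : ℝ) := ⟨5 / 8, 3 / 4, by norm_num, by norm_num⟩
  have bs : ContDiff ℝ ∞ b := b.contDiff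
  have hbd : ∀ l, ∃ C, ∀ x, |iteratedDeriv l b x| ≤ C := fun l => by
    have hs : HasCompactSupport (iteratedDeriv l b) := by
      induction l with
      | zero => simpa using b.hasCompactSupport
      | succ l ih => rw [iteratedDeriv_succ]; exact ih.deriv
    obtain ⟨C, hC⟩ := hs.exists_bound_of_continuous
      (bs.continuous_iteratedDeriv l (by exact_mod_cast le_top))
    exact ⟨C, hC⟩
  choose C hC using hbd
  have hC0 : ∀ l, 0 ≤ C l := fun l => (abs_nonneg _).trans (hC l 0)
  set S := ∑ l ∈ Finset.range (k + 1), C l with hS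
  have hS0 : 0 ≤ S := Finset.sum_nonneg fun l _ => hC0 l
  -- The rescaled derivative of order `l ≥ 1` is at most `L⁻¹ ^ l * S ≤ L⁻¹ * S` when `L ≥ 1`, and
  -- `S / δ ≤ L` makes this at most `δ`.
  refine ⟨1 + S / δ, by positivity, fun L hL => ?_⟩
  have hL1 : 1 ≤ L := le_trans (by simp; positivity) hL
  have hL0 : 0 < L := by linarith
  have hSL : S ≤ δ * L := by
    have : S / δ ≤ L := by linarith
    rwa [div_le_iff₀' hδ] at this
  have cL : Continuous fun x : ℝ => L⁻¹ * x := by fun_prop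
  refine ⟨fun x => b (L⁻¹ * x), bs.comp (contDiff_const.mul contDiff_id), fun x => ?_,
    fun x hx => ?_, fun x hx => ?_, fun l h1 hl x => ?_⟩
  · rw [abs_of_nonneg b.nonneg]
    exact b.le_one
  · have : L⁻¹ * x ∈ Metric.ball (0 : ℝ) (5 / 8) := by
      rw [mem_ball_zero_iff, Real.norm_eq_abs, abs_mul, abs_of_pos (inv_pos.2 hL0),
        inv_mul_lt_iff₀ hL0]
      linarith
    filter_upwards [cL.continuousAt.preimage_mem_nhds (Metric.isOpen_ball.mem_nhds this)] with y hy
    exact b.one_of_mem_closedBall (Metric.ball_subset_closedBall hy)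
  · have : L⁻¹ * x ∈ (Metric.closedBall (0 : ℝ) (3 / 4))ᶜ := by
      rw [mem_compl_iff, mem_closedBall_zero_iff, Real.norm_eq_abs, abs_mul,
        abs_of_pos (inv_pos.2 hL0), not_le, lt_inv_mul_iff₀ hL0]
      linarith
    filter_upwards [cL.continuousAt.preimage_mem_nhds
      (Metric.isClosed_closedBall.isOpen_compl.mem_nhds this)] with y hy
    refine b.zero_of_le_dist ?_
    simp only [mem_preimage, mem_compl_iff, Metric.mem_closedBall, not_le] at hy
    exact hy.le
  · rw [congrFun (iteratedDeriv_comp_const_mul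
      (bs.of_le (by exact_mod_cast le_top)) L⁻¹) x, abs_mul, abs_pow, abs_of_pos (inv_pos.2 hL0)]
    have h2 : L⁻¹ ^ l ≤ L⁻¹ := pow_le_of_le_one (by positivity) (inv_le_one_of_one_le₀ hL1) (by omega)
    have h3 : C l ≤ S := Finset.single_le_sum (f := C) (fun l _ => hC0 l)
      (Finset.mem_range.2 (by omega))
    calc L⁻¹ ^ l * |iteratedDeriv l b (L⁻¹ * x)| ≤ L⁻¹ * S :=
          mul_le_mul h2 ((hC l _).trans h3) (abs_nonneg _) (by positivity)
      _ ≤ δ := by rw [inv_mul_le_iff₀ hL0]; linarith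

end Towers

/-! ### Weak derivatives under `L²` convergence. -/

section LTwoLimits

variable {E : Type*} [NormedAddCommGroup E] [NormedSpace ℝ E]

omit [NormedSpace ℝ E] in
theorem tendsto_eLpNorm_one_of_two {R : ℝ} {f : ℕ → ℝ → E}
    (hf : ∀ n, AEStronglyMeasurable (f n) volume)
    (h : Tendsto (fun n => eLpNorm (f n) 2 (volume.restrict (Icc (-R) R))) atTop (𝓝 0)) :
    Tendsto (fun n => eLpNorm (f n) 1 (volume.restrict (Icc (-R) R))) atTop (𝓝 0) := by
  set c := (volume.restrict (Icc (-R) R)) univ ^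
    (1 / (1 : ℝ≥0∞).toReal - 1 / (2 : ℝ≥0∞).toReal) with hc
  have hct : c ≠ ⊤ := ENNReal.rpow_ne_top_of_nonneg (by norm_num) (by simp)
  have h0 : Tendsto (fun n => eLpNorm (f n) 2 (volume.restrict (Icc (-R) R)) * c) atTop (𝓝 0) := by
    simpa using ENNReal.Tendsto.mul_const h (Or.inr hct)
  exact tendsto_of_tendsto_of_tendsto_of_le_of_le tendsto_const_nhds h0 (fun _ => zero_le)
    fun n => eLpNorm_le_eLpNorm_mul_rpow_measure_univ (by norm_num) (hf n).restrict

theorem isWeakDeriv_of_tendsto_two {f g : ℕ → ℝ → E} {F G : ℝ → E}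
    (h : ∀ n, IsWeakDeriv (f n) (g n)) (hF : LocallyIntegrable F volume)
    (hG : LocallyIntegrable G volume)
    (hfF : ∀ R > 0, Tendsto (fun n => eLpNorm (f n - F) 2 (volume.restrict (Icc (-R) R)))
      atTop (𝓝 0))
    (hgG : ∀ R > 0, Tendsto (fun n => eLpNorm (g n - G) 2 (volume.restrict (Icc (-R) R)))
      atTop (𝓝 0)) : IsWeakDeriv F G :=
  isWeakDeriv_of_tendsto h hF hG
    (fun R hR => tendsto_eLpNorm_one_of_two (fun n => (h n).left.aestronglyMeasurable.sub
      hF.aestronglyMeasurable) (hfF R hR))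
    (fun R hR => tendsto_eLpNorm_one_of_two (fun n => (h n).right.aestronglyMeasurable.sub
      hG.aestronglyMeasurable) (hgG R hR))

theorem isWeakDeriv_of_tendsto_Lp {f g : ℕ → ℝ → E} {F G : Lp E 2 (volume : Measure ℝ)}
    (h : ∀ n, IsWeakDeriv (f n) (g n))
    (hfF : Tendsto (fun n => eLpNorm (f n - ⇑F) 2 volume) atTop (𝓝 0))
    (hgG : Tendsto (fun n => eLpNorm (g n - ⇑G) 2 volume) atTop (𝓝 0)) :
    IsWeakDeriv ⇑F ⇑G :=
  isWeakDeriv_of_tendsto_two h ((Lp.memLp F).locallyIntegrable (by norm_num))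
    ((Lp.memLp G).locallyIntegrable (by norm_num))
    (fun _ _ => tendsto_of_tendsto_of_tendsto_of_le_of_le tendsto_const_nhds hfF
      (fun _ => zero_le) fun _ => eLpNorm_restrict_le _ _ _ _)
    (fun _ _ => tendsto_of_tendsto_of_tendsto_of_le_of_le tendsto_const_nhds hgG
      (fun _ => zero_le) fun _ => eLpNorm_restrict_le _ _ _ _)

end LTwoLimits

/-! ### Differential expressions with bounded coefficients, evaluated on towers. -/

section Expressions

variable {m : ℕ}

/-- The coefficients `B 0, …, B k` are measurable and bounded by `Q`. -/
structure IsBoundedCoeff (k : ℕ) (B : ℕ → ℝ → Matrix (Fin m) (Fin m) ℂ) (Q : ℝ) : Prop where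
  aestronglyMeasurable : ∀ j ≤ k, AEStronglyMeasurable (B j) volume
  nonneg : 0 ≤ Q
  bound : ∀ᵐ x, ∀ j ≤ k, ∀ w, ‖Matrix.toEuclideanLin (B j x) w‖ ≤ Q * ‖w‖

/-- The expression `∑_{j ≤ k} B_j g_j - lam g_0`. -/
noncomputable def resExpr (k : ℕ) (B : ℕ → ℝ → Matrix (Fin m) (Fin m) ℂ) (lam : ℂ)
    (g : ℕ → ℝ → EuclideanSpace ℂ (Fin m)) (x : ℝ) : EuclideanSpace ℂ (Fin m) :=
  ∑ j ∈ Finset.range (k + 1), Matrix.toEuclideanLin (B j x) (g j x) - lam • g 0 x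

theorem continuous_toEuclideanLin : Continuous fun p : Matrix (Fin m) (Fin m) ℂ ×
    EuclideanSpace ℂ (Fin m) => Matrix.toEuclideanLin p.1 p.2 := by
  simp only [Matrix.toEuclideanLin, Matrix.toLpLin_apply]
  exact (PiLp.continuous_toLp 2 _).comp (continuous_fst.matrix_mulVec
    ((PiLp.continuous_ofLp 2 _).comp continuous_snd))

variable {k : ℕ} {B : ℕ → ℝ → Matrix (Fin m) (Fin m) ℂ} {Q : ℝ} {lam : ℂ}
  {μ : Measure ℝ}

theorem IsBoundedCoeff.aestronglyMeasurable_resExpr (hB : IsBoundedCoeff k B Q)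
    (hμ : μ ≪ volume) {g : ℕ → ℝ → EuclideanSpace ℂ (Fin m)}
    (hg : ∀ j ≤ k, AEStronglyMeasurable (g j) μ) :
    AEStronglyMeasurable (resExpr k B lam g) μ := by
  have h1 : ∀ j ∈ Finset.range (k + 1),
      AEStronglyMeasurable (fun x => Matrix.toEuclideanLin (B j x) (g j x)) μ := fun j hj => by
    have hj : j ≤ k := by simpa [Nat.lt_succ_iff] using hj
    have h3 := ((hB.aestronglyMeasurable j hj).mono_ac hμ).prodMk (hg j hj)
    have h4 := continuous_toEuclideanLin.comp_aestronglyMeasurable h3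
    exact h4
  have h2 := (Finset.aestronglyMeasurable_sum _ h1).sub ((hg 0 (Nat.zero_le k)).const_smul lam)
  refine h2.congr (ae_of_all _ fun x => ?_)
  simp [resExpr]

theorem IsBoundedCoeff.norm_resExpr_le (hB : IsBoundedCoeff k B Q) (hμ : μ ≪ volume)
    (g : ℕ → ℝ → EuclideanSpace ℂ (Fin m)) :
    ∀ᵐ x ∂μ, ‖resExpr k B lam g x‖ ≤
      (Q + ‖lam‖) * ∑ j ∈ Finset.range (k + 1), ‖g j x‖ := by
  filter_upwards [hμ.ae_le hB.bound] with x hx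
  have h0 : ‖g 0 x‖ ≤ ∑ j ∈ Finset.range (k + 1), ‖g j x‖ :=
    Finset.single_le_sum (f := fun j => ‖g j x‖) (fun _ _ => norm_nonneg _) (by simp)
  calc ‖resExpr k B lam g x‖ ≤ _ := norm_sub_le _ _
    _ ≤ ∑ j ∈ Finset.range (k + 1), Q * ‖g j x‖ + ‖lam‖ * ‖g 0 x‖ := by
        rw [norm_smul]
        gcongr
        exact norm_sum_le_of_le _ fun j hj => hx j (by simpa [Nat.lt_succ_iff] using hj) _
    _ ≤ _ := by
        rw [← Finset.mul_sum, add_mul]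
        gcongr

theorem IsBoundedCoeff.eLpNorm_resExpr_le (hB : IsBoundedCoeff k B Q) (hμ : μ ≪ volume)
    {g : ℕ → ℝ → EuclideanSpace ℂ (Fin m)} (hg : ∀ j ≤ k, AEStronglyMeasurable (g j) μ) :
    eLpNorm (resExpr k B lam g) 2 μ ≤
      ENNReal.ofReal (Q + ‖lam‖) * ∑ j ∈ Finset.range (k + 1), eLpNorm (g j) 2 μ := by
  refine (eLpNorm_le_mul_eLpNorm_of_ae_le_mul
    (g := ∑ j ∈ Finset.range (k + 1), fun x => ‖g j x‖) (c := Q + ‖lam‖) ?_ 2).trans ?_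
  · filter_upwards [hB.norm_resExpr_le (lam := lam) hμ g] with x hx
    rwa [Finset.sum_apply, Real.norm_of_nonneg (Finset.sum_nonneg fun _ _ => norm_nonneg _)]
  · gcongr
    refine (eLpNorm_sum_le (fun j hj => (hg j (by simpa [Nat.lt_succ_iff] using hj)).norm)
      (by norm_num)).trans (le_of_eq ?_)
    exact Finset.sum_congr rfl fun j _ => eLpNorm_norm _

theorem IsBoundedCoeff.memLp_resExpr (hB : IsBoundedCoeff k B Q) (hμ : μ ≪ volume)
    {g : ℕ → ℝ → EuclideanSpace ℂ (Fin m)} (hg : ∀ j ≤ k, MemLp (g j) 2 μ) :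
    MemLp (resExpr k B lam g) 2 μ := by
  refine ⟨hB.aestronglyMeasurable_resExpr hμ fun j hj => (hg j hj).1,
    (hB.eLpNorm_resExpr_le hμ fun j hj => (hg j hj).1).trans_lt ?_⟩
  refine ENNReal.mul_lt_top ENNReal.ofReal_lt_top (ENNReal.sum_lt_top.2 fun j hj => ?_)
  exact (hg j (by simpa [Nat.lt_succ_iff] using hj)).2

theorem resExpr_sub (g g' : ℕ → ℝ → EuclideanSpace ℂ (Fin m)) :
    resExpr k B lam (fun j => g j - g' j) = resExpr k B lam g - resExpr k B lam g' := by
  funext x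
  simp only [resExpr, Pi.sub_apply, map_sub, Finset.sum_sub_distrib, smul_sub]
  abel

theorem resExpr_congr_ae {g g' : ℕ → ℝ → EuclideanSpace ℂ (Fin m)}
    (h : ∀ j ≤ k, g j =ᵐ[μ] g' j) : resExpr k B lam g =ᵐ[μ] resExpr k B lam g' := by
  have h1 : ∀ᵐ x ∂μ, ∀ j ∈ Finset.range (k + 1), g j x = g' j x := by
    rw [Finset.eventually_all]
    exact fun j hj => h j (by simpa [Nat.lt_succ_iff] using hj)
  filter_upwards [h1] with x hx
  simp only [resExpr, hx 0 (by simp)]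
  congr 1
  exact Finset.sum_congr rfl fun j hj => by rw [hx j hj]

end Expressions

/-! ### A Hilbert space criterion for resolvent points. -/

section AbstractResolvent

variable {X : Type*} [NormedAddCommGroup X] [InnerProductSpace ℂ X] [CompleteSpace X]

/-- An a priori bound together with closed and dense range implies that `A - lam` is boundedly
invertible. -/
theorem mem_resolventSet_of_bound (A : X →ₗ.[ℂ] X) (lam : ℂ) (M : ℝ)
    (hM : ∀ u : A.domain, ‖(u : X)‖ ≤ M * ‖A u - lam • (u : X)‖)
    (hcl : ∀ (u : ℕ → A.domain) (f : X),
      Tendsto (fun n => A (u n) - lam • (u n : X)) atTop (𝓝 f) →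
        ∃ w : A.domain, A w - lam • (w : X) = f)
    (hd : ∀ g : X, (∀ u : A.domain, inner ℂ g (A u - lam • (u : X)) = 0) → g = 0) :
    lam ∈ resolventSet A := by
  let S : A.domain →ₗ[ℂ] X := A.toFun - lam • A.domain.subtype
  have hS : ∀ u, S u = A u - lam • (u : X) := fun u => rfl
  have hclosed : IsClosed (LinearMap.range S : Set X) := by
    refine IsSeqClosed.isClosed fun f f₀ hf hlim => ?_
    choose u hu using hf
    obtain ⟨w, hw⟩ := hcl u f₀ (by simpa only [← hS, hu] using hlim)
    exact ⟨w, by rw [hS, hw]⟩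
  have htop : LinearMap.range S = ⊤ := by
    have : CompleteSpace (LinearMap.range S) := hclosed.completeSpace_coe
    rw [← Submodule.orthogonal_eq_bot_iff, Submodule.eq_bot_iff]
    intro g hg
    refine hd g fun u => ?_
    rw [← hS, ← inner_conj_symm, (Submodule.mem_orthogonal _ _).1 hg _ ⟨u, rfl⟩, map_zero]
  have hinj : Function.Injective S := by
    rw [← LinearMap.ker_eq_bot, Submodule.eq_bot_iff]
    intro u hu
    have h1 := hM u
    rw [← hS, LinearMap.mem_ker.1 hu, norm_zero, mul_zero] at h1
    exact Subtype.ext (norm_le_zero_iff.1 h1)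
  let e := LinearEquiv.ofBijective S ⟨hinj, LinearMap.range_eq_top.1 htop⟩
  have he : ∀ u, e u = A u - lam • (u : X) := fun u => rfl
  let R : X →L[ℂ] X := (A.domain.subtype ∘ₗ e.symm.toLinearMap).mkContinuous M fun f => by
    have := hM (e.symm f)
    rw [← he, LinearEquiv.apply_symm_apply] at this
    exact this
  have hR : ∀ f, R f = (e.symm f : X) := fun f => rfl
  refine ⟨R, fun f => ⟨by rw [hR]; exact (e.symm f).2, ?_⟩, fun u => ?_⟩
  · have := he (e.symm f)
    rw [LinearEquiv.apply_symm_apply] at this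
    exact this.symm
  · rw [← he, hR, LinearEquiv.symm_apply_apply]

end AbstractResolvent

/-! ### Resolvent points of differential operators in terms of towers. -/

section DiffOp

variable {m : ℕ} {μ : Measure ℝ} {hμ : μ ≪ volume}
  {e : Lp (EuclideanSpace ℂ (Fin m)) 2 μ → ℝ → EuclideanSpace ℂ (Fin m)}
  {e_add : ∀ f g, e (f + g) =ᵐ[volume] e f + e g}
  {e_smul : ∀ (c : ℂ) f, e (c • f) =ᵐ[volume] c • e f}
  {k : ℕ} {B : ℕ → ℝ → Matrix (Fin m) (Fin m) ℂ} {Q : ℝ} {lam : ℂ}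

/-- The weak derivative of order `j` as a map on the domain of a differential operator. -/
noncomputable def domDeriv (hμ : μ ≪ volume) (e_add : ∀ f g, e (f + g) =ᵐ[volume] e f + e g)
    (e_smul : ∀ (c : ℂ) f, e (c • f) =ᵐ[volume] c • e f)
    (B : ℕ → ℝ → Matrix (Fin m) (Fin m) ℂ) {j : ℕ} (hj : j ≤ k) :
    diffDomain μ hμ e e_add e_smul k B →ₗ[ℂ] Lp (EuclideanSpace ℂ (Fin m)) 2 μ where
  toFun u := MemLp.toLp (weakDeriv^[j] (e u.1)) (u.2.1.2 j hj)
  map_add' f g :=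
    (MemLp.toLp_congr ((f + g).2.1.2 j hj) ((f.2.1.2 j hj).add (g.2.1.2 j hj))
      (hμ.ae_le ((f.2.1.1.add g.2.1.1 (e_add f.1 g.1)).2 j hj))).trans
      (MemLp.toLp_add (f.2.1.2 j hj) (g.2.1.2 j hj))
  map_smul' c f :=
    (MemLp.toLp_congr ((c • f).2.1.2 j hj) ((f.2.1.2 j hj).const_smul c)
      (hμ.ae_le ((f.2.1.1.const_smul c (e_smul c f.1)).2 j hj))).trans
      (MemLp.toLp_const_smul c (f.2.1.2 j hj))

theorem coeFn_domDeriv {j : ℕ} (hj : j ≤ k) (u : diffDomain μ hμ e e_add e_smul k B) :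
    domDeriv hμ e_add e_smul B hj u =ᵐ[μ] weakDeriv^[j] (e u.1) :=
  MemLp.coeFn_toLp (u.2.1.2 j hj)

theorem coeFn_diffOp_sub (he : ∀ f, e f =ᵐ[μ] f)
    (u : (diffOp μ hμ e e_add e_smul k B).domain) :
    ((diffOp μ hμ e e_add e_smul k B u - lam • (u : Lp (EuclideanSpace ℂ (Fin m)) 2 μ) :
      Lp (EuclideanSpace ℂ (Fin m)) 2 μ) : ℝ → EuclideanSpace ℂ (Fin m)) =ᵐ[μ]
      resExpr k B lam fun j => weakDeriv^[j] (e u.1) := by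
  have h1 : (diffOp μ hμ e e_add e_smul k B u : Lp (EuclideanSpace ℂ (Fin m)) 2 μ) =ᵐ[μ]
      diffExpr k B (e u.1) := MemLp.coeFn_toLp u.2.2
  filter_upwards [Lp.coeFn_sub (diffOp μ hμ e e_add e_smul k B u) (lam • u.1), h1,
    Lp.coeFn_smul lam u.1, he u.1] with x h2 h3 h4 h5
  rw [h2, Pi.sub_apply, h3, h4, Pi.smul_apply, ← h5]
  rfl

/-- A function with enough weak derivatives belongs to the domain if the coefficients are
bounded. -/
theorem mem_domain_of_isTower (hB : IsBoundedCoeff k B Q)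
    {u : Lp (EuclideanSpace ℂ (Fin m)) 2 μ}
    {g : ℕ → ℝ → EuclideanSpace ℂ (Fin m)} (hg : IsTower k g) (h0 : e u =ᵐ[volume] g 0)
    (hgL : ∀ j ≤ k, MemLp (g j) 2 μ) :
    u ∈ (diffOp μ hμ e e_add e_smul k B).domain := by
  obtain ⟨h1, h2⟩ := hg.hasWeakDerivs h0
  have h3 : ∀ j ≤ k, MemLp (weakDeriv^[j] (e u)) 2 μ := fun j hj =>
    (hgL j hj).ae_eq (hμ.ae_eq (h2 j hj)).symm
  refine ⟨⟨h1, h3⟩, ?_⟩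
  have h4 := hB.memLp_resExpr (lam := 0) hμ h3
  refine h4.ae_eq (ae_of_all _ fun x => ?_)
  simp [resExpr, diffExpr]

/-- Through `e` (the identity on the line, the periodic extension on a period cell) both operators
share this criterion. The bound `hM` is required for every order `j`, since it must make all
derivatives of a sequence Cauchy once its images converge; `hcl` then says that the limits form a
tower, which gives closed range. `hd` expresses density of the range. -/
theorem mem_resolventSet_diffOp (hB : IsBoundedCoeff k B Q) (he : ∀ f, e f =ᵐ[μ] f) (M : ℝ≥0)
    (hM : ∀ g : ℕ → ℝ → EuclideanSpace ℂ (Fin m), ∀ u, IsTower k g → g 0 = e u →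
      (∀ j ≤ k, MemLp (g j) 2 μ) →
      ∀ j ≤ k, eLpNorm (g j) 2 μ ≤ M * eLpNorm (resExpr k B lam g) 2 μ)
    (hcl : ∀ (g : ℕ → ℕ → ℝ → EuclideanSpace ℂ (Fin m))
      (u : ℕ → Lp (EuclideanSpace ℂ (Fin m)) 2 μ) (h : ℕ → Lp (EuclideanSpace ℂ (Fin m)) 2 μ),
      (∀ n, IsTower k (g n)) → (∀ n, g n 0 = e (u n)) →
      (∀ j ≤ k, Tendsto (fun n => eLpNorm (g n j - ⇑(h j)) 2 μ) atTop (𝓝 0)) →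
      IsTower k fun j => e (h j))
    (hd : ∀ f : Lp (EuclideanSpace ℂ (Fin m)) 2 μ,
      (∀ g : ℕ → ℝ → EuclideanSpace ℂ (Fin m), ∀ u, IsTower k g → g 0 =ᵐ[volume] e u →
        (∀ j ≤ k, MemLp (g j) 2 μ) → ∫ x, inner ℂ (f x) (resExpr k B lam g x) ∂μ = 0) → f = 0) :
    lam ∈ resolventSet (diffOp μ hμ e e_add e_smul k B) := by
  set A := diffOp μ hμ e e_add e_smul k B with hA
  have hbd : ∀ (j : ℕ) (hj : j ≤ k) (u : A.domain),
      ‖domDeriv hμ e_add e_smul B hj u‖ ≤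
        M * ‖A u - lam • (u : Lp (EuclideanSpace ℂ (Fin m)) 2 μ)‖ := by
    intro j hj u
    have h1 := hM _ u.1 u.2.1.1.isTower rfl u.2.1.2 j hj
    rw [← eLpNorm_congr_ae (coeFn_diffOp_sub (lam := lam) he u),
      ← eLpNorm_congr_ae (coeFn_domDeriv hj u), ← Lp.enorm_def, ← Lp.enorm_def] at h1
    have h2 := ENNReal.toReal_mono (ENNReal.mul_ne_top ENNReal.coe_ne_top enorm_ne_top) h1
    simpa using h2
  have hd0 : ∀ u : A.domain, domDeriv hμ e_add e_smul B (Nat.zero_le k) u =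
      (u : Lp (EuclideanSpace ℂ (Fin m)) 2 μ) := fun u =>
    Lp.ext ((coeFn_domDeriv _ u).trans (he u.1))
  refine mem_resolventSet_of_bound A lam M (fun u => ?_) (fun u f hf => ?_) fun f hf => ?_
  · simpa only [hd0] using hbd 0 (Nat.zero_le k) u
  · have hex : ∀ j : ℕ, ∃ h : Lp (EuclideanSpace ℂ (Fin m)) 2 μ, ∀ hj : j ≤ k,
        Tendsto (fun n => domDeriv hμ e_add e_smul B hj (u n)) atTop (𝓝 h) := by
      intro j
      by_cases hj : j ≤ k
      · have hc : CauchySeq fun n => domDeriv hμ e_add e_smul B hj (u n) := by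
          rw [Metric.cauchySeq_iff']
          intro ε hε
          obtain ⟨N, hN⟩ := Metric.cauchySeq_iff'.1 hf.cauchySeq (ε / (M + 1)) (by positivity)
          refine ⟨N, fun n hn => ?_⟩
          have h1 := hbd j hj (u n - u N)
          have h2 := hN n hn
          rw [dist_eq_norm] at h2 ⊢
          have h4 : domDeriv hμ e_add e_smul B hj (u n - u N) = domDeriv hμ e_add e_smul B hj (u n) -
              domDeriv hμ e_add e_smul B hj (u N) := map_sub _ _ _
          rw [h4] at h1
          refine h1.trans_lt ?_
          have h3 : A (u n - u N) - lam • ((u n - u N : A.domain) :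
              Lp (EuclideanSpace ℂ (Fin m)) 2 μ) = A (u n) - lam • (u n).1 -
              (A (u N) - lam • (u N).1) := by
            rw [LinearPMap.map_sub, Submodule.coe_sub, smul_sub]
            abel
          rw [h3]
          rw [lt_div_iff₀ (by positivity)] at h2
          nlinarith [norm_nonneg (A (u n) - lam • (u n).1 - (A (u N) - lam • (u N).1))]
        obtain ⟨h, hh⟩ := cauchySeq_tendsto_of_complete hc
        exact ⟨h, fun _ => hh⟩
      -- A dummy value for orders above `k`, so that `h` becomes a total function of `j`.
      · exact ⟨0, fun h => absurd h hj⟩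
    choose h hh using hex
    have hh' : ∀ j ≤ k, Tendsto (fun n => eLpNorm (weakDeriv^[j] (e (u n).1) - ⇑(h j)) 2 μ)
        atTop (𝓝 0) := by
      intro j hj
      have h1 := (Lp.tendsto_Lp_iff_tendsto_eLpNorm' _ _).1 (hh j hj)
      refine h1.congr fun n => eLpNorm_congr_ae ?_
      exact (coeFn_domDeriv hj (u n)).sub (ae_eq_refl _)
    have ht := hcl (fun n j => weakDeriv^[j] (e (u n).1)) (fun n => (u n).1) h
      (fun n => (u n).2.1.1.isTower) (fun n => rfl) hh'
    have hL : ∀ j ≤ k, MemLp (e (h j)) 2 μ := fun j _ => (Lp.memLp (h j)).ae_eq (he _).symm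
    have hw : h 0 ∈ A.domain := mem_domain_of_isTower hB ht (ae_eq_refl _) hL
    refine ⟨⟨h 0, hw⟩, ?_⟩
    refine tendsto_nhds_unique ?_ hf
    rw [Lp.tendsto_Lp_iff_tendsto_eLpNorm']
    have hb : ∀ n, eLpNorm (⇑(A (u n) - lam • (u n).1 : Lp (EuclideanSpace ℂ (Fin m)) 2 μ) -
        ⇑(A ⟨h 0, hw⟩ - lam • h 0 : Lp (EuclideanSpace ℂ (Fin m)) 2 μ)) 2 μ ≤ ENNReal.ofReal (Q + ‖lam‖) *
        ∑ j ∈ Finset.range (k + 1), eLpNorm (weakDeriv^[j] (e (u n).1) - ⇑(h j)) 2 μ := by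
      intro n
      have e1 := coeFn_diffOp_sub (lam := lam) he (u n)
      have e2 : ((A ⟨h 0, hw⟩ - lam • h 0 : Lp (EuclideanSpace ℂ (Fin m)) 2 μ) :
          ℝ → EuclideanSpace ℂ (Fin m)) =ᵐ[μ] resExpr k B lam fun j => h j := by
        refine (coeFn_diffOp_sub (lam := lam) he ⟨h 0, hw⟩).trans (resExpr_congr_ae fun j hj => ?_)
        exact (hμ.ae_eq ((ht.hasWeakDerivs (ae_eq_refl _)).2 j hj)).trans (he _)
      rw [eLpNorm_congr_ae (e1.sub e2), ← resExpr_sub]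
      exact hB.eLpNorm_resExpr_le hμ fun j hj =>
        ((u n).2.1.2 j hj).1.sub (Lp.aestronglyMeasurable _)
    refine tendsto_of_tendsto_of_tendsto_of_le_of_le tendsto_const_nhds ?_
      (fun _ => zero_le) hb
    have : Tendsto (fun n => ∑ j ∈ Finset.range (k + 1),
        eLpNorm (weakDeriv^[j] (e (u n).1) - ⇑(h j)) 2 μ) atTop (𝓝 0) := by
      simpa using tendsto_finsetSum (Finset.range (k + 1)) fun j hj =>
        hh' j (by simpa [Nat.lt_succ_iff] using hj)
    simpa using ENNReal.Tendsto.const_mul this (Or.inr ENNReal.ofReal_ne_top)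
  · refine hd f fun g u hg h0 hgL => ?_
    have hu : u ∈ A.domain := mem_domain_of_isTower hB hg h0.symm hgL
    rw [← hf ⟨u, hu⟩, L2.inner_def]
    refine integral_congr_ae ?_
    have e1 : resExpr k B lam (fun j => weakDeriv^[j] (e u)) =ᵐ[μ] resExpr k B lam g :=
      resExpr_congr_ae fun j hj => hμ.ae_eq ((hg.hasWeakDerivs h0.symm).2 j hj)
    filter_upwards [coeFn_diffOp_sub (lam := lam) he ⟨u, hu⟩, e1] with x h1 h2
    rw [h1, h2]

/-- A point of the resolvent set of an operator on the line admits `H^k` bounds. -/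
theorem exists_bound_of_mem_resolventSet_lineOp (hB : IsBoundedCoeff k B Q)
    (h : lam ∈ resolventSet (lineOp k B)) : ∃ M : ℝ≥0,
      (∀ f : ℝ → EuclideanSpace ℂ (Fin m), MemLp f 2 volume → ∃ g, IsTower k g ∧
        (∀ j ≤ k, MemLp (g j) 2 volume) ∧
        (∀ j ≤ k, eLpNorm (g j) 2 volume ≤ M * eLpNorm f 2 volume) ∧
        resExpr k B lam g =ᵐ[volume] f) ∧
      ∀ g : ℕ → ℝ → EuclideanSpace ℂ (Fin m), IsTower k g → (∀ j ≤ k, MemLp (g j) 2 volume) →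
        ∀ j ≤ k, eLpNorm (g j) 2 volume ≤ M * eLpNorm (resExpr k B lam g) 2 volume := by
  obtain ⟨R, hR, hR'⟩ := h
  choose hdom hres using hR
  let P : Lp (EuclideanSpace ℂ (Fin m)) 2 (volume : Measure ℝ) →ₗ[ℂ] (lineOp k B).domain :=
    R.toLinearMap.codRestrict _ hdom
  let D (j : ℕ) (hj : j ≤ k) : Lp (EuclideanSpace ℂ (Fin m)) 2 (volume : Measure ℝ) →ₗ[ℂ]
      Lp (EuclideanSpace ℂ (Fin m)) 2 (volume : Measure ℝ) :=
    domDeriv Measure.AbsolutelyContinuous.rfl Lp.coeFn_add Lp.coeFn_smul B hj ∘ₗ P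
  have hD : ∀ j hj f, D j hj f =ᵐ[volume] weakDeriv^[j] (R f) := fun j hj f =>
    coeFn_domDeriv hj (P f)
  -- Closed graph theorem, by induction on `j`: once the derivative of order `j` of the resolvent is
  -- continuous, the weak derivative relation survives limits, so the graph at order `j + 1` is
  -- closed.
  have hcont : ∀ j hj, Continuous (D j hj) := by
    intro j
    induction j with
    | zero =>
      intro hj
      have : ∀ f, D 0 hj f = R f := fun f => Lp.ext (hD 0 hj f)
      simpa only [funext this] using R.continuous
    | succ j ih =>
      intro hj
      refine (D (j + 1) hj).continuous_of_seq_closed_graph fun f f₀ w hf hw => ?_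
      have t1 := ((ih (by omega)).tendsto f₀).comp hf
      rw [Lp.tendsto_Lp_iff_tendsto_eLpNorm'] at t1 hw
      have w1 : ∀ f, IsWeakDeriv (D j (by omega) f) (D (j + 1) hj f) := fun f =>
        (((hdom f).1.1.isWeakDeriv (j := j) hj).congr (hD j (by omega) f).symm).congr_right
          (hD (j + 1) hj f).symm
      have w2 := isWeakDeriv_of_tendsto_Lp (fun n => w1 (f n)) t1 hw
      exact Lp.ext (w2.unique (w1 f₀) (ae_eq_refl _))
  let DC (j : ℕ) : Lp (EuclideanSpace ℂ (Fin m)) 2 (volume : Measure ℝ) →L[ℂ]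
      Lp (EuclideanSpace ℂ (Fin m)) 2 (volume : Measure ℝ) :=
    if hj : j ≤ k then ⟨D j hj, hcont j hj⟩ else 0
  set M : ℝ≥0 := ∑ j ∈ Finset.range (k + 1), ‖DC j‖₊ with hM
  have hbound : ∀ f, ∀ j ≤ k, eLpNorm (weakDeriv^[j] (R f)) 2 volume ≤ M * eLpNorm f 2 volume := by
    intro f j hj
    have h1 : ‖DC j f‖ₑ ≤ ‖DC j‖ₑ * ‖f‖ₑ := (DC j).le_opENorm f
    have h2 : DC j f = D j hj f := by simp [DC, hj]
    rw [h2, Lp.enorm_def, Lp.enorm_def, eLpNorm_congr_ae (hD j hj f)] at h1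
    refine h1.trans ?_
    gcongr
    rw [enorm_eq_nnnorm, ENNReal.coe_le_coe]
    exact Finset.single_le_sum (f := fun j => ‖DC j‖₊) (fun _ _ => zero_le)
      (Finset.mem_range.2 (by omega))
  have hid : ∀ f : Lp (EuclideanSpace ℂ (Fin m)) 2 (volume : Measure ℝ), 
      (fun f : Lp (EuclideanSpace ℂ (Fin m)) 2 (volume : Measure ℝ) =>
        (f : ℝ → EuclideanSpace ℂ (Fin m))) f =ᵐ[volume] f := fun f => ae_eq_refl _
  refine ⟨M, fun f hf => ?_, fun g hg hgL j hj => ?_⟩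
  · set F := hf.toLp f with hF
    refine ⟨fun j => weakDeriv^[j] (R F), (hdom F).1.1.isTower, (hdom F).1.2, fun j hj => ?_, ?_⟩
    · rw [← eLpNorm_congr_ae hf.coeFn_toLp]
      exact hbound F j hj
    · have e1 : ⇑(lineOp k B ⟨R F, hdom F⟩ - lam • R F) = ⇑F :=
        congrArg (fun w : Lp (EuclideanSpace ℂ (Fin m)) 2 (volume : Measure ℝ) => ⇑w) (hres F)
      exact ((coeFn_diffOp_sub (lam := lam) hid ⟨R F, hdom F⟩).symm.trans
        (EventuallyEq.of_eq e1)).trans hf.coeFn_toLp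
  · set u := (hgL 0 (Nat.zero_le k)).toLp (g 0) with hu
    have hu0 : u =ᵐ[volume] g 0 := MemLp.coeFn_toLp _
    have hud : u ∈ (lineOp k B).domain := mem_domain_of_isTower hB hg hu0 hgL
    have hwd := (hg.hasWeakDerivs hu0).2
    have h1 := hR' ⟨u, hud⟩
    have h2 := hbound (lineOp k B ⟨u, hud⟩ - lam • u) j hj
    rw [h1] at h2
    rw [eLpNorm_congr_ae (hwd j hj)] at h2
    refine h2.trans (le_of_eq ?_)
    congr 1
    refine eLpNorm_congr_ae ((coeFn_diffOp_sub (lam := lam) hid ⟨u, hud⟩).trans ?_)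
    exact resExpr_congr_ae hwd

end DiffOp

theorem eLpNorm_two_sq {α F : Type*} [MeasurableSpace α] [NormedAddCommGroup F] (f : α → F)
    (μ : Measure α) : eLpNorm f 2 μ ^ 2 = ∫⁻ x, ‖f x‖ₑ ^ 2 ∂μ := by
  rw [eLpNorm_eq_lintegral_rpow_enorm_toReal (by norm_num) (by norm_num), ← ENNReal.rpow_natCast,
    ← ENNReal.rpow_mul]
  simp

theorem ennreal_le_of_sq_le_sq {a b : ℝ≥0∞} (h : a ^ 2 ≤ b ^ 2) : a ≤ b :=
  (ENNReal.pow_le_pow_left_iff two_ne_zero).1 h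

/-! ### Pointwise energy and the commutator with a cut-off. -/

section Commutator

variable {m k : ℕ}

/-- The pointwise energy `∑_{l ≤ k} |g_l|²`. -/
noncomputable def energy (k : ℕ) (g : ℕ → ℝ → EuclideanSpace ℂ (Fin m)) (x : ℝ) : ℝ≥0∞ :=
  ∑ l ∈ Finset.range (k + 1), ‖g l x‖ₑ ^ 2

theorem enorm_sq_le_energy (g : ℕ → ℝ → EuclideanSpace ℂ (Fin m)) {j : ℕ} (hj : j ≤ k) (x : ℝ) :
    ‖g j x‖ₑ ^ 2 ≤ energy k g x :=
  Finset.single_le_sum (f := fun l => ‖g l x‖ₑ ^ 2) (fun _ _ => zero_le)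
    (Finset.mem_range.2 (by omega))

theorem aemeasurable_energy {μ : Measure ℝ} {g : ℕ → ℝ → EuclideanSpace ℂ (Fin m)}
    (hg : ∀ j ≤ k, AEStronglyMeasurable (g j) μ) : AEMeasurable (energy k g) μ :=
  Finset.aemeasurable_fun_sum _ fun l hl =>
    (hg l (by simpa [Nat.lt_succ_iff] using hl)).enorm.pow_const 2

theorem lintegral_energy {μ : Measure ℝ} {g : ℕ → ℝ → EuclideanSpace ℂ (Fin m)}
    (hg : ∀ j ≤ k, AEStronglyMeasurable (g j) μ) :
    ∫⁻ x, energy k g x ∂μ = ∑ l ∈ Finset.range (k + 1), eLpNorm (g l) 2 μ ^ 2 := by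
  simp only [energy, eLpNorm_two_sq]
  exact lintegral_finsetSum' _ fun l hl =>
    (hg l (by simpa [Nat.lt_succ_iff] using hl)).enorm.pow_const 2

/-- Combines `(a + b)² ≤ 2a² + 2b²` with Cauchy–Schwarz for `k + 1` summands; it turns pointwise
commutator bounds into bounds that can be integrated. -/
theorem enorm_sq_le_of_norm_le {F : Type*} [NormedAddCommGroup F] {A h : F} {K δ : ℝ}
    {g : ℕ → ℝ → EuclideanSpace ℂ (Fin m)} {x : ℝ}
    (H : ‖A‖ ≤ ‖h‖ + K * δ * ∑ l ∈ Finset.range (k + 1), ‖g l x‖) :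
    ‖A‖ₑ ^ 2 ≤ 2 * ‖h‖ₑ ^ 2 + ENNReal.ofReal (2 * (k + 1) * K ^ 2 * δ ^ 2) * energy k g x := by
  have h1 : (∑ l ∈ Finset.range (k + 1), ‖g l x‖) ^ 2 ≤
      (k + 1) * ∑ l ∈ Finset.range (k + 1), ‖g l x‖ ^ 2 := by
    simpa using sq_sum_le_card_mul_sum_sq (s := Finset.range (k + 1)) (f := fun l => ‖g l x‖)
  have h2 : ‖A‖ ^ 2 ≤ 2 * ‖h‖ ^ 2 +
      2 * (k + 1) * K ^ 2 * δ ^ 2 * ∑ l ∈ Finset.range (k + 1), ‖g l x‖ ^ 2 := by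
    calc ‖A‖ ^ 2 ≤ (‖h‖ + K * δ * ∑ l ∈ Finset.range (k + 1), ‖g l x‖) ^ 2 := by gcongr
      _ ≤ 2 * ‖h‖ ^ 2 + 2 * (K * δ) ^ 2 * (∑ l ∈ Finset.range (k + 1), ‖g l x‖) ^ 2 := by
        nlinarith [sq_nonneg (‖h‖ - K * δ * ∑ l ∈ Finset.range (k + 1), ‖g l x‖)]
      _ ≤ 2 * ‖h‖ ^ 2 + 2 * (K * δ) ^ 2 *
          ((k + 1) * ∑ l ∈ Finset.range (k + 1), ‖g l x‖ ^ 2) := by gcongr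
      _ = _ := by ring
  have h3 := ENNReal.ofReal_le_ofReal h2
  rw [ENNReal.ofReal_add (by positivity) (by positivity), ENNReal.ofReal_mul (by positivity),
    ENNReal.ofReal_mul (by positivity), ENNReal.ofReal_sum_of_nonneg (fun _ _ => by positivity),
    ENNReal.ofReal_pow (norm_nonneg _), ENNReal.ofReal_pow (norm_nonneg _)] at h3
  simp only [ENNReal.ofReal_pow (norm_nonneg _), ofReal_norm] at h3
  simpa [energy] using h3

/-- The commutator of a differential expression with a slowly varying cut-off is small. -/
theorem norm_resExpr_leibniz_sub_le {B₁ B₂ : ℕ → ℝ → Matrix (Fin m) (Fin m) ℂ} {lam₁ lam₂ : ℂ}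
    {x Q δ : ℝ} (hQ : 0 ≤ Q) (hδ : 0 ≤ δ)
    (h1 : ∀ j ≤ k, ∀ w, ‖Matrix.toEuclideanLin (B₁ j x) w‖ ≤ Q * ‖w‖)
    (h2 : ∀ j, 1 ≤ j → j ≤ k → B₂ j x = B₁ j x)
    (h3 : ∀ w, ‖Matrix.toEuclideanLin (B₁ 0 x) w - Matrix.toEuclideanLin (B₂ 0 x) w‖ ≤ δ * ‖w‖)
    (h4 : ‖lam₁ - lam₂‖ ≤ δ) {η : ℝ → ℝ} (hη1 : |η x| ≤ 1)
    (hη : ∀ l, 1 ≤ l → l ≤ k → |iteratedDeriv l η x| ≤ δ)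
    (g : ℕ → ℝ → EuclideanSpace ℂ (Fin m)) :
    ‖resExpr k B₁ lam₁ (fun i => leibniz i η g) x - η x • resExpr k B₂ lam₂ g x‖ ≤
      ((k + 1) * Q * 2 ^ k + 2) * δ * ∑ l ∈ Finset.range (k + 1), ‖g l x‖ := by
  set sg := ∑ l ∈ Finset.range (k + 1), ‖g l x‖ with hsg
  have hsg0 : 0 ≤ sg := Finset.sum_nonneg fun _ _ => norm_nonneg _
  have h0 : ‖g 0 x‖ ≤ sg :=
    Finset.single_le_sum (f := fun j => ‖g j x‖) (fun _ _ => norm_nonneg _) (by simp)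
  have e1 : ∑ j ∈ Finset.range (k + 1), Matrix.toEuclideanLin (B₂ j x) (g j x) =
      ∑ j ∈ Finset.range (k + 1), Matrix.toEuclideanLin (B₁ j x) (g j x) -
      (Matrix.toEuclideanLin (B₁ 0 x) (g 0 x) - Matrix.toEuclideanLin (B₂ 0 x) (g 0 x)) := by
    rw [Finset.sum_range_succ', Finset.sum_range_succ']
    have : ∑ j ∈ Finset.range k, Matrix.toEuclideanLin (B₂ (j + 1) x) (g (j + 1) x) =
        ∑ j ∈ Finset.range k, Matrix.toEuclideanLin (B₁ (j + 1) x) (g (j + 1) x) :=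
      Finset.sum_congr rfl fun j hj => by
        rw [h2 (j + 1) (by omega) (by have := Finset.mem_range.1 hj; omega)]
    rw [this]
    abel
  -- Three sources of error are separated: the commutator with `η`, the difference of the
  -- coefficients of order zero, and the shift of the spectral parameter.
  have e2 : resExpr k B₁ lam₁ (fun i => leibniz i η g) x - η x • resExpr k B₂ lam₂ g x =
      ∑ j ∈ Finset.range (k + 1),
        Matrix.toEuclideanLin (B₁ j x) (leibniz j η g x - η x • g j x) +
      (η x • (Matrix.toEuclideanLin (B₁ 0 x) (g 0 x) - Matrix.toEuclideanLin (B₂ 0 x) (g 0 x)) -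
      η x • ((lam₁ - lam₂) • g 0 x)) := by
    have e3 : leibniz 0 η g x = η x • g 0 x := rfl
    simp only [resExpr, e1, e3, map_sub, LinearMap.map_smul_of_tower, Finset.sum_sub_distrib,
      ← Finset.smul_sum, smul_sub, sub_smul]
    rw [smul_comm lam₁ (η x)]
    abel
  rw [e2]
  have b1 : ∀ j ∈ Finset.range (k + 1),
      ‖Matrix.toEuclideanLin (B₁ j x) (leibniz j η g x - η x • g j x)‖ ≤ Q * 2 ^ k * δ * sg := by
    intro j hj
    have hj : j ≤ k := by simpa [Nat.lt_succ_iff] using hj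
    refine (h1 j hj _).trans ?_
    have b3 : ∑ l ∈ Finset.range (j + 1), ‖g l x‖ ≤ sg :=
      Finset.sum_le_sum_of_subset_of_nonneg (Finset.range_mono (by omega))
        fun _ _ _ => norm_nonneg _
    have b4 : (2 : ℝ) ^ j ≤ 2 ^ k := pow_le_pow_right₀ (by norm_num) hj
    calc Q * ‖leibniz j η g x - η x • g j x‖ ≤ Q * (2 ^ j * δ * ∑ l ∈ Finset.range (j + 1),
          ‖g l x‖) := by
          gcongr
          exact norm_leibniz_sub_le hδ j (fun l h h' => hη l h (h'.trans hj)) g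
      _ ≤ Q * (2 ^ k * δ * sg) := by gcongr
      _ = _ := by ring
  have b2 : ‖η x • (Matrix.toEuclideanLin (B₁ 0 x) (g 0 x) -
      Matrix.toEuclideanLin (B₂ 0 x) (g 0 x))‖ ≤ δ * sg := by
    rw [norm_smul, Real.norm_eq_abs]
    calc _ ≤ 1 * (δ * ‖g 0 x‖) := by gcongr; exact h3 _
      _ ≤ _ := by rw [one_mul]; gcongr
  have b3 : ‖η x • ((lam₁ - lam₂) • g 0 x)‖ ≤ δ * sg := by
    rw [norm_smul, norm_smul, Real.norm_eq_abs]
    calc _ ≤ 1 * (δ * ‖g 0 x‖) := by gcongr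
      _ ≤ _ := by rw [one_mul]; gcongr
  calc _ ≤ _ := norm_add_le _ _
    _ ≤ ∑ j ∈ Finset.range (k + 1), Q * 2 ^ k * δ * sg + (δ * sg + δ * sg) :=
        add_le_add (norm_sum_le_of_le _ b1) ((norm_sub_le _ _).trans (add_le_add b2 b3))
    _ = _ := by
        rw [Finset.sum_const, Finset.card_range, nsmul_eq_mul]
        push_cast
        ring

end Commutator

/-! ### Estimates and approximate solutions on one window of length comparable to the period. -/

section Local

variable {m k : ℕ} {B B' : ℕ → ℝ → Matrix (Fin m) (Fin m) ℂ} {Q δ L : ℝ} {lam lam' : ℂ}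

/-- The coefficients `B'` are `L`-periodic, agree with `B` in the orders `j ≥ 1`, and are
`δ`-close to `B` in the order `0` on `[-3L/4, 3L/4]`. -/
structure IsPeriodicApprox (k : ℕ) (B B' : ℕ → ℝ → Matrix (Fin m) (Fin m) ℂ) (L δ : ℝ) :
    Prop where
  pos : 0 < L
  periodic : ∀ j ≤ k, Function.Periodic (B' j) L
  eq : ∀ j, 1 ≤ j → j ≤ k → B' j = B j
  near : ∀ᵐ x, |x| ≤ 3 * L / 4 → ∀ w,
    ‖Matrix.toEuclideanLin (B 0 x) w - Matrix.toEuclideanLin (B' 0 x) w‖ ≤ δ * ‖w‖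

/-- A cut-off function for the interval `[-L/2, L/2]` with derivatives bounded by `δ`. -/
structure IsSlowCutoff (k : ℕ) (L δ : ℝ) (η : ℝ → ℝ) : Prop where
  smooth : ContDiff ℝ ∞ η
  abs_le_one : ∀ x, |η x| ≤ 1
  eventuallyEq_one : ∀ x, |x| ≤ L / 2 → η =ᶠ[𝓝 x] 1
  eventuallyEq_zero : ∀ x, 3 * L / 4 < |x| → η =ᶠ[𝓝 x] 0
  abs_iteratedDeriv_le : ∀ l, 1 ≤ l → l ≤ k → ∀ x, |iteratedDeriv l η x| ≤ δ

theorem IsSlowCutoff.leibniz_eq_zero {η : ℝ → ℝ} (hη : IsSlowCutoff k L δ η) (hL : 0 < L) (i : ℕ)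
    (g : ℕ → ℝ → EuclideanSpace ℂ (Fin m)) {x : ℝ} (hx : x ∉ Ioc (-L) L) :
    leibniz i η g x = 0 := by
  refine PeriodicPulse.leibniz_eq_zero (hη.eventuallyEq_zero x ?_) i g
  by_contra h
  rw [not_lt, abs_le] at h
  exact hx ⟨by linarith, by linarith⟩

theorem IsSlowCutoff.memLp_leibniz {η : ℝ → ℝ} (hη : IsSlowCutoff k L δ η) (hL : 0 < L)
    (hδ : δ ≤ 1) {g : ℕ → ℝ → EuclideanSpace ℂ (Fin m)} (hg : IsTower k g)
    (hgL : ∀ j ≤ k, MemLp (g j) 2 (volume.restrict (Ioc (-L) L))) {i : ℕ} (hi : i ≤ k) :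
    MemLp (leibniz i η g) 2 volume := by
  have e1 : leibniz i η g = (Ioc (-L) L).indicator (leibniz i η g) := by
    funext x
    by_cases hx : x ∈ Ioc (-L) L
    · rw [indicator_of_mem hx]
    · rw [indicator_of_notMem hx, hη.leibniz_eq_zero hL i g hx]
  rw [e1, memLp_indicator_iff_restrict measurableSet_Ioc]
  have h1 : MemLp (fun x => 2 ^ i * 1 * ∑ l ∈ Finset.range (i + 1), ‖g l x‖) 2
      (volume.restrict (Ioc (-L) L)) :=
    (memLp_finsetSum _ fun l hl => (hgL l (by have := Finset.mem_range.1 hl; omega)).norm).const_mul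
      _
  refine h1.mono' ((isTower_leibniz hg hη.smooth).aestronglyMeasurable hi).restrict
    (ae_of_all _ fun x => ?_)
  refine norm_leibniz_le i (fun l hl => ?_) g
  rcases Nat.eq_zero_or_pos l with rfl | h
  · simpa using hη.abs_le_one x
  · exact (hη.abs_iteratedDeriv_le l h (hl.trans hi) x).trans hδ

/-- A local a priori estimate on `[-L/2, L/2]`. -/
theorem exists_local_apriori (hB : IsBoundedCoeff k B Q) (M : ℝ≥0)
    (hM : ∀ g : ℕ → ℝ → EuclideanSpace ℂ (Fin m), IsTower k g →
      (∀ j ≤ k, MemLp (g j) 2 volume) →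
      ∀ j ≤ k, eLpNorm (g j) 2 volume ≤ M * eLpNorm (resExpr k B lam g) 2 volume) :
    ∃ C : ℝ≥0, ∀ (L δ : ℝ) (B' : ℕ → ℝ → Matrix (Fin m) (Fin m) ℂ) (lam' : ℂ) (η : ℝ → ℝ),
      0 ≤ δ → δ ≤ 1 → IsPeriodicApprox k B B' L δ → IsSlowCutoff k L δ η → ‖lam - lam'‖ ≤ δ →
      ∀ g : ℕ → ℝ → EuclideanSpace ℂ (Fin m), IsTower k g →
        (∀ j ≤ k, MemLp (g j) 2 (volume.restrict (Ioc (-L) L))) →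
        ∫⁻ x in Ioc (-(L / 2)) (L / 2), energy k g x ≤
          ∫⁻ x in Ioc (-L) L, (C * ‖resExpr k B' lam' g x‖ₑ ^ 2 +
            C * ENNReal.ofReal (δ ^ 2) * energy k g x) := by
  set K : ℝ := (k + 1) * Q * 2 ^ k + 2 with hK
  have hK0 : 0 ≤ 2 * (k + 1) * K ^ 2 := by positivity
  set C₁ : ℝ≥0 := 2 + (2 * (k + 1) * K ^ 2).toNNReal with hC₁
  -- Each of the `k + 1` derivatives is bounded by `M` times the norm of `r`, and `C₁` dominates
  -- both coefficients in `enorm_sq_le_of_norm_le`. The constant does not see `L`, `δ`, `B'` or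
  -- `lam'`.
  refine ⟨(k + 1) * M ^ 2 * C₁, fun L δ B' lam' η hδ hδ1 hB' hη hlam g hg hgL => ?_⟩
  have hL := hB'.pos
  -- The global estimate for `B` becomes applicable after cutting off, although `g` is
  -- square-integrable only on the window.
  have ht := isTower_leibniz hg hη.smooth
  have hm : ∀ i ≤ k, MemLp (leibniz i η g) 2 volume := fun i hi =>
    hη.memLp_leibniz hL hδ1 hg hgL hi
  set r := resExpr k B lam fun i => leibniz i η g with hr
  have hr0 : ∀ x, x ∉ Ioc (-L) L → r x = 0 := fun x hx => by
    simp [hr, resExpr, hη.leibniz_eq_zero hL _ g hx]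
  have hrb : ∀ᵐ x, ‖r x‖ₑ ^ 2 ≤ C₁ * ‖resExpr k B' lam' g x‖ₑ ^ 2 +
      C₁ * ENNReal.ofReal (δ ^ 2) * energy k g x := by
    filter_upwards [hB.bound, hB'.near] with x hx hx'
    by_cases hxL : |x| ≤ 3 * L / 4
    · have h1 := norm_resExpr_leibniz_sub_le (B₁ := B) (B₂ := B') (lam₁ := lam) (lam₂ := lam')
        hB.nonneg hδ hx (fun j h h' => by rw [hB'.eq j h h']) (hx' hxL) hlam (hη.abs_le_one x)
        (fun l h h' => hη.abs_iteratedDeriv_le l h h' x) g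
      have h2 : ‖r x‖ ≤ ‖resExpr k B' lam' g x‖ +
          K * δ * ∑ l ∈ Finset.range (k + 1), ‖g l x‖ := by
        calc ‖r x‖ = ‖η x • resExpr k B' lam' g x + (r x - η x • resExpr k B' lam' g x)‖ := by
              rw [add_sub_cancel]
          _ ≤ _ := norm_add_le _ _
          _ ≤ _ := by
              refine add_le_add ?_ h1
              rw [norm_smul, Real.norm_eq_abs]
              exact mul_le_of_le_one_left (norm_nonneg _) (hη.abs_le_one x)
      refine (enorm_sq_le_of_norm_le h2).trans ?_
      rw [ENNReal.ofReal_mul hK0]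
      gcongr
      · rw [hC₁]
        push_cast
        exact le_self_add
      · rw [hC₁]
        push_cast
        exact le_add_self
    · have : r x = 0 := by
        have h0 := hη.eventuallyEq_zero x (not_le.1 hxL)
        simp [hr, resExpr, leibniz_eq_zero h0]
      simp [this]
  have hrn : eLpNorm r 2 volume ^ 2 ≤ ∫⁻ x in Ioc (-L) L,
      (C₁ * ‖resExpr k B' lam' g x‖ₑ ^ 2 + C₁ * ENNReal.ofReal (δ ^ 2) * energy k g x) := by
    rw [eLpNorm_two_sq, ← setLIntegral_eq_of_support_subset (s := Ioc (-L) L) fun x hx => ?_]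
    · exact lintegral_mono_ae (ae_restrict_of_ae hrb)
    · by_contra h
      exact hx (by simp [hr0 x h])
  have hgi : ∀ i ≤ k, ∫⁻ x in Ioc (-(L / 2)) (L / 2), ‖g i x‖ₑ ^ 2 ≤
      (M : ℝ≥0∞) ^ 2 * eLpNorm r 2 volume ^ 2 := by
    intro i hi
    calc ∫⁻ x in Ioc (-(L / 2)) (L / 2), ‖g i x‖ₑ ^ 2
        = ∫⁻ x in Ioc (-(L / 2)) (L / 2), ‖leibniz i η g x‖ₑ ^ 2 := by
          refine setLIntegral_congr_fun measurableSet_Ioc fun x hx => ?_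
          have h1 : |x| ≤ L / 2 := abs_le.2 ⟨hx.1.le, hx.2⟩
          simp only [leibniz_eq_self (hη.eventuallyEq_one x h1)]
      _ ≤ ∫⁻ x, ‖leibniz i η g x‖ₑ ^ 2 := setLIntegral_le_lintegral _ _
      _ = eLpNorm (leibniz i η g) 2 volume ^ 2 := (eLpNorm_two_sq _ _).symm
      _ ≤ (M * eLpNorm r 2 volume) ^ 2 := by gcongr; exact hM _ ht hm i hi
      _ = _ := mul_pow _ _ _
  calc ∫⁻ x in Ioc (-(L / 2)) (L / 2), energy k g x
      = ∑ i ∈ Finset.range (k + 1), ∫⁻ x in Ioc (-(L / 2)) (L / 2), ‖g i x‖ₑ ^ 2 := by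
        simp only [energy]
        exact lintegral_finsetSum' _ fun l hl =>
          (hg.aestronglyMeasurable (by have := Finset.mem_range.1 hl; omega)).restrict.enorm.pow_const 2
    _ ≤ ∑ i ∈ Finset.range (k + 1), (M : ℝ≥0∞) ^ 2 * eLpNorm r 2 volume ^ 2 :=
        Finset.sum_le_sum fun i hi => hgi i (by have := Finset.mem_range.1 hi; omega)
    _ = (k + 1) * (M : ℝ≥0∞) ^ 2 * eLpNorm r 2 volume ^ 2 := by
        rw [Finset.sum_const, Finset.card_range, nsmul_eq_mul]
        push_cast
        ring
    _ ≤ (k + 1) * (M : ℝ≥0∞) ^ 2 * ∫⁻ x in Ioc (-L) L,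
      (C₁ * ‖resExpr k B' lam' g x‖ₑ ^ 2 + C₁ * ENNReal.ofReal (δ ^ 2) * energy k g x) := by gcongr
    _ = _ := by
        rw [← lintegral_const_mul' _ _ (by finiteness)]
        refine lintegral_congr fun x => ?_
        push_cast
        ring

/-- Approximate solvability for right-hand sides supported in `[-L/2, L/2]`. -/
theorem exists_local_solution (hB : IsBoundedCoeff k B Q) (M : ℝ≥0)
    (hM : ∀ f : ℝ → EuclideanSpace ℂ (Fin m), MemLp f 2 volume → ∃ g, IsTower k g ∧
        (∀ j ≤ k, MemLp (g j) 2 volume) ∧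
        (∀ j ≤ k, eLpNorm (g j) 2 volume ≤ M * eLpNorm f 2 volume) ∧
        resExpr k B lam g =ᵐ[volume] f) :
    ∃ C : ℝ≥0, ∀ (L δ : ℝ) (B' : ℕ → ℝ → Matrix (Fin m) (Fin m) ℂ) (lam' : ℂ) (η : ℝ → ℝ),
      0 ≤ δ → δ ≤ 1 → IsPeriodicApprox k B B' L δ → IsSlowCutoff k L δ η → ‖lam - lam'‖ ≤ δ →
      ∀ f : ℝ → EuclideanSpace ℂ (Fin m), MemLp f 2 volume →
        (∀ x, x ∉ Ioc (-(L / 2)) (L / 2) → f x = 0) →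
        ∃ p, IsTower k p ∧ (∀ j, ∀ x, x ∉ Ioc (-L) L → p j x = 0) ∧
          (∀ j ≤ k, MemLp (p j) 2 volume) ∧
          eLpNorm (resExpr k B' lam' p - f) 2 volume ^ 2 ≤
            C * ENNReal.ofReal (δ ^ 2) * eLpNorm f 2 volume ^ 2 := by
  -- The commutator is now taken with `B'` instead of `B`; where the cut-off lives, its coefficients
  -- are bounded by `Q + δ ≤ Q + 1`.
  set K : ℝ := (k + 1) * (Q + 1) * 2 ^ k + 2 with hK
  have hK0 : 0 ≤ 2 * (k + 1) * K ^ 2 := by positivity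
  set C₁ : ℝ≥0 := (2 * (k + 1) * K ^ 2).toNNReal with hC₁
  refine ⟨C₁ * ((k + 1) * M ^ 2), fun L δ B' lam' η hδ hδ1 hB' hη hlam f hf hf0 => ?_⟩
  have hL := hB'.pos
  obtain ⟨g, hg, hgL, hgb, hgf⟩ := hM f hf
  refine ⟨fun i => leibniz i η g, isTower_leibniz hg hη.smooth,
    fun j x hx => hη.leibniz_eq_zero hL j g hx,
    fun j hj => hη.memLp_leibniz hL hδ1 hg (fun j hj => (hgL j hj).restrict _) hj, ?_⟩
  have hb : ∀ᵐ x, ‖(resExpr k B' lam' (fun i => leibniz i η g) - f) x‖ₑ ^ 2 ≤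
      C₁ * ENNReal.ofReal (δ ^ 2) * energy k g x := by
    filter_upwards [hB.bound, hB'.near, hgf] with x hx hx' hgx
    by_cases hxL : |x| ≤ 3 * L / 4
    · have h0 : ∀ j ≤ k, ∀ w, ‖Matrix.toEuclideanLin (B' j x) w‖ ≤ (Q + 1) * ‖w‖ := by
        intro j hj w
        rcases Nat.eq_zero_or_pos j with rfl | h
        · calc _ = ‖Matrix.toEuclideanLin (B 0 x) w - (Matrix.toEuclideanLin (B 0 x) w -
                Matrix.toEuclideanLin (B' 0 x) w)‖ := by rw [sub_sub_cancel]
            _ ≤ _ := norm_sub_le _ _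
            _ ≤ Q * ‖w‖ + δ * ‖w‖ := add_le_add (hx 0 hj w) (hx' hxL w)
            _ ≤ (Q + 1) * ‖w‖ := by nlinarith [norm_nonneg w]
        · rw [hB'.eq j h hj]
          nlinarith [hx j hj w, norm_nonneg w]
      have h1 := norm_resExpr_leibniz_sub_le (B₁ := B') (B₂ := B) (lam₁ := lam') (lam₂ := lam)
        (by linarith [hB.nonneg] : 0 ≤ Q + 1) hδ h0 (fun j h h' => by rw [hB'.eq j h h'])
        (fun w => by rw [norm_sub_rev]; exact hx' hxL w)
        (by rw [norm_sub_rev]; exact hlam) (hη.abs_le_one x)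
        (fun l h h' => hη.abs_iteratedDeriv_le l h h' x) g
      -- The cut-off equals `1` on the support of `f`, so truncating the exact solution does not
      -- alter the right-hand side.
      have h3 : η x • f x = f x := by
        by_cases hxI : x ∈ Ioc (-(L / 2)) (L / 2)
        · rw [(hη.eventuallyEq_one x (abs_le.2 ⟨hxI.1.le, hxI.2⟩)).eq_of_nhds, Pi.one_apply,
            one_smul]
        · rw [hf0 x hxI, smul_zero]
      rw [hgx, h3] at h1
      have h4 : ‖(resExpr k B' lam' (fun i => leibniz i η g) - f) x‖ ≤
          ‖(0 : EuclideanSpace ℂ (Fin m))‖ + K * δ * ∑ l ∈ Finset.range (k + 1), ‖g l x‖ := by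
        rw [norm_zero, zero_add]
        exact h1
      refine (enorm_sq_le_of_norm_le h4).trans ?_
      rw [ENNReal.ofReal_mul hK0]
      simp [hC₁, ENNReal.ofReal]
    · have h0 := hη.eventuallyEq_zero x (not_le.1 hxL)
      have h1 : f x = 0 := hf0 x fun h => hxL (abs_le.2 ⟨by linarith [h.1], by linarith [h.2]⟩)
      simp [resExpr, leibniz_eq_zero h0, h1]
  rw [eLpNorm_two_sq]
  calc _ ≤ ∫⁻ x, C₁ * ENNReal.ofReal (δ ^ 2) * energy k g x := lintegral_mono_ae hb
    _ = C₁ * ENNReal.ofReal (δ ^ 2) *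
        ∑ l ∈ Finset.range (k + 1), eLpNorm (g l) 2 volume ^ 2 := by
        rw [lintegral_const_mul' _ _ (by finiteness), lintegral_energy fun j hj => (hgL j hj).1]
    _ ≤ C₁ * ENNReal.ofReal (δ ^ 2) *
        ∑ l ∈ Finset.range (k + 1), (M * eLpNorm f 2 volume) ^ 2 := by
        gcongr with l hl
        exact hgb l (by have := Finset.mem_range.1 hl; omega)
    _ = _ := by
        rw [Finset.sum_const, Finset.card_range, nsmul_eq_mul]
        push_cast
        ring

/-- A function that is orthogonal to the image of compactly supported functions is small on
`[-L/2, L/2]` relative to `[-L, L]`. -/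
theorem exists_local_orthogonal (hB : IsBoundedCoeff k B Q) (M : ℝ≥0)
    (hM : ∀ f : ℝ → EuclideanSpace ℂ (Fin m), MemLp f 2 volume → ∃ g, IsTower k g ∧
        (∀ j ≤ k, MemLp (g j) 2 volume) ∧
        (∀ j ≤ k, eLpNorm (g j) 2 volume ≤ M * eLpNorm f 2 volume) ∧
        resExpr k B lam g =ᵐ[volume] f) :
    ∃ C : ℝ≥0, ∀ (L δ Q' : ℝ) (B' : ℕ → ℝ → Matrix (Fin m) (Fin m) ℂ) (lam' : ℂ) (η : ℝ → ℝ),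
      0 ≤ δ → δ ≤ 1 → IsBoundedCoeff k B' Q' → IsPeriodicApprox k B B' L δ →
      IsSlowCutoff k L δ η → ‖lam - lam'‖ ≤ δ →
      ∀ g : ℝ → EuclideanSpace ℂ (Fin m), MemLp g 2 (volume.restrict (Ioc (-L) L)) →
        (∀ p, IsTower k p → (∀ j, ∀ x, x ∉ Ioc (-L) L → p j x = 0) →
          (∀ j ≤ k, MemLp (p j) 2 volume) → ∫ x, inner ℂ (g x) (resExpr k B' lam' p x) = 0) →
        ∫⁻ x in Ioc (-(L / 2)) (L / 2), ‖g x‖ₑ ^ 2 ≤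
          ∫⁻ x in Ioc (-L) L, C * ENNReal.ofReal (δ ^ 2) * ‖g x‖ₑ ^ 2 := by
  obtain ⟨C, hC⟩ := exists_local_solution hB M hM
  refine ⟨C, fun L δ Q' B' lam' η hδ hδ1 hBb hB' hη hlam g hg hort => ?_⟩
  have hL := hB'.pos
  have hsub : Ioc (-(L / 2)) (L / 2) ⊆ Ioc (-L) L := Ioc_subset_Ioc (by linarith) (by linarith)
  set gW := (Ioc (-L) L).indicator g with hgW
  set f := (Ioc (-(L / 2)) (L / 2)).indicator g with hf
  have hgWL : MemLp gW 2 volume := (memLp_indicator_iff_restrict measurableSet_Ioc).2 hg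
  have hfL : MemLp f 2 volume := (memLp_indicator_iff_restrict measurableSet_Ioc).2
    (hg.mono_measure (Measure.restrict_mono hsub le_rfl))
  -- Here `f` is `g` restricted to the half window and the image of `p` approximates it. Since `g`
  -- is orthogonal to that image, `‖f‖² = ⟨g, f⟩` equals `⟨g, f - image⟩`, which is of order `δ ‖g‖
  -- ‖f‖`.
  obtain ⟨p, hp, hp0, hpL, hpf⟩ := hC L δ B' lam' η hδ hδ1 hB' hη hlam f hfL
    (fun x hx => indicator_of_notMem hx _)
  have hrL : MemLp (resExpr k B' lam' p) 2 volume :=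
    hBb.memLp_resExpr Measure.AbsolutelyContinuous.rfl hpL
  set G := hgWL.toLp gW
  set F := hfL.toLp f
  set P := hrL.toLp (resExpr k B' lam' p)
  have i1 : inner ℂ G P = 0 := by
    rw [L2.inner_def, ← hort p hp hp0 hpL]
    refine integral_congr_ae ?_
    filter_upwards [hgWL.coeFn_toLp, hrL.coeFn_toLp] with x h1 h2
    rw [h1, h2]
    by_cases hx : x ∈ Ioc (-L) L
    · rw [hgW, indicator_of_mem hx]
    · have : resExpr k B' lam' p x = 0 := by simp [resExpr, hp0 _ x hx]
      rw [this, inner_zero_right, inner_zero_right]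
  have i2 : inner ℂ G F = inner ℂ F F := by
    rw [L2.inner_def, L2.inner_def]
    refine integral_congr_ae ?_
    filter_upwards [hgWL.coeFn_toLp, hfL.coeFn_toLp] with x h1 h2
    rw [h1, h2]
    by_cases hx : x ∈ Ioc (-(L / 2)) (L / 2)
    · rw [hgW, hf, indicator_of_mem hx, indicator_of_mem (hsub hx)]
    · rw [hf, indicator_of_notMem hx, inner_zero_right, inner_zero_right]
  have i3 : ‖F‖ ^ 2 ≤ ‖G‖ * ‖P - F‖ := by
    have h1 : (inner ℂ F F : ℂ) = - inner ℂ G (P - F) := by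
      rw [inner_sub_right, i1, ← i2]
      ring
    have h2 := norm_inner_le_norm (𝕜 := ℂ) G (P - F)
    rw [← norm_neg, ← h1, inner_self_eq_norm_sq_to_K] at h2
    simpa using h2
  have nF : ‖F‖ₑ = eLpNorm f 2 volume := by rw [Lp.enorm_def, eLpNorm_congr_ae hfL.coeFn_toLp]
  have nG : ‖G‖ₑ = eLpNorm gW 2 volume := by rw [Lp.enorm_def, eLpNorm_congr_ae hgWL.coeFn_toLp]
  have nP : ‖P - F‖ₑ = eLpNorm (resExpr k B' lam' p - f) 2 volume := by
    rw [Lp.enorm_def]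
    refine eLpNorm_congr_ae ((Lp.coeFn_sub _ _).trans ?_)
    exact hrL.coeFn_toLp.sub hfL.coeFn_toLp
  have i4 : ‖F‖ₑ ^ 2 ≤ ‖G‖ₑ * ‖P - F‖ₑ := by
    have := ENNReal.ofReal_le_ofReal i3
    rwa [ENNReal.ofReal_mul (norm_nonneg _), ENNReal.ofReal_pow (norm_nonneg _), ofReal_norm,
      ofReal_norm, ofReal_norm] at this
  rw [← nF, ← nP] at hpf
  have i5 : ‖F‖ₑ ^ 2 ≤ C * ENNReal.ofReal (δ ^ 2) * ‖G‖ₑ ^ 2 := by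
    -- The inequality `i4` is squared and one factor `‖F‖ₑ ^ 2` is cancelled, which needs it to be
    -- nonzero and finite.
    by_cases h0 : ‖F‖ₑ ^ 2 = 0
    · rw [h0]; exact zero_le
    have ht : ‖F‖ₑ ^ 2 ≠ ⊤ := ENNReal.pow_ne_top enorm_ne_top
    refine (ENNReal.mul_le_mul_iff_left h0 ht).1 ?_
    calc ‖F‖ₑ ^ 2 * ‖F‖ₑ ^ 2 ≤ (‖G‖ₑ * ‖P - F‖ₑ) * (‖G‖ₑ * ‖P - F‖ₑ) := mul_le_mul' i4 i4
      _ = ‖G‖ₑ ^ 2 * ‖P - F‖ₑ ^ 2 := by ring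
      _ ≤ ‖G‖ₑ ^ 2 * (C * ENNReal.ofReal (δ ^ 2) * ‖F‖ₑ ^ 2) := by gcongr
      _ = _ := by ring
  rw [nF, nG, eLpNorm_two_sq, eLpNorm_two_sq] at i5
  have hind : ∀ s : Set ℝ, MeasurableSet s → ∫⁻ x, ‖s.indicator g x‖ₑ ^ 2 =
      ∫⁻ x in s, ‖g x‖ₑ ^ 2 := by
    intro s hs
    rw [← lintegral_indicator hs]
    refine lintegral_congr fun x => ?_
    by_cases hx : x ∈ s <;> simp [hx]
  rw [hind _ measurableSet_Ioc, hind _ measurableSet_Ioc] at i5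
  rw [lintegral_const_mul' _ _ (by finiteness)]
  exact i5

end Local

/-! ### Summing local estimates over translates, and integrals of periodic functions. -/

section Tiling

variable {L : ℝ}

theorem setLIntegral_add_right (q : ℝ → ℝ≥0∞) (a b c : ℝ) :
    ∫⁻ x in Ioc a b, q (x + c) = ∫⁻ x in Ioc (a + c) (b + c), q x := by
  rw [← (measurePreserving_add_right volume c).setLIntegral_comp_preimage_emb
    (measurableEmbedding_addRight c) q]
  simp

theorem tsum_setLIntegral_add (hL : 0 < L) (q : ℝ → ℝ≥0∞) (a : ℝ) :
    ∑' j : ℤ, ∫⁻ x in Ioc a (a + L), q (x + j * L) = ∫⁻ x, q x := by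
  rw [← setLIntegral_univ q, ← iUnion_Ioc_add_zsmul hL a,
    lintegral_iUnion (fun _ => measurableSet_Ioc) (pairwise_disjoint_Ioc_add_zsmul a L)]
  refine tsum_congr fun j => ?_
  rw [setLIntegral_add_right]
  simp only [zsmul_eq_mul]
  push_cast
  congr 3
  ring

theorem setLIntegral_Ioc_add (q : ℝ → ℝ≥0∞) {a b c : ℝ} (hab : a ≤ b) (hbc : b ≤ c) :
    ∫⁻ x in Ioc a c, q x = (∫⁻ x in Ioc a b, q x) + ∫⁻ x in Ioc b c, q x := by
  rw [← lintegral_union measurableSet_Ioc (Ioc_disjoint_Ioc_of_le le_rfl),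
    Ioc_union_Ioc_eq_Ioc hab hbc]

/-- Local bounds of `q` on intervals of length `L` by `G` on the twice longer intervals add up. -/
theorem lintegral_le_two_mul (hL : 0 < L) {q G : ℝ → ℝ≥0∞}
    (h : ∀ j : ℤ, ∫⁻ x in Ioc (-(L / 2)) (L / 2), q (x + j * L) ≤
      ∫⁻ x in Ioc (-L) L, G (x + j * L)) :
    ∫⁻ x, q x ≤ 2 * ∫⁻ x, G x := by
  rw [← tsum_setLIntegral_add hL q (-(L / 2))]
  have e1 : -(L / 2) + L = L / 2 := by ring
  rw [e1]
  refine (ENNReal.tsum_le_tsum h).trans ?_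
  -- The doubled window splits into two intervals of length `L`, and the translates of each tile the
  -- line; this is the source of the factor `2`.
  have e2 : ∀ j : ℤ, ∫⁻ x in Ioc (-L) L, G (x + j * L) =
      (∫⁻ x in Ioc (-L) (-L + L), G (x + j * L)) + ∫⁻ x in Ioc 0 (0 + L), G (x + j * L) := by
    intro j
    rw [neg_add_cancel, zero_add]
    exact setLIntegral_Ioc_add (fun x => G (x + j * L)) (by linarith) hL.le
  simp only [e2]
  rw [ENNReal.tsum_add, tsum_setLIntegral_add hL, tsum_setLIntegral_add hL, two_mul]

/-- Weak derivatives of a periodic function are periodic only up to null sets; countably many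
translates of a null set are still null. -/
theorem ae_periodic_zsmul {β : Type*} {q : ℝ → β} (hq : ∀ᵐ x, q (x + L) = q x) :
    ∀ᵐ x, ∀ j : ℤ, q (x + j * L) = q x := by
  have hq' : ∀ᵐ x, ∀ i : ℤ, q (x + i * L + L) = q (x + i * L) := by
    rw [ae_all_iff]
    exact fun i => (measurePreserving_add_right volume (i * L)).quasiMeasurePreserving.ae hq
  filter_upwards [hq'] with x hx j
  have e : ∀ i : ℤ, q (x + ((i + 1 : ℤ) : ℝ) * L) = q (x + i * L) := fun i => by
    rw [← hx i]
    push_cast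
    ring_nf
  induction j using Int.induction_on with
  | zero => simp
  | succ i ih => rw [e, ih]
  | pred i ih =>
    rw [← ih, ← e]
    simp

theorem setLIntegral_of_ae_periodic (hL : 0 < L) {q : ℝ → ℝ≥0∞} (hq : ∀ᵐ x, q (x + L) = q x)
    (a : ℝ) : ∫⁻ x in Ioc a (a + L), q x = ∫⁻ x in Ico 0 L, q x := by
  set q' : ℝ → ℝ≥0∞ := fun x => q (L * Int.fract (x / L)) with hq'
  have h1 : q =ᵐ[volume] q' := by
    filter_upwards [ae_periodic_zsmul hq] with x hx
    rw [hq', ← hx (-⌊x / L⌋)]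
    congr 1
    unfold Int.fract
    push_cast
    field_simp
    ring
  have h2 : Function.Periodic q' L := fun x => by
    simp only [hq', add_div, div_self hL.ne', Int.fract_add_one]
  rw [lintegral_congr_ae (ae_restrict_of_ae h1), lintegral_congr_ae (ae_restrict_of_ae h1),
    Measure.restrict_congr_set Ico_ae_eq_Ioc]
  have h3 := (isAddFundamentalDomain_Ioc hL a).setLIntegral_eq (isAddFundamentalDomain_Ioc hL 0) q'
    (fun g x => by
      obtain ⟨n, hn⟩ := AddSubgroup.mem_zmultiples_iff.1 g.2
      have : g +ᵥ x = x + n • L := by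
        rw [hn, add_comm]
        rfl
      rw [this]
      exact h2.zsmul n x)
  simpa using h3

theorem setLIntegral_le_two_mul_of_ae_periodic (hL : 0 < L) {q G : ℝ → ℝ≥0∞}
    (hq : ∀ᵐ x, q (x + L) = q x) (hG : ∀ᵐ x, G (x + L) = G x)
    (h : ∫⁻ x in Ioc (-(L / 2)) (L / 2), q x ≤ ∫⁻ x in Ioc (-L) L, G x) :
    ∫⁻ x in Ico 0 L, q x ≤ 2 * ∫⁻ x in Ico 0 L, G x := by
  have e1 := setLIntegral_of_ae_periodic hL hq (-(L / 2))
  have e2 := setLIntegral_of_ae_periodic hL hG (-L)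
  have e3 := setLIntegral_of_ae_periodic hL hG 0
  rw [show -(L / 2) + L = L / 2 by ring] at e1
  rw [neg_add_cancel] at e2
  rw [zero_add] at e3
  rw [← e1, two_mul]
  nth_rw 1 [← e2]
  rw [← e3, ← setLIntegral_Ioc_add G (by linarith) hL.le]
  exact h

theorem exists_setLIntegral_le_of_ae_periodic (hL : 0 < L) (R : ℝ) :
    ∃ N : ℕ, ∀ q : ℝ → ℝ≥0∞, (∀ᵐ x, q (x + L) = q x) →
      ∫⁻ x in Icc (-R) R, q x ≤ N * ∫⁻ x in Ico 0 L, q x := by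
  obtain ⟨N, hN⟩ := exists_nat_gt ((2 * R + 1) / L)
  rw [div_lt_iff₀ hL] at hN
  refine ⟨N, fun q hq => ?_⟩
  -- Starting at `-R - 1`, strictly to the left of `-R`, allows half-open periods to cover the
  -- closed interval.
  have h1 : ∀ n : ℕ, ∫⁻ x in Ioc (-R - 1) (-R - 1 + n * L), q x = n * ∫⁻ x in Ico 0 L, q x := by
    intro n
    induction n with
    | zero => simp
    | succ n ih =>
      rw [setLIntegral_Ioc_add q (b := -R - 1 + n * L) (by simp; positivity)
        (by push_cast; nlinarith), ih, show -R - 1 + ((n + 1 : ℕ) : ℝ) * L = -R - 1 + n * L + L by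
          push_cast; ring, setLIntegral_of_ae_periodic hL hq]
      push_cast
      ring
  rw [← h1 N]
  exact lintegral_mono_set fun x hx => ⟨by linarith [hx.1], by linarith [hx.2]⟩

end Tiling

/-! ### Absorption of the remainder and the perturbation result on the line. -/

section Global

variable {m k : ℕ} {B B' : ℕ → ℝ → Matrix (Fin m) (Fin m) ℂ} {L : ℝ} {lam lam' : ℂ}

theorem periodic_int_mul {β : Type*} {f : ℝ → β} (hf : Function.Periodic f L) (j : ℤ) (x : ℝ) :
    f (x + j * L) = f x := by
  have := hf.zsmul j x
  rwa [zsmul_eq_mul] at this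

theorem resExpr_add_right {c : ℝ} (hB : ∀ j ≤ k, ∀ x, B j (x + c) = B j x)
    (g : ℕ → ℝ → EuclideanSpace ℂ (Fin m)) (x : ℝ) :
    resExpr k B lam g (x + c) = resExpr k B lam (fun j y => g j (y + c)) x := by
  simp only [resExpr]
  congr 1
  exact Finset.sum_congr rfl fun j hj => by rw [hB j (by have := Finset.mem_range.1 hj; omega)]

/-- Absorption of the energy into the left-hand side of an a priori estimate. -/
theorem eLpNorm_le_of_energy_le {μ : Measure ℝ} {C : ℝ≥0} {d : ℝ}
    (hd : 4 * (C : ℝ) * d ≤ 1)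
    {g : ℕ → ℝ → EuclideanSpace ℂ (Fin m)} {h : ℝ → EuclideanSpace ℂ (Fin m)}
    (hg : ∀ j ≤ k, MemLp (g j) 2 μ)
    (H : ∫⁻ x, energy k g x ∂μ ≤
      2 * ∫⁻ x, (C * ‖h x‖ₑ ^ 2 + C * ENNReal.ofReal d * energy k g x) ∂μ) :
    ∀ j ≤ k, eLpNorm (g j) 2 μ ≤ (2 * (C + 1) : ℝ≥0) * eLpNorm h 2 μ := by
  set I := ∫⁻ x, energy k g x ∂μ with hI
  have hgm : ∀ j ≤ k, AEStronglyMeasurable (g j) μ := fun j hj => (hg j hj).1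
  -- Finiteness of the energy is what permits cancelling `I / 2` from both sides below.
  have hIt : I ≠ ⊤ := by
    rw [hI, lintegral_energy hgm]
    exact (ENNReal.sum_lt_top.2 fun l hl => ENNReal.pow_lt_top
      (hg l (by have := Finset.mem_range.1 hl; omega)).2).ne
  rw [lintegral_add_right' _ ((aemeasurable_energy hgm).const_mul _),
    lintegral_const_mul' _ _ (by finiteness), lintegral_const_mul' _ _ (by finiteness),
    ← eLpNorm_two_sq, ← hI] at H
  have h1 : 2 * (C * ENNReal.ofReal d * I) ≤ I / 2 := by
    rw [ENNReal.le_div_iff_mul_le (by simp) (by simp)]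
    calc 2 * (C * ENNReal.ofReal d * I) * 2 = ENNReal.ofReal (4 * C * d) * I := by
          rw [ENNReal.ofReal_mul (by positivity), ENNReal.ofReal_mul (by norm_num)]
          simp
          ring
      _ ≤ 1 * I := by
          gcongr
          exact ENNReal.ofReal_le_one.2 hd
      _ = I := one_mul _
  have h2 : I ≤ 4 * C * eLpNorm h 2 μ ^ 2 := by
    rw [mul_add] at H
    have h3 : I ≤ 2 * (C * eLpNorm h 2 μ ^ 2) + I / 2 := H.trans (by gcongr)
    have h4 : I / 2 + I / 2 ≤ 2 * (C * eLpNorm h 2 μ ^ 2) + I / 2 := by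
      rwa [ENNReal.add_halves]
    have h5 : I / 2 ≤ 2 * (C * eLpNorm h 2 μ ^ 2) :=
      (ENNReal.add_le_add_iff_right (ENNReal.div_ne_top hIt (by simp))).1 h4
    calc I = I / 2 + I / 2 := (ENNReal.add_halves I).symm
      _ ≤ 2 * (C * eLpNorm h 2 μ ^ 2) + 2 * (C * eLpNorm h 2 μ ^ 2) := add_le_add h5 h5
      _ = _ := by ring
  intro j hj
  refine ennreal_le_of_sq_le_sq ?_
  calc eLpNorm (g j) 2 μ ^ 2 = ∫⁻ x, ‖g j x‖ₑ ^ 2 ∂μ := eLpNorm_two_sq _ _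
    _ ≤ I := lintegral_mono fun x => enorm_sq_le_energy g hj x
    _ ≤ 4 * C * eLpNorm h 2 μ ^ 2 := h2
    _ ≤ ((2 * (C + 1) : ℝ≥0) : ℝ≥0∞) ^ 2 * eLpNorm h 2 μ ^ 2 := by
        gcongr
        have : (4 * C : ℝ≥0) ≤ (2 * (C + 1)) ^ 2 := by
          rw [← NNReal.coe_le_coe]
          push_cast
          nlinarith [C.coe_nonneg]
        exact_mod_cast this
    _ = _ := (mul_pow _ _ _).symm

/-- The case `k = 0`, `h = 0` of the absorption argument; this is how a function orthogonal to the
range is forced to vanish. -/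
theorem ae_eq_zero_of_absorb {μ : Measure ℝ} {C : ℝ≥0} {d : ℝ} (hd : 4 * (C : ℝ) * d ≤ 1)
    {f : ℝ → EuclideanSpace ℂ (Fin m)} (hf : MemLp f 2 μ)
    (H : ∫⁻ x, ‖f x‖ₑ ^ 2 ∂μ ≤ 2 * ∫⁻ x, C * ENNReal.ofReal d * ‖f x‖ₑ ^ 2 ∂μ) :
    f =ᵐ[μ] 0 := by
  have h1 := eLpNorm_le_of_energy_le (k := 0) (h := (0 : ℝ → EuclideanSpace ℂ (Fin m)))
    (g := fun _ => f) hd (fun _ _ => hf) (by simpa [energy] using H) 0 le_rfl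
  rw [eLpNorm_zero, mul_zero] at h1
  exact (eLpNorm_eq_zero_iff hf.1 (by norm_num)).1 (le_antisymm h1 zero_le)

/-- The resolvent set of an operator on the line is stable under replacing its coefficients by
long-periodic approximations. -/
theorem mem_resolventSet_lineOp_of_approx {Q' δ : ℝ} {C₁ C₂ : ℝ≥0}
    (hL : 0 < L)
    (hBb : IsBoundedCoeff k B' Q') (hper : ∀ j ≤ k, Function.Periodic (B' j) L)
    (hC₁ : 4 * (C₁ : ℝ) * δ ^ 2 ≤ 1) (hC₂ : 4 * (C₂ : ℝ) * δ ^ 2 ≤ 1)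
    (hap : ∀ g : ℕ → ℝ → EuclideanSpace ℂ (Fin m), IsTower k g →
        (∀ j ≤ k, MemLp (g j) 2 (volume.restrict (Ioc (-L) L))) →
        ∫⁻ x in Ioc (-(L / 2)) (L / 2), energy k g x ≤
          ∫⁻ x in Ioc (-L) L, (C₁ * ‖resExpr k B' lam' g x‖ₑ ^ 2 +
            C₁ * ENNReal.ofReal (δ ^ 2) * energy k g x))
    (hor : ∀ g : ℝ → EuclideanSpace ℂ (Fin m), MemLp g 2 (volume.restrict (Ioc (-L) L)) →
        (∀ p, IsTower k p → (∀ j, ∀ x, x ∉ Ioc (-L) L → p j x = 0) →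
          (∀ j ≤ k, MemLp (p j) 2 volume) → ∫ x, inner ℂ (g x) (resExpr k B' lam' p x) = 0) →
        ∫⁻ x in Ioc (-(L / 2)) (L / 2), ‖g x‖ₑ ^ 2 ≤
          ∫⁻ x in Ioc (-L) L, C₂ * ENNReal.ofReal (δ ^ 2) * ‖g x‖ₑ ^ 2) :
    lam' ∈ resolventSet (lineOp k B') := by
  have hperj : ∀ i : ℤ, ∀ j ≤ k, ∀ x, B' j (x + i * L) = B' j x := fun i j hj x =>
    periodic_int_mul (hper j hj) i x
  refine mem_resolventSet_diffOp hBb (fun f => ae_eq_refl _) (2 * (C₁ + 1)) ?_ ?_ ?_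
  · intro g u hg _ hgL
    refine eLpNorm_le_of_energy_le hC₁ hgL (lintegral_le_two_mul hL fun j => ?_)
    -- Translation by `j * L` commutes with the expression because `B'` is `L`-periodic, so the
    -- estimate on the central window serves all windows.
    have h1 := hap (fun i x => g i (x + j * L)) (hg.comp_add_right _) fun i hi =>
      ((hgL i hi).comp_measurePreserving (measurePreserving_add_right volume (j * L))).restrict _
    simp only [← resExpr_add_right (hperj j)] at h1
    exact h1
  · intro g u h hg _ hh
    refine ⟨(Lp.memLp (h 0)).locallyIntegrable (by norm_num), fun j hj => ?_⟩
    exact isWeakDeriv_of_tendsto_Lp (fun n => (hg n).isWeakDeriv j hj) (hh j hj.le) (hh (j + 1) hj)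
  · intro f hf
    have h1 : ∫⁻ x, ‖f x‖ₑ ^ 2 ≤ 2 * ∫⁻ x, C₂ * ENNReal.ofReal (δ ^ 2) * ‖f x‖ₑ ^ 2 := by
      refine lintegral_le_two_mul hL fun j => ?_
      refine hor (fun x => f (x + j * L)) (((Lp.memLp f).comp_measurePreserving
        (measurePreserving_add_right volume (j * L))).restrict _) fun p hp _ hpL => ?_
      -- The test tower is translated back by `-j * L`, where the orthogonality of `f` itself can be
      -- used.
      have h2 := hf (fun i x => p i (x + ((-j : ℤ) : ℝ) * L))
        (MemLp.toLp _ ((hpL 0 (Nat.zero_le k)).comp_measurePreserving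
          (measurePreserving_add_right volume (((-j : ℤ) : ℝ) * L))))
        (hp.comp_add_right _) (MemLp.coeFn_toLp _).symm
        (fun i hi => (hpL i hi).comp_measurePreserving (measurePreserving_add_right volume _))
      rw [← integral_add_right_eq_self _ ((j : ℝ) * L)] at h2
      refine Eq.trans (integral_congr_ae (ae_of_all _ fun x => ?_)) h2
      simp only
      rw [resExpr_add_right (hperj j)]
      simp
    exact Lp.eq_zero_iff_ae_eq_zero.2 (ae_eq_zero_of_absorb hC₂ (Lp.memLp f) h1)

end Global

/-! ### Periodization of functions supported in `(-L, L]`. -/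

section Periodization

variable {E : Type*} [NormedAddCommGroup E] {L : ℝ}

/-- The periodization `∑_j h(x + j L)`. -/
noncomputable def periodize (L : ℝ) (h : ℝ → E) (x : ℝ) : E := ∑' j : ℤ, h (x + j * L)

theorem periodic_periodize (h : ℝ → E) : Function.Periodic (periodize L h) L := fun x => by
  simp only [periodize]
  rw [← (Equiv.addRight (1 : ℤ)).tsum_eq fun j : ℤ => h (x + j * L)]
  refine tsum_congr fun j => ?_
  simp only [Equiv.coe_addRight]
  push_cast
  congr 1
  ring

/-- The finite index set depends on the window only, not on `h`; the same finite sum therefore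
represents a function and its weak derivative there. -/
theorem exists_periodize_eq_sum (hL : 0 < L) (R : ℝ) : ∃ s : Finset ℤ, ∀ h : ℝ → E,
    (∀ x, x ∉ Ioc (-L) L → h x = 0) → ∀ x ∈ Icc (-R) R,
      periodize L h x = (∑ j ∈ s, fun y => h (y + j * L)) x := by
  obtain ⟨N, hN⟩ := exists_nat_gt (R / L)
  rw [div_lt_iff₀ hL] at hN
  refine ⟨Finset.Icc (-N) N, fun h hh x hx => ?_⟩
  rw [Finset.sum_apply]
  refine tsum_eq_sum fun j hj => hh _ fun hxj => hj ?_
  rw [Finset.mem_Icc]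
  have h1 : (j : ℝ) * L < (N + 1) * L := by linarith [hx.1, hxj.2]
  have h2 : (-(N + 1) : ℝ) * L < j * L := by linarith [hx.2, hxj.1]
  have h3 := lt_of_mul_lt_mul_right h1 hL.le
  have h4 := lt_of_mul_lt_mul_right h2 hL.le
  have h5 : j < (N : ℤ) + 1 := by exact_mod_cast h3
  have h6 : -((N : ℤ) + 1) < j := by exact_mod_cast h4
  constructor <;> omega

theorem periodize_eq_add (hL : 0 < L) {h : ℝ → E} (hh : ∀ x, x ∉ Ioc (-L) L → h x = 0)
    {x : ℝ} (hx : x ∈ Ioo 0 L) : periodize L h x = h x + h (x + -L) := by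
  have : periodize L h x = ∑ j ∈ ({0, -1} : Finset ℤ), h (x + j * L) := by
    refine tsum_eq_sum fun j hj => hh _ fun hxj => hj ?_
    have h1 : (j : ℝ) * L < 1 * L := by linarith [hx.1, hxj.2]
    have h2 : (-2 : ℝ) * L < j * L := by linarith [hx.2, hxj.1]
    have h3 : j < 1 := by exact_mod_cast lt_of_mul_lt_mul_right h1 hL.le
    have h4 : -2 < j := by exact_mod_cast lt_of_mul_lt_mul_right h2 hL.le
    simp only [Finset.mem_insert, Finset.mem_singleton]
    omega
  rw [this, Finset.sum_pair (by norm_num)]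
  simp

variable [NormedSpace ℝ E]

theorem IsWeakDeriv.periodize (hL : 0 < L) {h h' : ℝ → E} (H : IsWeakDeriv h h')
    (hh : ∀ x, x ∉ Ioc (-L) L → h x = 0) (hh' : ∀ x, x ∉ Ioc (-L) L → h' x = 0) :
    IsWeakDeriv (periodize L h) (periodize L h') := by
  refine isWeakDeriv_of_local fun R _ => ?_
  obtain ⟨s, hs⟩ := exists_periodize_eq_sum (E := E) hL R
  exact ⟨_, _, IsWeakDeriv.sum s fun j _ => H.comp_add_right (j * L),
    fun x hx => ⟨hs h hh x hx, hs h' hh' x hx⟩⟩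

omit [NormedSpace ℝ E] in
theorem locallyIntegrable_periodize (hL : 0 < L) {h : ℝ → E} (H : LocallyIntegrable h volume)
    (hh : ∀ x, x ∉ Ioc (-L) L → h x = 0) : LocallyIntegrable (periodize L h) volume := by
  refine locallyIntegrable_of_forall_Icc fun R _ => ?_
  obtain ⟨s, hs⟩ := exists_periodize_eq_sum (E := E) hL R
  have h1 : LocallyIntegrable (∑ j ∈ s, fun y => h (y + j * L)) volume :=
    locallyIntegrable_finsetSum' s fun j _ => locallyIntegrable_comp_add_right H (j * L)
  exact (h1.integrableOn_isCompact isCompact_Icc).congr_fun (fun x hx => (hs h hh x hx).symm)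
    measurableSet_Icc

theorem IsTower.periodize (hL : 0 < L) {k : ℕ} {p : ℕ → ℝ → E} (hp : IsTower k p)
    (hp0 : ∀ j, ∀ x, x ∉ Ioc (-L) L → p j x = 0) : IsTower k fun j => periodize L (p j) :=
  ⟨locallyIntegrable_periodize hL hp.locallyIntegrable (hp0 0),
    fun j hj => (hp.isWeakDeriv j hj).periodize hL (hp0 j) (hp0 (j + 1))⟩

omit [NormedSpace ℝ E] in
theorem periodize_ae_eq (hL : 0 < L) {h : ℝ → E} (hh : ∀ x, x ∉ Ioc (-L) L → h x = 0) :
    periodize L h =ᵐ[volume.restrict (Ico 0 L)] fun x => h x + h (x + -L) := by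
  rw [Measure.restrict_congr_set Ioo_ae_eq_Ico.symm]
  filter_upwards [ae_restrict_mem measurableSet_Ioo] with x hx
  exact periodize_eq_add hL hh hx

omit [NormedSpace ℝ E] in
theorem memLp_periodize (hL : 0 < L) {h : ℝ → E} (H : MemLp h 2 volume)
    (hh : ∀ x, x ∉ Ioc (-L) L → h x = 0) :
    MemLp (periodize L h) 2 (volume.restrict (Ico 0 L)) :=
  ((H.restrict _).add ((H.comp_measurePreserving
    (measurePreserving_add_right volume (-L))).restrict _)).ae_eq (periodize_ae_eq hL hh).symm

omit [NormedSpace ℝ E] in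
theorem memLp_Icc_of_ae_periodic (hL : 0 < L) {q : ℝ → E} (hq : AEStronglyMeasurable q volume)
    (hp : ∀ᵐ x, q (x + L) = q x) (hq2 : MemLp q 2 (volume.restrict (Ico 0 L))) (R : ℝ) :
    MemLp q 2 (volume.restrict (Icc (-R) R)) := by
  refine ⟨hq.restrict, ?_⟩
  obtain ⟨N, hN⟩ := exists_setLIntegral_le_of_ae_periodic hL R
  have h1 := hN (fun x => ‖q x‖ₑ ^ 2) (by filter_upwards [hp] with x hx; rw [hx])
  rw [← eLpNorm_two_sq, ← eLpNorm_two_sq] at h1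
  have h2 : eLpNorm q 2 (volume.restrict (Icc (-R) R)) ^ 2 < ⊤ :=
    h1.trans_lt (ENNReal.mul_lt_top (by simp) (ENNReal.pow_lt_top hq2.2))
  by_contra h3
  rw [not_lt, top_le_iff] at h3
  simp [h3] at h2

end Periodization

/-! ### Periodic extension of elements of `L²` of a period cell. -/

section PerExt

variable {m : ℕ} {L : ℝ}

theorem mul_fract_div (hL : 0 < L) (x : ℝ) : L * Int.fract (x / L) = x - ⌊x / L⌋ * L := by
  unfold Int.fract
  field_simp

theorem mul_fract_div_mem (hL : 0 < L) (x : ℝ) : L * Int.fract (x / L) ∈ Ico 0 L :=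
  ⟨mul_nonneg hL.le (Int.fract_nonneg _), by
    simpa using mul_lt_mul_of_pos_left (Int.fract_lt_one (x / L)) hL⟩

theorem periodic_perExt (hL : 0 < L) (f : ℝ → EuclideanSpace ℂ (Fin m)) :
    Function.Periodic (perExt L f) L := fun x => by
  simp only [perExt, add_div, div_self hL.ne', Int.fract_add_one]

theorem perExt_eq_of_mem (hL : 0 < L) (f : ℝ → EuclideanSpace ℂ (Fin m)) {x : ℝ}
    (hx : x ∈ Ico 0 L) : perExt L f x = f x := by
  have h1 : ⌊x / L⌋ = 0 := by
    rw [Int.floor_eq_zero_iff]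
    exact ⟨div_nonneg hx.1 hL.le, (div_lt_one hL).2 hx.2⟩
  rw [perExt, mul_fract_div hL, h1]
  simp [hx]

theorem perExt_ae_eq (hL : 0 < L) (f : ℝ → EuclideanSpace ℂ (Fin m)) :
    perExt L f =ᵐ[volume.restrict (Ico 0 L)] f := by
  filter_upwards [ae_restrict_mem measurableSet_Ico] with x hx
  exact perExt_eq_of_mem hL f hx

theorem perExt_of_periodic (hL : 0 < L) {f : ℝ → EuclideanSpace ℂ (Fin m)}
    (hf : Function.Periodic f L) : perExt L f = f := by
  funext x
  rw [perExt, indicator_of_mem (mul_fract_div_mem hL x), mul_fract_div hL]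
  have := periodic_int_mul hf (-⌊x / L⌋) x
  push_cast at this
  rw [← this]
  ring_nf

theorem aestronglyMeasurable_perExt
    (f : Lp (EuclideanSpace ℂ (Fin m)) 2 ((volume : Measure ℝ).restrict (Ico 0 L))) :
    AEStronglyMeasurable (perExt L f) volume := by
  have h1 : StronglyMeasurable ((Ico 0 L).indicator f) :=
    (Lp.stronglyMeasurable f).indicator measurableSet_Ico
  have h2 : Measurable fun x : ℝ => L * Int.fract (x / L) :=
    (measurable_fract.comp (measurable_id.div_const L)).const_mul L
  exact (h1.comp_measurable h2).aestronglyMeasurable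

theorem memLp_perExt (hL : 0 < L)
    (f : Lp (EuclideanSpace ℂ (Fin m)) 2 ((volume : Measure ℝ).restrict (Ico 0 L))) (R : ℝ) :
    MemLp (perExt L f) 2 (volume.restrict (Icc (-R) R)) :=
  memLp_Icc_of_ae_periodic hL (aestronglyMeasurable_perExt f)
    (ae_of_all _ (periodic_perExt hL f)) ((Lp.memLp f).ae_eq (perExt_ae_eq hL f).symm) R

theorem locallyIntegrable_perExt (hL : 0 < L)
    (f : Lp (EuclideanSpace ℂ (Fin m)) 2 ((volume : Measure ℝ).restrict (Ico 0 L))) :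
    LocallyIntegrable (perExt L f) volume :=
  locallyIntegrable_of_forall_Icc fun R _ => (memLp_perExt hL f R).integrable (by norm_num)

end PerExt

/-! ### The perturbation result on the period cell, and the common statement. -/

section PeriodicOperator

variable {m k : ℕ} {B' : ℕ → ℝ → Matrix (Fin m) (Fin m) ℂ} {L : ℝ} {lam' : ℂ}

theorem resExpr_periodize (hL : 0 < L) (hper : ∀ j ≤ k, Function.Periodic (B' j) L)
    {p : ℕ → ℝ → EuclideanSpace ℂ (Fin m)} (hp0 : ∀ j, ∀ x, x ∉ Ioc (-L) L → p j x = 0) {x : ℝ}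
    (hx : x ∈ Ioo 0 L) : resExpr k B' lam' (fun j => periodize L (p j)) x =
      resExpr k B' lam' p x + resExpr k B' lam' p (x + -L) := by
  have h1 : ∀ j ≤ k, ∀ x, B' j (x + -L) = B' j x := fun j hj x => by
    simpa using periodic_int_mul (hper j hj) (-1) x
  rw [resExpr_add_right h1]
  simp only [resExpr, periodize_eq_add hL (hp0 _) hx, map_add, Finset.sum_add_distrib, smul_add]
  abel

/-- Unfolding: over `(0, L)` the periodization has two terms, and periodicity of `g` and of the
coefficients reassembles them into an integral over `(-L, L]`. Orthogonality in `L²_per` thereby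
becomes orthogonality against compactly supported towers on the line. -/
theorem integral_inner_periodize (hL : 0 < L) (hper : ∀ j ≤ k, Function.Periodic (B' j) L)
    {p : ℕ → ℝ → EuclideanSpace ℂ (Fin m)} (hp0 : ∀ j, ∀ x, x ∉ Ioc (-L) L → p j x = 0)
    (hpL : MemLp (resExpr k B' lam' p) 2 volume) {g : ℝ → EuclideanSpace ℂ (Fin m)}
    (hg : Function.Periodic g L) (hgL : MemLp g 2 (volume.restrict (Icc (-L) L))) :
    ∫ x in Ico 0 L, inner ℂ (g x) (resExpr k B' lam' (fun j => periodize L (p j)) x) =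
      ∫ x, inner ℂ (g x) (resExpr k B' lam' p x) := by
  set F : ℝ → ℂ := fun x => inner ℂ (g x) (resExpr k B' lam' p x) with hF
  have hF0 : ∀ x, x ∉ Ioc (-L) L → F x = 0 := fun x hx => by
    simp [hF, resExpr, hp0 _ x hx]
  have hFi : IntegrableOn F (Icc (-L) L) := by
    have := MemLp.integrable_mul hgL.norm (hpL.restrict (Icc (-L) L)).norm
    refine this.mono (hgL.1.inner hpL.1.restrict) (ae_of_all _ fun x => ?_)
    refine (norm_inner_le_norm _ _).trans (le_of_eq ?_)
    simp
  have i1 : IntervalIntegrable F volume (-L) 0 :=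
    (hFi.mono_set (by rw [uIcc_of_le (by linarith)]; exact Icc_subset_Icc le_rfl hL.le)).intervalIntegrable
  have i2 : IntervalIntegrable F volume 0 L :=
    (hFi.mono_set (by rw [uIcc_of_le hL.le]; exact Icc_subset_Icc (by linarith) le_rfl)).intervalIntegrable
  have i3 : IntervalIntegrable (fun x => F (x + -L)) volume 0 L := by
    have := i1.comp_add_right (-L)
    simpa using this
  rw [← setIntegral_eq_integral_of_forall_compl_eq_zero hF0,
    ← intervalIntegral.integral_of_le (by linarith),
    ← intervalIntegral.integral_add_adjacent_intervals i1 i2, integral_Ico_eq_integral_Ioo]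
  calc _ = ∫ x in Ioo 0 L, (F x + F (x + -L)) := by
        refine setIntegral_congr_fun measurableSet_Ioo fun x hx => ?_
        have h1 : g (x + -L) = g x := by simpa using periodic_int_mul hg (-1) x
        simp only [hF]
        rw [resExpr_periodize hL hper hp0 hx, inner_add_right, h1]
    _ = ∫ x in (0 : ℝ)..L, (F x + F (x + -L)) := by
        rw [intervalIntegral.integral_of_le hL.le, integral_Ioc_eq_integral_Ioo]
    _ = _ := by
        rw [intervalIntegral.integral_add i2 i3, intervalIntegral.integral_comp_add_right]
        simp [add_comm]

/-- The resolvent set of a periodic operator contains the points of the resolvent set of an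
operator on the line with approximately the same coefficients. -/
theorem mem_resolventSet_perOp_of_approx {Q' δ : ℝ} {C₁ C₂ : ℝ≥0}
    (hL : 0 < L)
    (hBb : IsBoundedCoeff k B' Q') (hper : ∀ j ≤ k, Function.Periodic (B' j) L)
    (hC₁ : 4 * (C₁ : ℝ) * δ ^ 2 ≤ 1) (hC₂ : 4 * (C₂ : ℝ) * δ ^ 2 ≤ 1)
    (hap : ∀ g : ℕ → ℝ → EuclideanSpace ℂ (Fin m), IsTower k g →
        (∀ j ≤ k, MemLp (g j) 2 (volume.restrict (Ioc (-L) L))) →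
        ∫⁻ x in Ioc (-(L / 2)) (L / 2), energy k g x ≤
          ∫⁻ x in Ioc (-L) L, (C₁ * ‖resExpr k B' lam' g x‖ₑ ^ 2 +
            C₁ * ENNReal.ofReal (δ ^ 2) * energy k g x))
    (hor : ∀ g : ℝ → EuclideanSpace ℂ (Fin m), MemLp g 2 (volume.restrict (Ioc (-L) L)) →
        (∀ p, IsTower k p → (∀ j, ∀ x, x ∉ Ioc (-L) L → p j x = 0) →
          (∀ j ≤ k, MemLp (p j) 2 volume) → ∫ x, inner ℂ (g x) (resExpr k B' lam' p x) = 0) →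
        ∫⁻ x in Ioc (-(L / 2)) (L / 2), ‖g x‖ₑ ^ 2 ≤
          ∫⁻ x in Ioc (-L) L, C₂ * ENNReal.ofReal (δ ^ 2) * ‖g x‖ₑ ^ 2) :
    lam' ∈ resolventSet (perOp L k B') := by
  have hae : ∀ (g : ℕ → ℝ → EuclideanSpace ℂ (Fin m))
      (u : Lp (EuclideanSpace ℂ (Fin m)) 2 ((volume : Measure ℝ).restrict (Ico 0 L))),
      IsTower k g → g 0 = perExt L u → ∀ j ≤ k, ∀ᵐ x, g j (x + L) = g j x := by
    intro g u hg h0 j hj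
    -- The translate by `L` is another tower over the same periodic function, so uniqueness of weak
    -- derivatives yields periodicity at every level.
    refine (hg.comp_add_right L).ae_eq hg (ae_of_all _ fun x => ?_) hj
    simp only [h0]
    exact periodic_perExt hL u x
  have hsub : Ioc (-L) L ⊆ Icc (-L) L := Ioc_subset_Icc_self
  refine mem_resolventSet_diffOp hBb (fun f => perExt_ae_eq hL f) (2 * (C₁ + 1)) ?_ ?_ ?_
  · intro g u hg h0 hgL
    have hp := hae g u hg h0
    have hp' : ∀ᵐ x, ∀ j ∈ Finset.range (k + 1), g j (x + L) = g j x := by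
      rw [Finset.eventually_all]
      exact fun j hj => hp j (by have := Finset.mem_range.1 hj; omega)
    have hpe : ∀ᵐ x, energy k g (x + L) = energy k g x := by
      filter_upwards [hp'] with x hx
      exact Finset.sum_congr rfl fun j hj => by rw [hx j hj]
    have hpr : ∀ᵐ x, resExpr k B' lam' g (x + L) = resExpr k B' lam' g x := by
      filter_upwards [hp'] with x hx
      rw [resExpr_add_right (fun j hj => hper j hj)]
      simp only [resExpr, hx 0 (by simp)]
      congr 1
      exact Finset.sum_congr rfl fun j hj => by rw [hx j hj]
    refine eLpNorm_le_of_energy_le hC₁ hgL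
      (setLIntegral_le_two_mul_of_ae_periodic hL hpe ?_ (hap g hg fun j hj => ?_))
    · filter_upwards [hpe, hpr] with x h1 h2
      rw [h1, h2]
    · exact (memLp_Icc_of_ae_periodic hL (hg.aestronglyMeasurable hj) (hp j hj)
        (hgL j hj) L).mono_measure (Measure.restrict_mono hsub le_rfl)
  · intro g u h hg h0 hh
    have hloc : ∀ j ≤ k, ∀ R > 0, Tendsto (fun n => eLpNorm (g n j - perExt L (h j)) 2
        (volume.restrict (Icc (-R) R))) atTop (𝓝 0) := by
      intro j hj R _
      obtain ⟨N, hN⟩ := exists_setLIntegral_le_of_ae_periodic hL R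
      -- The comparison of squares costs a factor `N`; the bound `N ≤ (N + 1)²` avoids a square
      -- root.
      have hb : ∀ n, eLpNorm (g n j - perExt L (h j)) 2 (volume.restrict (Icc (-R) R)) ≤
          (N + 1) * eLpNorm (g n j - ⇑(h j)) 2 (volume.restrict (Ico 0 L)) := by
        intro n
        refine ennreal_le_of_sq_le_sq ?_
        have h1 := hN (fun x => ‖(g n j - perExt L (h j)) x‖ₑ ^ 2) (by
          filter_upwards [hae (g n) (u n) (hg n) (h0 n) j hj] with x hx
          simp only [Pi.sub_apply]
          rw [hx, periodic_perExt hL (h j) x])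
        rw [← eLpNorm_two_sq, ← eLpNorm_two_sq, eLpNorm_congr_ae
          (EventuallyEq.sub (ae_eq_refl (g n j)) (perExt_ae_eq hL (h j)))] at h1
        refine h1.trans ?_
        rw [mul_pow]
        gcongr
        calc (N : ℝ≥0∞) ≤ N + 1 := le_self_add
          _ ≤ (N + 1) ^ 2 := le_self_pow (by simp) two_ne_zero
      refine tendsto_of_tendsto_of_tendsto_of_le_of_le tendsto_const_nhds ?_
        (fun _ => zero_le) hb
      simpa using ENNReal.Tendsto.const_mul (hh j hj) (Or.inr (by finiteness))
    exact ⟨locallyIntegrable_perExt hL (h 0), fun j hj =>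
      isWeakDeriv_of_tendsto_two (fun n => (hg n).isWeakDeriv j hj)
        (locallyIntegrable_perExt hL _) (locallyIntegrable_perExt hL _) (hloc j hj.le)
        (hloc (j + 1) hj)⟩
  · intro f hf
    have hgL := memLp_perExt hL f L
    have h1 := hor (perExt L f) (hgL.mono_measure (Measure.restrict_mono hsub le_rfl))
      fun p hp hp0 hpL => by
        rw [← integral_inner_periodize hL hper hp0
          (hBb.memLp_resExpr Measure.AbsolutelyContinuous.rfl hpL) (periodic_perExt hL f) hgL]
        have hpm : ∀ j ≤ k, MemLp (periodize L (p j)) 2 (volume.restrict (Ico 0 L)) :=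
          fun j hj => memLp_periodize hL (hpL j hj) (hp0 j)
        rw [← hf _ ((hpm 0 (Nat.zero_le k)).toLp _) (hp.periodize hL hp0) ?_ hpm]
        · refine integral_congr_ae ?_
          filter_upwards [perExt_ae_eq hL f] with x hx
          rw [hx]
        · have := perExt_congr (hpm 0 (Nat.zero_le k)).coeFn_toLp
          rw [perExt_of_periodic hL (periodic_periodize (p 0))] at this
          exact this.symm
    have h2 := setLIntegral_le_two_mul_of_ae_periodic hL
      (ae_of_all _ fun x => by rw [periodic_perExt hL f x])
      (ae_of_all _ fun x => by rw [periodic_perExt hL f x]) h1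
    have h3 := ae_eq_zero_of_absorb hC₂ ((Lp.memLp f).ae_eq (perExt_ae_eq hL f).symm) h2
    exact Lp.eq_zero_iff_ae_eq_zero.2 ((perExt_ae_eq hL f).symm.trans h3)

/-- Perturbation theorem: points near a resolvent point `lam` of an operator on the line belong to
the resolvent sets of the operators with long-periodic approximations of its coefficients. -/
theorem exists_forall_mem_resolventSet_of_approx {B : ℕ → ℝ → Matrix (Fin m) (Fin m) ℂ} {Q : ℝ}
    {lam : ℂ} (hB : IsBoundedCoeff k B Q) (h : lam ∈ resolventSet (lineOp k B)) :
    ∃ δ > 0, ∃ Λ : ℝ, ∀ (L Q' : ℝ) (B' : ℕ → ℝ → Matrix (Fin m) (Fin m) ℂ) (lam' : ℂ), Λ ≤ L →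
      IsBoundedCoeff k B' Q' → IsPeriodicApprox k B B' L δ → ‖lam - lam'‖ ≤ δ →
      lam' ∈ resolventSet (lineOp k B') ∧ lam' ∈ resolventSet (perOp L k B') := by
  obtain ⟨M, hM₁, hM₂⟩ := exists_bound_of_mem_resolventSet_lineOp hB h
  obtain ⟨C₁, hC₁⟩ := exists_local_apriori hB M hM₂
  obtain ⟨C₂, hC₂⟩ := exists_local_orthogonal hB M hM₁
  -- The constants `C₁` and `C₂` depend only on the reference problem, so `δ` may be chosen after
  -- them. Since `δ ≤ 1`, the absorption conditions follow from `4 C δ² ≤ 4 C δ ≤ 1`, and the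
  -- threshold `Λ` comes from the cut-off for this `δ`.
  set δ : ℝ := 1 / (4 * (C₁ + C₂ + 1)) with hδ
  have hpos : (0 : ℝ) < 4 * (C₁ + C₂ + 1) := by positivity
  have hδ0 : 0 < δ := by positivity
  have hδ1 : δ ≤ 1 := by
    rw [hδ, div_le_one hpos]
    linarith [C₁.coe_nonneg, C₂.coe_nonneg]
  have hδ2 : 4 * (C₁ + C₂ + 1) * δ ≤ 1 := by
    rw [hδ, mul_one_div_cancel hpos.ne']
  have hδ3 : δ ^ 2 ≤ δ := by nlinarith
  have b1 : 4 * (C₁ : ℝ) * δ ^ 2 ≤ 1 := by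
    nlinarith [C₁.coe_nonneg, C₂.coe_nonneg, mul_nonneg C₁.coe_nonneg hδ0.le,
      mul_nonneg C₂.coe_nonneg hδ0.le, mul_le_mul_of_nonneg_left hδ3 C₁.coe_nonneg]
  have b2 : 4 * (C₂ : ℝ) * δ ^ 2 ≤ 1 := by
    nlinarith [C₁.coe_nonneg, C₂.coe_nonneg, mul_nonneg C₁.coe_nonneg hδ0.le,
      mul_nonneg C₂.coe_nonneg hδ0.le, mul_le_mul_of_nonneg_left hδ3 C₂.coe_nonneg]
  obtain ⟨Λ, _, hΛ⟩ := exists_cutoff k hδ0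
  refine ⟨δ, hδ0, Λ, fun L Q' B' lam' hL hBb hB' hlam => ?_⟩
  obtain ⟨η, e1, e2, e3, e4, e5⟩ := hΛ L hL
  have hη : IsSlowCutoff k L δ η := ⟨e1, e2, e3, e4, e5⟩
  have hap := hC₁ L δ B' lam' η hδ0.le hδ1 hB' hη hlam
  have hor := hC₂ L δ Q' B' lam' η hδ0.le hδ1 hBb hB' hη hlam
  exact ⟨mem_resolventSet_lineOp_of_approx hB'.pos hBb hB'.periodic b1 b2 hap hor,
    mem_resolventSet_perOp_of_approx hB'.pos hBb hB'.periodic b1 b2 hap hor⟩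

end PeriodicOperator

/-! ### Tails of Sobolev norms and supremum bounds. -/

section SupBounds

variable {E : Type*} [NormedAddCommGroup E] [NormedSpace ℝ E] {k : ℕ}

theorem eLpNorm_le_hkNorm {S : Set ℝ} (f : ℝ → E) {j : ℕ} (hj : j ≤ k) :
    eLpNorm (weakDeriv^[j] f) 2 (volume.restrict S) ≤ hkNorm k S f := by
  refine ennreal_le_of_sq_le_sq ?_
  rw [hkNorm, ← ENNReal.rpow_natCast (_ ^ _), ← ENNReal.rpow_mul]
  norm_num
  exact Finset.single_le_sum
    (f := fun j => eLpNorm (weakDeriv^[j] f) 2 (volume.restrict S) ^ 2)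
    (fun _ _ => zero_le) (Finset.mem_range.2 (by omega))

theorem hkNorm_ne_top {S : Set ℝ} {f : ℝ → E}
    (hf : ∀ j ≤ k, MemLp (weakDeriv^[j] f) 2 (volume.restrict S)) : hkNorm k S f ≠ ⊤ :=
  ENNReal.rpow_ne_top_of_nonneg (by norm_num) (ENNReal.sum_lt_top.2 fun j hj =>
    ENNReal.pow_lt_top (hf j (by have := Finset.mem_range.1 hj; omega)).2).ne

/-- The `H^k` norm of the tails tends to zero. -/
theorem tendsto_hkNorm_compl {f : ℝ → E} (hf : MemHk k volume f) {r : ℕ → ℝ}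
    (hr : Tendsto r atTop atTop) :
    Tendsto (fun n => hkNorm k (Ioo (-(r n)) (r n))ᶜ f) atTop (𝓝 0) := by
  have h1 : ∀ j ≤ k, Tendsto (fun n =>
      eLpNorm (weakDeriv^[j] f) 2 (volume.restrict (Ioo (-(r n)) (r n))ᶜ) ^ 2) atTop (𝓝 0) := by
    intro j hj
    have hm := hf.2 j hj
    have e : ∀ n, eLpNorm (weakDeriv^[j] f) 2 (volume.restrict (Ioo (-(r n)) (r n))ᶜ) ^ 2 =
        ∫⁻ x, (Ioo (-(r n)) (r n))ᶜ.indicator (fun x => ‖weakDeriv^[j] f x‖ₑ ^ 2) x := fun n => by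
      rw [eLpNorm_two_sq, lintegral_indicator measurableSet_Ioo.compl]
    simp only [e]
    have h2 := tendsto_lintegral_of_dominated_convergence' (μ := volume)
      (F := fun n => (Ioo (-(r n)) (r n))ᶜ.indicator (fun x => ‖weakDeriv^[j] f x‖ₑ ^ 2))
      (f := fun _ => 0) (fun x => ‖weakDeriv^[j] f x‖ₑ ^ 2)
      (fun n => (hm.1.enorm.pow_const 2).indicator measurableSet_Ioo.compl)
      (fun n => ae_of_all _ fun x => indicator_le_self _ _ _)
      (by rw [← eLpNorm_two_sq]; exact (ENNReal.pow_lt_top hm.2).ne)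
      (ae_of_all _ fun x => tendsto_nhds_of_eventually_eq
        ((hr.eventually_gt_atTop |x|).mono fun n hn =>
          indicator_of_notMem (notMem_compl_iff.2 (mem_Ioo.2 (abs_lt.1 hn))) _))
    simpa using h2
  have h3 : Tendsto (fun n => ∑ j ∈ Finset.range (k + 1),
      eLpNorm (weakDeriv^[j] f) 2 (volume.restrict (Ioo (-(r n)) (r n))ᶜ) ^ 2) atTop (𝓝 0) := by
    simpa using tendsto_finsetSum (Finset.range (k + 1)) fun j hj =>
      h1 j (by have := Finset.mem_range.1 hj; omega)
  have h4 := (ENNReal.continuous_rpow_const (y := (1 / 2 : ℝ))).continuousAt.tendsto.comp h3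
  simpa [hkNorm, Function.comp_def] using h4

/-- A Sobolev inequality on all intervals of a partition of the line. -/
theorem exists_enorm_le_partition (E : Type*) [NormedAddCommGroup E] [NormedSpace ℝ E]
    [CompleteSpace E] {T : ℝ} (hT : 0 < T) : ∃ C : ℝ≥0, ∀ f : ℝ → E, ∀ k, 1 ≤ k →
      HasWeakDerivs k f → ∀ᵐ x, ∃ a, x ∈ Ioc a (a + T) ∧
        ‖f x‖ₑ ≤ C * (eLpNorm f 2 (volume.restrict (Ioc a (a + T))) +
          eLpNorm (weakDeriv f) 2 (volume.restrict (Ioc a (a + T)))) := by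
  obtain ⟨C, hC⟩ := exists_enorm_le_of_isWeakDeriv E hT
  refine ⟨C, fun f k hk hf => ?_⟩
  -- A countable grid of intervals keeps the union of the exceptional sets null.
  have h1 : ∀ᵐ x, ∀ q : ℤ, x ∈ Ioc (q * T) (q * T + T) →
      ‖f x‖ₑ ≤ C * (eLpNorm f 2 (volume.restrict (Ioc (q * T) (q * T + T))) +
          eLpNorm (weakDeriv f) 2 (volume.restrict (Ioc (q * T) (q * T + T)))) := by
    rw [ae_all_iff]
    exact fun q => hC f _ (hf.isWeakDeriv (j := 0) hk) _
  filter_upwards [h1] with x hx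
  have h2 : x ∈ ⋃ n : ℤ, Ioc (n • T) ((n + 1) • T) := by
    rw [iUnion_Ioc_zsmul hT]
    trivial
  obtain ⟨q, hq⟩ := mem_iUnion.1 h2
  simp only [zsmul_eq_mul, Int.cast_add, Int.cast_one, add_mul, one_mul] at hq
  exact ⟨_, hq, hx q hq⟩

/-- An interval of length `T` through a point with `|x| ≥ r` cannot enter `(-(r - T), r - T)`; this
is why the radius drops by `T`. -/
theorem exists_enorm_le_hkNorm_compl (E : Type*) [NormedAddCommGroup E] [NormedSpace ℝ E]
    [CompleteSpace E] {T : ℝ} (hT : 0 < T) : ∃ C : ℝ≥0, ∀ f : ℝ → E, ∀ k, 1 ≤ k →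
      HasWeakDerivs k f → ∀ r, ∀ᵐ x, r ≤ |x| →
        ‖f x‖ₑ ≤ C * hkNorm k (Ioo (-(r - T)) (r - T))ᶜ f := by
  obtain ⟨C, hC⟩ := exists_enorm_le_partition E hT
  refine ⟨C * 2, fun f k hk hf r => ?_⟩
  filter_upwards [hC f k hk hf] with x hx hr
  obtain ⟨a, hxa, hb⟩ := hx
  have hsub : Ioc a (a + T) ⊆ (Ioo (-(r - T)) (r - T))ᶜ := by
    intro y hy hy'
    rcases le_abs.1 hr with h | h
    · linarith [hxa.1, hxa.2, hy.1, hy.2, hy'.1, hy'.2]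
    · linarith [hxa.1, hxa.2, hy.1, hy.2, hy'.1, hy'.2]
  have hm : ∀ g : ℝ → E, eLpNorm g 2 (volume.restrict (Ioc a (a + T))) ≤
      eLpNorm g 2 (volume.restrict (Ioo (-(r - T)) (r - T))ᶜ) := fun g =>
    eLpNorm_mono_measure _ (Measure.restrict_mono hsub le_rfl)
  refine hb.trans ?_
  push_cast
  rw [mul_assoc, two_mul]
  gcongr
  · exact (hm f).trans (eLpNorm_le_hkNorm (k := k) f (j := 0) (by omega))
  · exact (hm _).trans (eLpNorm_le_hkNorm (k := k) f (j := 1) (by omega))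

/-- As `T ≤ L`, an interval of length `T` fits into one period. The constant is thus independent of
`L`, which is essential because `L = nT` grows. -/
theorem exists_enorm_le_hkNorm_per (E : Type*) [NormedAddCommGroup E] [NormedSpace ℝ E]
    [CompleteSpace E] {T : ℝ} (hT : 0 < T) : ∃ C : ℝ≥0, ∀ f : ℝ → E, ∀ k, 1 ≤ k →
      ∀ L, T ≤ L → MemHkPer k L f → ∀ᵐ x, ‖f x‖ₑ ≤ C * hkNorm k (Ico 0 L) f := by
  obtain ⟨C, hC⟩ := exists_enorm_le_partition E hT
  refine ⟨C * 2, fun f k hk L hL hf => ?_⟩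
  have hL0 : 0 < L := hT.trans_le hL
  filter_upwards [hC f k hk hf.2.1] with x hx
  obtain ⟨a, _, hb⟩ := hx
  have hp : ∀ j ≤ k, ∀ᵐ x, weakDeriv^[j] f (x + L) = weakDeriv^[j] f x := fun j hj =>
    (hf.2.1.isTower.comp_add_right L).ae_eq hf.2.1.isTower (ae_of_all _ fun x => hf.1 x) hj
  have hm : ∀ j ≤ k, eLpNorm (weakDeriv^[j] f) 2 (volume.restrict (Ioc a (a + T))) ≤
      hkNorm k (Ico 0 L) f := by
    intro j hj
    refine le_trans (ennreal_le_of_sq_le_sq ?_) (eLpNorm_le_hkNorm f hj)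
    rw [eLpNorm_two_sq, eLpNorm_two_sq, ← setLIntegral_of_ae_periodic hL0 (by
      filter_upwards [hp j hj] with y hy
      rw [hy]) a]
    exact lintegral_mono_set (Ioc_subset_Ioc le_rfl (by linarith))
  refine hb.trans ?_
  push_cast
  rw [mul_assoc, two_mul]
  gcongr
  · exact hm 0 (by omega)
  · exact hm 1 hk

end SupBounds

/-! ### Bounds and continuity of the linearized coefficients. -/

section Coefficients

theorem norm_toEuclideanLin_le {m : ℕ} {M : Matrix (Fin m) (Fin m) ℂ} {c : ℝ} (hc : 0 ≤ c)
    (hM : ∀ i j, ‖M i j‖ ≤ c) (w : EuclideanSpace ℂ (Fin m)) :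
    ‖Matrix.toEuclideanLin M w‖ ≤ m * m * c * ‖w‖ := by
  rcases Nat.eq_zero_or_pos m with rfl | hm
  · have : Matrix.toEuclideanLin M w = 0 := by ext i; exact i.elim0
    simp [this]
  have h1 : ∀ i, ‖Matrix.toEuclideanLin M w i‖ ≤ m * c * ‖w‖ := by
    intro i
    have e : Matrix.toEuclideanLin M w i = ∑ j, M i j * w j := by
      simp [Matrix.toEuclideanLin, Matrix.toLpLin_apply, Matrix.mulVec, dotProduct]
    rw [e]
    calc ‖∑ j, M i j * w j‖ ≤ ∑ _j : Fin m, c * ‖w‖ := by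
          refine norm_sum_le_of_le _ fun j _ => ?_
          rw [norm_mul]
          exact mul_le_mul (hM i j) (PiLp.norm_apply_le w j) (norm_nonneg _) hc
      _ = m * c * ‖w‖ := by simp; ring
  have hm1 : (1 : ℝ) ≤ m := by exact_mod_cast hm
  refine (pow_le_pow_iff_left₀ (norm_nonneg _) (by positivity) two_ne_zero).1 ?_
  rw [EuclideanSpace.norm_sq_eq]
  calc ∑ i, ‖Matrix.toEuclideanLin M w i‖ ^ 2 ≤ ∑ _i : Fin m, (m * c * ‖w‖) ^ 2 :=
        Finset.sum_le_sum fun i _ => by gcongr; exact h1 i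
    _ = m * (m * c * ‖w‖) ^ 2 := by simp
    _ ≤ (m * m) * (m * c * ‖w‖) ^ 2 := by gcongr; nlinarith
    _ = _ := by ring

/-- The factor `2` comes from treating real and imaginary parts separately; it is not sharp, but
only some fixed constant is needed. -/
theorem norm_rclike_map_le {𝔽 : Type*} [RCLike 𝔽] (a : 𝔽) : ‖RCLike.map 𝔽 ℂ a‖ ≤ 2 * ‖a‖ := by
  rw [RCLike.map_apply]
  refine (norm_add_le _ _).trans ?_
  have h1 := RCLike.norm_re_le_norm a
  have h2 := RCLike.norm_im_le_norm a
  simp only [Real.norm_eq_abs] at h1 h2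
  simp
  linarith

namespace PeriodicSystem

variable {𝔽 : Type*} [RCLike 𝔽] {k m : ℕ} {T : ℝ} (S : PeriodicSystem 𝔽 k m T)

theorem continuous_jacobian :
    Continuous fun p : EuclideanSpace 𝔽 (Fin m) × ℝ => S.jacobian p.1 p.2 := by
  refine continuous_matrix fun i j => ?_
  have h1 : Continuous fun p : EuclideanSpace 𝔽 (Fin m) × ℝ =>
      fderiv 𝔽 (fun w => S.nonlin w p.2) p.1 (EuclideanSpace.single j (1 : 𝔽)) :=
    S.nonlin_fderiv_continuous.clm_apply continuous_const
  exact (EuclideanSpace.proj (𝕜 := 𝔽) i).continuous.comp h1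

theorem periodic_jacobian : Function.Periodic (fun x w => S.jacobian w x) T := by
  intro x
  funext w
  have : (fun y => S.nonlin y (x + T)) = fun y => S.nonlin y x := by
    funext y
    exact S.nonlin_periodic y x
  simp only [jacobian, this]

/-- By periodicity in `x` only the compact set given by a ball times `[0, T]` matters. The same
compact set gives uniform continuity in `exists_near_jacobian`. -/
theorem exists_bound_jacobian (hT : 0 < T) (Q : ℝ) :
    ∃ c : ℝ, 0 ≤ c ∧ ∀ w x, ‖w‖ ≤ Q → ∀ i j, ‖S.jacobian w x i j‖ ≤ c := by
  have : ProperSpace (EuclideanSpace 𝔽 (Fin m)) := FiniteDimensional.proper_rclike 𝔽 _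
  have hc := (isCompact_closedBall (0 : EuclideanSpace 𝔽 (Fin m)) Q).prod
    (isCompact_Icc (a := (0 : ℝ)) (b := T))
  have h1 : ∀ i j, ∃ c : ℝ, ∀ p ∈ Metric.closedBall (0 : EuclideanSpace 𝔽 (Fin m)) Q ×ˢ Icc 0 T,
      ‖S.jacobian p.1 p.2 i j‖ ≤ c := fun i j =>
    hc.exists_bound_of_continuousOn (S.continuous_jacobian.matrix_elem i j).continuousOn
  choose c hc using h1
  refine ⟨∑ i, ∑ j, |c i j|, by positivity, fun w x hw i j => ?_⟩
  obtain ⟨y, hy, hxy⟩ := S.periodic_jacobian.exists_mem_Ico₀ hT x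
  have e : S.jacobian w x = S.jacobian w y := congrFun hxy w
  rw [e]
  refine (hc i j (w, y) ⟨mem_closedBall_zero_iff.2 hw, hy.1, hy.2.le⟩).trans ((le_abs_self _).trans ?_)
  refine le_trans ?_ (Finset.single_le_sum (f := fun i => ∑ j, |c i j|)
    (fun _ _ => by positivity) (Finset.mem_univ i))
  exact Finset.single_le_sum (f := fun j => |c i j|) (fun _ _ => by positivity) (Finset.mem_univ j)

theorem exists_near_jacobian (hT : 0 < T) (Q : ℝ) {ε : ℝ} (hε : 0 < ε) :
    ∃ δ > 0, ∀ w w' x, ‖w‖ ≤ Q → ‖w'‖ ≤ Q → ‖w - w'‖ ≤ δ →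
      ∀ i j, ‖S.jacobian w x i j - S.jacobian w' x i j‖ ≤ ε := by
  have : ProperSpace (EuclideanSpace 𝔽 (Fin m)) := FiniteDimensional.proper_rclike 𝔽 _
  have hc := (isCompact_closedBall (0 : EuclideanSpace 𝔽 (Fin m)) Q).prod
    (isCompact_Icc (a := (0 : ℝ)) (b := T))
  have h1 : ∀ i j, ∃ δ > 0, ∀ w w' x, ‖w‖ ≤ Q → ‖w'‖ ≤ Q → ‖w - w'‖ ≤ δ →
      ‖S.jacobian w x i j - S.jacobian w' x i j‖ ≤ ε := by
    intro i j
    have hu := hc.uniformContinuousOn_of_continuous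
      (S.continuous_jacobian.matrix_elem i j).continuousOn
    obtain ⟨δ, hδ, H⟩ := Metric.uniformContinuousOn_iff.1 hu ε hε
    refine ⟨δ / 2, by positivity, fun w w' x hw hw' hww => ?_⟩
    obtain ⟨y, hy, hxy⟩ := S.periodic_jacobian.exists_mem_Ico₀ hT x
    have e : ∀ w, S.jacobian w x = S.jacobian w y := congrFun hxy
    rw [e, e, ← dist_eq_norm]
    refine (H (w, y) ⟨mem_closedBall_zero_iff.2 hw, hy.1, hy.2.le⟩ (w', y)
      ⟨mem_closedBall_zero_iff.2 hw', hy.1, hy.2.le⟩ ?_).le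
    rw [Prod.dist_eq, dist_self, dist_eq_norm, max_eq_left (norm_nonneg _)]
    linarith
  choose δ hδ H using h1
  rcases isEmpty_or_nonempty (Fin m) with hm | hm
  · exact ⟨1, one_pos, fun _ _ _ _ _ _ i => isEmptyElim i⟩
  · refine ⟨Finset.univ.inf' Finset.univ_nonempty fun p : Fin m × Fin m => δ p.1 p.2,
      (Finset.lt_inf'_iff _).2 fun p _ => hδ p.1 p.2, fun w w' x hw hw' hww i j => ?_⟩
    exact H i j w w' x hw hw' (hww.trans (Finset.inf'_le _ (Finset.mem_univ (i, j))))

theorem exists_bound_α (hT : 0 < T) :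
    ∃ c : ℝ, 0 ≤ c ∧ ∀ l ∈ Finset.Icc 1 k, ∀ x i j, ‖S.α l x i j‖ ≤ c := by
  have h1 : ∀ (l : Finset.Icc 1 k) (i j : Fin m), ∃ c : ℝ, ∀ x ∈ Icc 0 T, ‖S.α l x i j‖ ≤ c :=
    fun l i j => isCompact_Icc.exists_bound_of_continuousOn
      ((S.α_continuous l l.2).matrix_elem i j).continuousOn
  choose c hc using h1
  refine ⟨∑ l, ∑ i, ∑ j, |c l i j|, by positivity, fun l hl x i j => ?_⟩
  obtain ⟨y, hy, hxy⟩ := (S.α_periodic l hl).exists_mem_Ico₀ hT x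
  rw [hxy]
  refine (hc ⟨l, hl⟩ i j y ⟨hy.1, hy.2.le⟩).trans ((le_abs_self _).trans ?_)
  refine le_trans ?_ (Finset.single_le_sum (f := fun l => ∑ i, ∑ j, |c l i j|)
    (fun _ _ => by positivity) (Finset.mem_univ ⟨l, hl⟩))
  refine le_trans ?_ (Finset.single_le_sum (f := fun i => ∑ j, |c ⟨l, hl⟩ i j|)
    (fun _ _ => by positivity) (Finset.mem_univ i))
  exact Finset.single_le_sum (f := fun j => |c ⟨l, hl⟩ i j|)
    (fun _ _ => by positivity) (Finset.mem_univ j)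

theorem continuous_map_matrix :
    Continuous fun M : Matrix (Fin m) (Fin m) 𝔽 => M.map (RCLike.map 𝔽 ℂ) :=
  continuous_id.matrix_map (RCLike.map 𝔽 ℂ).continuous

theorem exists_isBoundedCoeff (hT : 0 < T) {w : ℝ → EuclideanSpace 𝔽 (Fin m)}
    (hw : AEStronglyMeasurable w volume) {q : ℝ} (hq : ∀ᵐ x, ‖w x‖ ≤ q) :
    ∃ Q, IsBoundedCoeff k (S.linCoeff w) Q := by
  obtain ⟨c₀, h0, hc₀⟩ := S.exists_bound_jacobian hT q
  obtain ⟨c₁, h1, hc₁⟩ := S.exists_bound_α hT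
  have : TopologicalSpace.PseudoMetrizableSpace (Matrix (Fin m) (Fin m) ℂ) :=
    inferInstanceAs (TopologicalSpace.PseudoMetrizableSpace (Fin m → Fin m → ℂ))
  refine ⟨m * m * (2 * (c₀ + c₁)), fun j hj => ?_, by positivity, ?_⟩
  · rcases j with _ | j
    · exact continuous_map_matrix.comp_aestronglyMeasurable
        (S.continuous_jacobian.comp_aestronglyMeasurable
          (hw.prodMk (continuous_id (X := ℝ)).aestronglyMeasurable))
    · exact (continuous_map_matrix.comp
        (S.α_continuous (j + 1) (by simp; omega))).aestronglyMeasurable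
  · filter_upwards [hq] with x hx j hj v
    refine norm_toEuclideanLin_le (by positivity) (fun i l => ?_) v
    rcases j with _ | j
    · simp only [linCoeff, Matrix.map_apply]
      refine (norm_rclike_map_le _).trans ?_
      have := hc₀ (w x) x hx i l
      linarith
    · simp only [linCoeff, Matrix.map_apply]
      refine (norm_rclike_map_le _).trans ?_
      have := hc₁ (j + 1) (by simp; omega) x i l
      linarith

/-- Functions that are uniformly close on `[-3L/4, 3L/4]` have approximately the same
linearizations. -/
theorem exists_isPeriodicApprox (hT : 0 < T) (q : ℝ) {δ : ℝ} (hδ : 0 < δ) :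
    ∃ ε > 0, ∀ (n : ℕ) (w u : ℝ → EuclideanSpace 𝔽 (Fin m)), 1 ≤ n → (∀ᵐ x, ‖w x‖ ≤ q) →
      Function.Periodic u (n * T) →
      (∀ᵐ x, |x| ≤ 3 * (n * T) / 4 → ‖u x - w x‖ ≤ ε) →
      IsPeriodicApprox k (S.linCoeff w) (S.linCoeff u) (n * T) δ := by
  -- Tolerance per matrix entry: `m * m` is the cost of passing from entries to the operator norm,
  -- `2` that of the embedding into `ℂ`, and `+ 1` keeps the denominator positive.
  set ε' : ℝ := δ / (m * m * 2 + 1) with hε'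
  have hε0 : 0 < ε' := by positivity
  have hε1 : m * m * (2 * ε') ≤ δ := by
    rw [hε', ← mul_assoc, mul_div_assoc', div_le_iff₀ (by positivity)]
    nlinarith
  -- With tolerance `min ε 1`, the values of `u` on the window stay in the ball of radius `q + 1`.
  obtain ⟨ε, hε, H⟩ := S.exists_near_jacobian hT (q + 1) hε0
  refine ⟨min ε 1, by positivity, fun n w u hn hw hu hnear => ?_⟩
  have hn' : (0 : ℝ) < n := by exact_mod_cast hn
  refine ⟨by positivity, fun j hj x => ?_, fun j hj _ => ?_, ?_⟩
  · rcases j with _ | j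
    · have h1 : S.jacobian (u (x + n * T)) (x + n * T) = S.jacobian (u x) x := by
        rw [hu x]
        exact congrFun (S.periodic_jacobian.nat_mul n x) (u x)
      simp only [linCoeff, h1]
    · have h1 := (S.α_periodic (j + 1) (by simp; omega)).nat_mul n x
      simp only [linCoeff, h1]
  · obtain ⟨j, rfl⟩ : ∃ i, j = i + 1 := ⟨j - 1, by omega⟩
    rfl
  · filter_upwards [hw, hnear] with x hx hx' hxL v
    have h1 := hx' hxL
    have h2 : ‖u x‖ ≤ q + 1 := by
      calc ‖u x‖ = ‖w x + (u x - w x)‖ := by rw [add_sub_cancel]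
        _ ≤ _ := norm_add_le _ _
        _ ≤ q + 1 := add_le_add hx (h1.trans (min_le_right _ _))
    have h3 := H (w x) (u x) x (by linarith) h2 (by
      rw [norm_sub_rev]; exact h1.trans (min_le_left _ _))
    rw [← LinearMap.sub_apply, ← map_sub]
    refine (norm_toEuclideanLin_le (c := 2 * ε') (by positivity) (fun i l => ?_) v).trans ?_
    · simp only [linCoeff, Matrix.sub_apply, Matrix.map_apply]
      rw [← map_sub]
      refine (norm_rclike_map_le _).trans ?_
      have := h3 i l
      linarith
    · gcongr

end PeriodicSystem

end Coefficients

/-! ### Periodic pulses approach `z + v`, and resolvent points persist. -/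

namespace PeriodicSystem

variable {𝔽 : Type*} [RCLike 𝔽] {k m : ℕ} {T : ℝ} {S : PeriodicSystem 𝔽 k m T}
  {v z a u : ℝ → EuclideanSpace 𝔽 (Fin m)} {C : ℝ≥0} {n : ℕ} {χ : ℝ → ℝ}

/-- If the tails of `z` and the error are small, then the periodic pulse is close to `z + v`. -/
theorem IsPeriodicPulse.ae_norm_sub_le (h : S.IsPeriodicPulse v z C n χ a u)
    (hL : 0 < n * T) (hv : Function.Periodic v T) {ε : ℝ}
    (hz : ∀ᵐ x, n * T / 6 ≤ |x| → ‖z x‖ ≤ ε) (ha : ∀ᵐ x, ‖a x‖ ≤ ε) :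
    ∀ᵐ x, |x| ≤ 3 * (n * T) / 4 → ‖u x - (z + v) x‖ ≤ 3 * ε := by
  have hvL : Function.Periodic v (n * T) := hv.nat_mul n
  have huL := h.u_mem.1
  set L := n * T
  have h0 := (h.u_eq.and hz).and ha
  have h1 := (measurePreserving_add_right volume L).quasiMeasurePreserving.ae h0
  have h2 := (measurePreserving_sub_right volume L).quasiMeasurePreserving.ae h0
  have hχ := h.cutoff.mem_Icc
  -- For `x` outside the fundamental interval, `y = x ± L` is its representative there. Both points
  -- are at distance at least `L / 6` from the origin, so `χ y • z y`, `a y` and `z x` contribute at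
  -- most `ε` each.
  have key : ∀ x y, L / 6 ≤ |x| → ‖z x‖ ≤ ε → L / 6 ≤ |y| → y ∈ Ico (-(L / 2)) (L / 2) →
      u x = u y → v x = v y →
      ((y ∈ Ico (-(L / 2)) (L / 2) → u y = χ y • z y + v y + a y) ∧
        (L / 6 ≤ |y| → ‖z y‖ ≤ ε)) ∧ ‖a y‖ ≤ ε → ‖u x - (z + v) x‖ ≤ 3 * ε := by
    intro x y _ hzx hy hy' hu hv hP
    have e : u x - (z + v) x = χ y • z y + a y - z x := by
      rw [hu, hP.1.1 hy', Pi.add_apply, hv]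
      abel
    have hzy := hP.1.2 hy
    have h3 : ‖χ y • z y‖ ≤ ε := by
      rw [norm_smul, Real.norm_of_nonneg (hχ y).1]
      nlinarith [(hχ y).1, (hχ y).2, norm_nonneg (z y)]
    rw [e]
    linarith [norm_sub_le (χ y • z y + a y) (z x), norm_add_le (χ y • z y) (a y), hP.2]
  filter_upwards [h0, h1, h2] with x hx hxp hxm hxL
  have hxL' := abs_le.1 hxL
  by_cases hx1 : x ∈ Ico (-(L / 2)) (L / 2)
  · have e : u x - (z + v) x = (χ x - 1) • z x + a x := by
      rw [hx.1.1 hx1, Pi.add_apply, sub_smul, one_smul]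
      abel
    -- Either `|x| ≥ L / 6` and `z` is small, or the cut-off is `1` and the term vanishes.
    have h3 : ‖(χ x - 1) • z x‖ ≤ ε := by
      have hε : 0 ≤ ε := (norm_nonneg _).trans hx.2
      by_cases hx2 : L / 6 ≤ |x|
      · rw [norm_smul, Real.norm_eq_abs, abs_of_nonpos (by linarith [(hχ x).2])]
        nlinarith [(hχ x).1, (hχ x).2, norm_nonneg (z x), hx.1.2 hx2]
      · rw [h.cutoff.eq_one x (abs_le.1 (not_le.1 hx2).le)]
        simpa using hε
    have hε : 0 ≤ ε := (norm_nonneg _).trans hx.2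
    rw [e]
    linarith [norm_add_le ((χ x - 1) • z x) (a x), hx.2]
  -- From `|x| ≤ 3L/4` the representative `x ∓ L` has modulus at least `L / 4 > L / 6`. A window
  -- reaching up to `L` would meet the next copy of the pulse, where `u` is not close to `z + v`.
  · rcases le_or_gt (L / 2) x with hx2 | hx2
    · have hx3 : L / 6 ≤ |x| := le_abs.2 (Or.inl (by linarith))
      exact key x (x - L) hx3 (hx.1.2 hx3) (le_abs.2 (Or.inr (by linarith)))
        ⟨by linarith, by linarith⟩ (huL.sub_eq x).symm (hvL.sub_eq x).symm hxm
    · have hx4 : x < -(L / 2) := by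
        by_contra hc
        exact hx1 ⟨not_lt.1 hc, hx2⟩
      have hx3 : L / 6 ≤ |x| := le_abs.2 (Or.inr (by linarith))
      exact key x (x + L) hx3 (hx.1.2 hx3) (le_abs.2 (Or.inl (by linarith)))
        ⟨by linarith, by linarith⟩ (huL x).symm (hvL x).symm hxp

/-- Along a sequence of periodic pulses, the distance to `z + v` tends to zero. -/
theorem eventually_ae_norm_sub_le (hk : 1 ≤ k) (hT : 0 < T) (hv : MemHkPer k T v)
    (hz : MemHk k volume z) {N₀ : ℕ} {χ : ℕ → ℝ → ℝ} {a u : ℕ → ℝ → EuclideanSpace 𝔽 (Fin m)}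
    (hu : ∀ n ≥ N₀, S.IsPeriodicPulse v z C n (χ n) (a n) (u n)) {ε : ℝ} (hε : 0 < ε) :
    ∀ᶠ n : ℕ in atTop, ∀ᵐ x, |x| ≤ 3 * (n * T) / 4 → ‖u n x - (z + v) x‖ ≤ ε := by
  obtain ⟨C₁, hC₁⟩ := exists_enorm_le_hkNorm_compl (EuclideanSpace 𝔽 (Fin m)) hT
  obtain ⟨C₂, hC₂⟩ := exists_enorm_le_hkNorm_per (EuclideanSpace 𝔽 (Fin m)) hT
  have hε3 : ENNReal.ofReal (ε / 3) ≠ 0 := by simpa using hε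
  have r0 : Tendsto (fun n : ℕ => (n : ℝ) * T / 6) atTop atTop :=
    (tendsto_natCast_atTop_atTop.atTop_mul_const hT).atTop_div_const (by norm_num)
  -- The shift by `T` accounts for the loss of radius in `exists_enorm_le_hkNorm_compl`.
  have r1 : Tendsto (fun n : ℕ => (n : ℝ) * T / 6 - T) atTop atTop :=
    tendsto_atTop_add_const_right _ _ r0
  have l1 : ∀ᶠ n : ℕ in atTop, C₁ * hkNorm k (Ioo (-(n * T / 6 - T)) (n * T / 6 - T))ᶜ z <
      ENNReal.ofReal (ε / 3) := by
    have := ENNReal.Tendsto.const_mul (a := (C₁ : ℝ≥0∞)) (tendsto_hkNorm_compl hz r1)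
      (Or.inr ENNReal.coe_ne_top)
    rw [mul_zero] at this
    exact this.eventually_lt_const (pos_iff_ne_zero.2 hε3)
  have l2 : ∀ᶠ n : ℕ in atTop, (C₂ * C : ℝ≥0∞) * hkNorm k (Ioo (-(n * T / 6)) (n * T / 6))ᶜ z <
      ENNReal.ofReal (ε / 3) := by
    have := ENNReal.Tendsto.const_mul (a := (C₂ * C : ℝ≥0∞)) (tendsto_hkNorm_compl hz r0)
      (Or.inr (by simp [ENNReal.mul_eq_top]))
    rw [mul_zero] at this
    exact this.eventually_lt_const (pos_iff_ne_zero.2 hε3)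
  have conv : ∀ w : EuclideanSpace 𝔽 (Fin m), ‖w‖ₑ ≤ ENNReal.ofReal (ε / 3) → ‖w‖ ≤ ε / 3 :=
    fun w hw => by
      rwa [← ofReal_norm, ENNReal.ofReal_le_ofReal_iff (by positivity)] at hw
  filter_upwards [l1, l2, eventually_ge_atTop N₀, eventually_ge_atTop 1] with n h1 h2 hn hn1
  have hn1' : (1 : ℝ) ≤ n := by exact_mod_cast hn1
  have hTL : T ≤ n * T := by nlinarith
  have := (hu n hn).ae_norm_sub_le (hT.trans_le hTL) hv.1 (ε := ε / 3) (by
    filter_upwards [hC₁ z k hk hz.1 (n * T / 6)] with x hx hxr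
    exact conv _ ((hx hxr).trans h1.le)) (by
    filter_upwards [hC₂ (a n) k hk _ hTL (hu n hn).a_mem] with x hx
    refine conv _ (hx.trans (le_trans ?_ h2.le))
    rw [mul_assoc]
    gcongr
    exact (hu n hn).a_le)
  simpa [mul_div_cancel₀] using this

theorem ae_norm_le_of_enorm_le {w : ℝ → EuclideanSpace 𝔽 (Fin m)} {c : ℝ≥0∞} (hc : c ≠ ⊤)
    (h : ∀ᵐ x, ‖w x‖ₑ ≤ c) : ∀ᵐ x, ‖w x‖ ≤ c.toReal := by
  filter_upwards [h] with x hx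
  rw [← toReal_enorm]
  exact ENNReal.toReal_mono hc hx

theorem exists_ae_norm_le_of_memHkPer (hk : 1 ≤ k) (hT : 0 < T) {L : ℝ} (hL : T ≤ L)
    (hu : MemHkPer k L u) : ∃ q : ℝ, ∀ᵐ x, ‖u x‖ ≤ q := by
  obtain ⟨C₂, hC₂⟩ := exists_enorm_le_hkNorm_per (EuclideanSpace 𝔽 (Fin m)) hT
  exact ⟨_, ae_norm_le_of_enorm_le
    (ENNReal.mul_ne_top ENNReal.coe_ne_top (hkNorm_ne_top hu.2.2)) (hC₂ u k hk L hL hu)⟩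

/-- With radius `0` and interval length `1`, the removed interval has endpoints `1` and `-1` in the
wrong order and is empty, so the tail estimate is a bound on the whole line. -/
theorem exists_ae_norm_le_of_memHk (hk : 1 ≤ k) (hz : MemHk k volume z) :
    ∃ q : ℝ, ∀ᵐ x, ‖z x‖ ≤ q := by
  obtain ⟨C₁, hC₁⟩ := exists_enorm_le_hkNorm_compl (EuclideanSpace 𝔽 (Fin m)) one_pos
  exact ⟨_, ae_norm_le_of_enorm_le (ENNReal.mul_ne_top ENNReal.coe_ne_top
    (hkNorm_ne_top fun j hj => (hz.2 j hj).restrict _))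
    ((hC₁ z k hk hz.1 0).mono fun x hx => hx (abs_nonneg x))⟩

/-- Resolvent points of the linearization about `z + v` are, locally uniformly, resolvent points
of the linearizations about periodic pulses of large period. -/
theorem eventually_mem_resolventSet (hk : 1 ≤ k) (hT : 0 < T) (hv : MemHkPer k T v)
    (hz : MemHk k volume z) {N₀ : ℕ} {χ : ℕ → ℝ → ℝ} {a u : ℕ → ℝ → EuclideanSpace 𝔽 (Fin m)}
    (hu : ∀ n ≥ N₀, S.IsPeriodicPulse v z C n (χ n) (a n) (u n)) {lam : ℂ}
    (h : lam ∈ resolventSet (S.linOp (z + v))) :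
    ∃ δ > 0, ∀ᶠ n : ℕ in atTop, ∀ lam', ‖lam - lam'‖ ≤ δ →
      lam' ∈ resolventSet (S.linOp (u n)) ∧ lam' ∈ resolventSet (S.linOpPer (n * T) (u n)) := by
  obtain ⟨q₁, hq₁⟩ := exists_ae_norm_le_of_memHk hk hz
  obtain ⟨q₂, hq₂⟩ := exists_ae_norm_le_of_memHkPer hk hT le_rfl hv
  have hq : ∀ᵐ x, ‖(z + v) x‖ ≤ q₁ + q₂ := by
    filter_upwards [hq₁, hq₂] with x h1 h2
    exact (norm_add_le _ _).trans (add_le_add h1 h2)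
  obtain ⟨Q, hQ⟩ := S.exists_isBoundedCoeff hT
    (hz.1.1.aestronglyMeasurable.add hv.2.1.1.aestronglyMeasurable) hq
  obtain ⟨δ, hδ, Λ, hΛ⟩ := exists_forall_mem_resolventSet_of_approx hQ h
  obtain ⟨ε, hε, happ⟩ := S.exists_isPeriodicApprox hT (q₁ + q₂) hδ
  refine ⟨δ, hδ, ?_⟩
  filter_upwards [eventually_ae_norm_sub_le hk hT hv hz hu hε, eventually_ge_atTop N₀,
    eventually_ge_atTop 1,
    (tendsto_natCast_atTop_atTop.atTop_mul_const hT).eventually_ge_atTop Λ]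
    with n h1 hn hn1 hnΛ lam' hlam
  have hn1' : (1 : ℝ) ≤ n := by exact_mod_cast hn1
  have hun := (hu n hn).u_mem
  -- These bounds may depend on `n`: boundedness of the perturbed coefficients enters only
  -- qualitatively, not through `δ` or `Λ`.
  obtain ⟨q, hq'⟩ := exists_ae_norm_le_of_memHkPer hk hT (by nlinarith) hun
  obtain ⟨Q', hQ'⟩ := S.exists_isBoundedCoeff hT hun.2.1.1.aestronglyMeasurable hq'
  exact hΛ _ _ _ _ hnΛ hQ' (happ n _ _ hn1 hq hun.1 h1) hlam

/-- Finitely many neighbourhoods from `eventually_mem_resolventSet` cover `K`, and their finitely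
many thresholds for `n` have a common upper bound. -/
theorem eventually_forall_mem_resolventSet (hk : 1 ≤ k) (hT : 0 < T) (hv : MemHkPer k T v)
    (hz : MemHk k volume z) {N₀ : ℕ} {χ : ℕ → ℝ → ℝ} {a u : ℕ → ℝ → EuclideanSpace 𝔽 (Fin m)}
    (hu : ∀ n ≥ N₀, S.IsPeriodicPulse v z C n (χ n) (a n) (u n)) {K : Set ℂ} (hK : IsCompact K)
    (h : K ⊆ resolventSet (S.linOp (z + v))) :
    ∀ᶠ n : ℕ in atTop, ∀ lam ∈ K,
      lam ∈ resolventSet (S.linOp (u n)) ∧ lam ∈ resolventSet (S.linOpPer (n * T) (u n)) := by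
  refine hK.induction_on (p := fun s => ∀ᶠ n : ℕ in atTop, ∀ lam ∈ s,
    lam ∈ resolventSet (S.linOp (u n)) ∧ lam ∈ resolventSet (S.linOpPer (n * T) (u n)))
    (by simp) (fun s t hst ht => ht.mono fun n hn lam hl => hn lam (hst hl))
    (fun s t hs ht => ?_) (fun lam hlam => ?_)
  · filter_upwards [hs, ht] with n h1 h2 lam hl
    exact hl.elim (h1 lam) (h2 lam)
  · obtain ⟨δ, hδ, hn⟩ := eventually_mem_resolventSet hk hT hv hz hu (h hlam)
    refine ⟨Metric.closedBall lam δ, mem_nhdsWithin_of_mem_nhds (Metric.closedBall_mem_nhds _ hδ),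
      hn.mono fun n hn lam' hl => hn lam' ?_⟩
    rwa [Metric.mem_closedBall, dist_comm, dist_eq_norm] at hl

end PeriodicSystem

/-! ### Conclusion: from resolvent points on a compact set to spectral stability. -/

/-- A family of operators whose unstable spectrum stays in a compact set that eventually consists
of resolvent points is eventually spectrally stable. -/
theorem exists_forall_spec_subset {X : ℕ → Type*} [∀ n, NormedAddCommGroup (X n)]
    [∀ n, NormedSpace ℂ (X n)] {A : ∀ n, X n →ₗ.[ℂ] X n} {K : Set ℂ} {N : ℕ}
    (hN : ∀ n ≥ N, spec (A n) ∩ {lam : ℂ | 0 ≤ lam.re} ⊆ K)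
    (h : ∀ᶠ n in atTop, ∀ lam ∈ K ∩ {lam : ℂ | 0 ≤ lam.re}, lam ∈ resolventSet (A n)) :
    ∃ N₁ ≥ N, ∀ n ≥ N₁, spec (A n) ⊆ {lam : ℂ | lam.re < 0} := by
  obtain ⟨N₁, hN₁⟩ := eventually_atTop.1 h
  refine ⟨max N N₁, le_max_left _ _, fun n hn lam hlam => ?_⟩
  by_contra hc
  have hre : 0 ≤ lam.re := not_lt.1 hc
  exact hlam (hN₁ n (le_of_max_le_right hn) lam
    ⟨hN n (le_of_max_le_left hn) ⟨hlam, hre⟩, hre⟩)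

end PeriodicPulse

theorem mainTheorem7 {𝔽 : Type*} [RCLike 𝔽] {k m : ℕ} (hk : 1 ≤ k) (hm : 1 ≤ m)
    {T : ℝ} (hT : 0 < T) (S : PeriodicPulse.PeriodicSystem 𝔽 k m T)
    (v z : ℝ → EuclideanSpace 𝔽 (Fin m))
    (hv : PeriodicPulse.MemHkPer k T v) (hz : PeriodicPulse.MemHk k volume z)
    (hv_sol : S.IsSolution v) (hzv_sol : S.IsSolution (z + v))
    (hzv_nondeg : S.Nondegenerate (z + v))
    (hzv_stable : S.StronglySpectrallyStable (z + v))
    (C : ℝ≥0) (N₀ : ℕ) (hN₀ : 1 ≤ N₀)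
    (χ : ℕ → ℝ → ℝ) (a u : ℕ → ℝ → EuclideanSpace 𝔽 (Fin m))
    (hu : ∀ n ≥ N₀, S.IsPeriodicPulse v z C n (χ n) (a n) (u n)) :
    (∀ K : Set ℂ, IsCompact K → ∀ N ≥ N₀,
      (∀ n ≥ N, PeriodicPulse.spec (S.linOp (u n)) ∩ {lam : ℂ | 0 ≤ lam.re} ⊆ K) →
      ∃ N₁ ≥ N, ∀ n ≥ N₁,
        PeriodicPulse.spec (S.linOp (u n)) ⊆ {lam : ℂ | lam.re < 0}) ∧
    (∀ K : Set ℂ, IsCompact K → ∀ N ≥ N₀,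
      (∀ n ≥ N, PeriodicPulse.spec (S.linOpPer (n * T) (u n)) ∩ {lam : ℂ | 0 ≤ lam.re} ⊆ K) →
      ∃ N₁ ≥ N, ∀ n ≥ N₁,
        PeriodicPulse.spec (S.linOpPer (n * T) (u n)) ⊆ {lam : ℂ | lam.re < 0}) := by
  obtain ⟨ϱ, hϱ, hstab⟩ := hzv_stable
  -- The intersection with the closed half-plane is needed because `K` itself may meet the spectrum
  -- of the limit operator; the intersection is compact and, by strong stability, consists of
  -- resolvent points.
  have h : ∀ K : Set ℂ, IsCompact K → ∀ᶠ n : ℕ in Filter.atTop, ∀ lam ∈ K ∩ {lam : ℂ | 0 ≤ lam.re},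
      lam ∈ PeriodicPulse.resolventSet (S.linOp (u n)) ∧
        lam ∈ PeriodicPulse.resolventSet (S.linOpPer (n * T) (u n)) := fun K hK =>
    PeriodicPulse.PeriodicSystem.eventually_forall_mem_resolventSet hk hT hv hz hu
      (hK.inter_right (isClosed_le continuous_const Complex.continuous_re)) fun lam hlam => by
        by_contra hc
        have h1 : lam.re ≤ -ϱ := hstab hc
        have h2 : 0 ≤ lam.re := hlam.2
        linarith
  exact ⟨fun K hK N _ hN => PeriodicPulse.exists_forall_spec_subset hN
      ((h K hK).mono fun n hn lam hl => (hn lam hl).1),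
    fun K hK N _ hN => PeriodicPulse.exists_forall_spec_subset hN
      ((h K hK).mono fun n hn lam hl => (hn lam hl).2)⟩
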